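/- Let $\mathrm{FOC}(\{>\})$ be first-order logic with counting over the signature of graphs: formulas are built from $x=y$, $E(x,y)$, $\neg$, $\vee$, $\exists$ and comparisons $t_1>t_2$ of counting terms, and counting terms are built from integers $N\in\mathbb Z$ and terms $\#(y_1,\dots,y_k)\,\varphi$ (the number of tuples that satisfy $\varphi$) by addition, subtraction and multiplication. The length $|\varphi|$ is the number of symbols of $\varphi$, where every number symbol has length one. For $\lambda>1$, a formula $\varphi'$ is $\lambda$-similar to $\varphi$ if it is obtained from $\varphi$ by replacing each atomic counting term $N\in\mathbb Z$ by some $N'\in\mathbb Z$ with $N/\lambda\le N'\le\lambda N$. A sentence $\varphi$ is $\lambda$-stable on $G$ if for every $\varphi'$ that is $\lambda$-similar to $\varphi$ we have $G\models\varphi$ if and only if $G\models\varphi'$; otherwise $\varphi$ is $\lambda$-unstable on $G$. Let $\mathrm L$ be the fragment of $\mathrm{FOC}(\{>\})$ obtained by extending first-order logic by any one of the following four rules, where $y$ and $z$ are arbitrary variables (distinct in rule 4): 1. if $\varphi_1,\varphi_2$ are formulas, then $1\cdot\#y\,\varphi_1>1\cdot\#z\,\varphi_2$ is a formula; 2. if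 $\varphi_1,\varphi_2$ are formulas and $N\in\mathbb Z$, then $\#y\,\varphi_1-\#z\,\varphi_2>N$ is a formula; 3. if $\varphi_1,\varphi_2$ are formulas and $N\in\mathbb Z$, then $\#y\,\varphi_1\cdot\#z\,\varphi_2>N$ is a formula; 4. if $\varphi$ is a formula and $N\in\mathbb Z$, then $\#(y,z)\,\varphi>N$ is a formula. Unless $\mathrm{AW}[*]\subseteq\mathrm{FPT}$, there is no algorithm with the following properties. It gets as input a sentence $\varphi\in\mathrm L$ and a tree $T$ of depth $9$ (that is, $T$ can be rooted so that the longest path from the root to a leaf has exactly $9$ vertices), it runs in time at most $f(|\varphi|)\,|T|^c$ for some function $f$ and some constant $c$, where $|T|$ is the number of vertices of $T$, and it returns $1$, $0$ or $\bot$, such that - if it returns $1$, then $T\models\varphi$; - if it returns $0$, then $T\not\models\varphi$; - if it returns $\bot$, then $\varphi$ is $2^{\sqrt{\log_2|T|}}$-unstable on $T$. Here algorithms are random access machines with uniform cost measure whose arithmetic operations are addition, truncated subtraction and halving; every symbol of $\varphi$ (in particular every variable and every number) is given in a constant number of machine words. $\mathrm{FPT}$ is the class of parameterized problems that one program decides in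 time $f(k)\,|x|^c$ for some function $f$ and constant $c$. $\mathrm{AW}[*]$ is the union over $t\ge1$ of the classes $\mathrm{AW}[t]$ of the problems that are fpt many-one reducible to parameterized $\mathrm{QBFSAT}_t$ (given disjoint sets $s_1,\dots,s_r$ of Boolean variables, numbers $k_1,\dots,k_r$ and a $t$-normalized formula $F$ over these variables, with parameter $r,k_1,\dots,k_r$: is there a $k_1$-subset of $s_1$ such that for every $k_2$-subset of $s_2$ there is a $k_3$-subset of $s_3$ …, such that $F$ holds when exactly the chosen variables are true?). -/

import Mathlib

/-! ## Random access machines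

The model of computation is the random access machine with uniform cost measure, with addition,
truncated subtraction and halving as its arithmetic operations (no multiplication, so that it is
polynomially equivalent to Turing machines).  Control flow is structured. -/

namespace RAM

/-- A configuration: registers `R_0, R_1, …` and memory cells `M[0], M[1], …`, all of them
holding natural numbers. -/
structure State where
  reg : ℕ → ℕ
  mem : ℕ → ℕ

/-- Programs.  A program mentions only finitely many registers; the memory is addressed
indirectly, through registers. -/
inductive Prog : Type
  /-- do nothing -/
  | skip : Prog
  /-- `R_i := k` -/
  | const (i k : ℕ) : Prog
  /-- `R_i := R_j + R_l` -/
  | add (i j l : ℕ) : Prog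
  /-- `R_i := R_j - R_l`, cut off at zero -/
  | sub (i j l : ℕ) : Prog
  /-- `R_i := R_j / 2`, rounded down -/
  | half (i j : ℕ) : Prog
  /-- `R_i := M[R_j]` -/
  | load (i j : ℕ) : Prog
  /-- `M[R_i] := R_j` -/
  | store (i j : ℕ) : Prog
  /-- first `P`, then `Q` -/
  | seq (P Q : Prog) : Prog
  /-- if `R_i ≠ 0` then `P` else `Q` -/
  | ite (i : ℕ) (P Q : Prog) : Prog
  /-- while `R_i ≠ 0` do `P` -/
  | loop (i : ℕ) (P : Prog) : Prog

/-- Write `v` into register `i`. -/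
def State.setReg (s : State) (i v : ℕ) : State := { s with reg := Function.update s.reg i v }

/-- Write `v` into memory cell `a`. -/
def State.setMem (s : State) (a v : ℕ) : State := { s with mem := Function.update s.mem a v }

/-- `Exec P s t s'`: started in `s`, the program `P` halts after exactly `t` steps in `s'`.
Every elementary instruction and every evaluation of a test is one step. -/
inductive Exec : Prog → State → ℕ → State → Prop
  | skip (s : State) : Exec .skip s 1 s
  | const (s : State) (i k : ℕ) : Exec (.const i k) s 1 (s.setReg i k)
  | add (s : State) (i j l : ℕ) : Exec (.add i j l) s 1 (s.setReg i (s.reg j + s.reg l))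
  | sub (s : State) (i j l : ℕ) : Exec (.sub i j l) s 1 (s.setReg i (s.reg j - s.reg l))
  | half (s : State) (i j : ℕ) : Exec (.half i j) s 1 (s.setReg i (s.reg j / 2))
  | load (s : State) (i j : ℕ) : Exec (.load i j) s 1 (s.setReg i (s.mem (s.reg j)))
  | store (s : State) (i j : ℕ) : Exec (.store i j) s 1 (s.setMem (s.reg i) (s.reg j))
  | seq {P Q : Prog} {s s' s'' : State} {t t' : ℕ} :
      Exec P s t s' → Exec Q s' t' s'' → Exec (.seq P Q) s (t + t') s''
  | ite_true {i : ℕ} {P Q : Prog} {s s' : State} {t : ℕ} :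
      s.reg i ≠ 0 → Exec P s t s' → Exec (.ite i P Q) s (t + 1) s'
  | ite_false {i : ℕ} {P Q : Prog} {s s' : State} {t : ℕ} :
      s.reg i = 0 → Exec Q s t s' → Exec (.ite i P Q) s (t + 1) s'
  | loop_done {i : ℕ} {P : Prog} {s : State} :
      s.reg i = 0 → Exec (.loop i P) s 1 s
  | loop_step {i : ℕ} {P : Prog} {s s' s'' : State} {t t' : ℕ} :
      s.reg i ≠ 0 → Exec P s t s' → Exec (.loop i P) s' t' s'' →
      Exec (.loop i P) s (t + t' + 1) s''

/-- The initial configuration on an input that is a list of words: the words stand in the first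
memory cells, their number in `R_0`, and everything else is zero. -/
def init (w : List ℕ) : State where
  reg := fun i => if i = 0 then w.length else 0
  mem := fun a => w.getD a 0

/-- On input `w`, the program `P` halts after `t` steps with the number `v` in `R_0`. -/
def Returns (P : Prog) (w : List ℕ) (t v : ℕ) : Prop :=
  ∃ s : State, Exec P (init w) t s ∧ s.reg 0 = v

/-- On input `w`, the program `P` halts after `t` steps with the list of words `u` as output:
the length of `u` stands in `R_0`, its entries stand in the first memory cells. -/
def Writes (P : Prog) (w : List ℕ) (t : ℕ) (u : List ℕ) : Prop :=
  ∃ s : State, Exec P (init w) t s ∧ s.reg 0 = u.length ∧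
    ∀ (a : ℕ) (h : a < u.length), s.mem a = u[a]

end RAM

/-! ## Parameterized complexity: `FPT` and `AW[*]` -/

namespace ParamComplexity

/-- A parameterized problem: a set of pairs of a binary string and a parameter. -/
abbrev Problem : Type := Set (List Bool × ℕ)

/-- The words given to a machine for the instance `(x, k)`. -/
def inputWords (p : List Bool × ℕ) : List ℕ := p.2 :: p.1.map Bool.toNat

/-- `FPT`: the problems decided by one program in time `f(k) · |x|^c` for some function `f` and
constant `c`.  (One is added to `|x|` only for the sake of the empty string.) -/
def FPT : Set Problem :=
  {L | ∃ (P : RAM.Prog) (f : ℕ → ℕ) (c : ℕ), ∀ p : List Bool × ℕ, ∃ t v : ℕ,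
    RAM.Returns P (inputWords p) t v ∧ t ≤ f p.2 * (p.1.length + 1) ^ c ∧
    (p ∈ L → v = 1) ∧ (p ∉ L → v = 0)}

/-- A concrete parameterized problem: instances with their encoding as binary strings, their
parameter, and the set of yes-instances. -/
structure ConcreteProblem where
  Inst : Type
  encode : Inst → List Bool
  param : Inst → ℕ
  yes : Set Inst

/-- `L` is fpt many-one reducible to `C`: a map `R` of the instances of `L` to instances of `C`
preserves the answer, the new parameter is bounded in terms of the old one, and one program
computes the map in time `f(k) · |x|^c`.  (The length of the output is counted as well, since the
cells of the memory are zero without having been written.) -/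
def FPTReducible (L : Problem) (C : ConcreteProblem) : Prop :=
  ∃ (R : List Bool × ℕ → C.Inst) (P : RAM.Prog) (f g : ℕ → ℕ) (c : ℕ), ∀ p : List Bool × ℕ,
    (p ∈ L ↔ R p ∈ C.yes) ∧ C.param (R p) ≤ g p.2 ∧
    ∃ t : ℕ, RAM.Writes P (inputWords p) t ((C.encode (R p)).map Bool.toNat) ∧
      t + (C.encode (R p)).length ≤ f p.2 * (p.1.length + 1) ^ c

/-- A Boolean variable `(i, j)`: the `j`-th variable of the `i`-th set. -/
abbrev BVar : Type := ℕ × ℕ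

/-- The data of a propositional formula with `t` alternating levels of unbounded conjunctions and
disjunctions above the literals.  In a literal `(x, b)` the bit `b` tells whether the variable
`x` occurs positively. -/
def Levels : ℕ → Type
  | 0 => BVar × Bool
  | t + 1 => List (Levels t)

/-- Truth of such a formula under the assignment that makes exactly the variables in `S` true;
`conj` tells whether the topmost level is a conjunction (otherwise it is a disjunction). -/
def Levels.Holds (S : Set BVar) : (t : ℕ) → (conj : Bool) → Levels t → Prop
  | 0, _, ((x, b) : BVar × Bool) => x ∈ S ↔ b = true
  | t + 1, true, (F : List (Levels t)) => ∀ H ∈ F, Levels.Holds S t false H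
  | t + 1, false, (F : List (Levels t)) => ∃ H ∈ F, Levels.Holds S t true H

/-- The variables of such a formula. -/
def Levels.vars : (t : ℕ) → Levels t → Set BVar
  | 0, ((x, _) : BVar × Bool) => {x}
  | t + 1, (F : List (Levels t)) => {x | ∃ H ∈ F, x ∈ Levels.vars t H}

def Levels.words : (t : ℕ) → Levels t → List ℕ
  | 0, (((i, j), b) : BVar × Bool) => [i, j, b.toNat]
  | t + 1, (F : List (Levels t)) => F.length :: F.flatMap (Levels.words t)

/-- A list of numbers as a binary string, each number written in unary and closed by a zero. -/
def unary (w : List ℕ) : List Bool := w.flatMap fun n => List.replicate n true ++ [false]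

/-- An instance of parameterized `QBFSAT_t`: disjoint sets `s_0, …, s_{r-1}` of Boolean variables,
numbers `k_0, …, k_{r-1}`, and a `t`-normalized formula (a conjunction of disjunctions of
conjunctions … of literals, with `t` levels) over the variables in these sets.
The `i`-th entry of `blocks` is the pair `(|s_i|, k_i)`, and `s_i = {(i, j) | j < |s_i|}`. -/
structure QBF (t : ℕ) where
  blocks : List (ℕ × ℕ)
  formula : Levels t
  vars_mem : ∀ x ∈ Levels.vars t formula, ∃ h : x.1 < blocks.length, x.2 < (blocks[x.1]).1

/-- The alternating quantification: `∃ t_i ⊆ s_i` of size `k_i` for even `i`, `∀ t_i ⊆ s_i` of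
size `k_i` for odd `i`; the argument `i` is the index of the first of the given blocks, and `S` is
the set of the variables made true so far. -/
def Alternate (φ : Set BVar → Prop) : (i : ℕ) → List (ℕ × ℕ) → Set BVar → Prop
  | _, [], S => φ S
  | i, (m, k) :: bs, S =>
    if Even i then
      ∃ u ⊆ Finset.range m, u.card = k ∧ Alternate φ (i + 1) bs (S ∪ {x | x.1 = i ∧ x.2 ∈ u})
    else
      ∀ u ⊆ Finset.range m, u.card = k → Alternate φ (i + 1) bs (S ∪ {x | x.1 = i ∧ x.2 ∈ u})

/-- Parameterized `QBFSAT_t`.  The parameter `r, k_0, …, k_{r-1}` is represented by the number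
`r + k_0 + ⋯ + k_{r-1}`. -/
def QBFSAT (t : ℕ) : ConcreteProblem where
  Inst := QBF t
  encode I := unary (I.blocks.length ::
    (I.blocks.flatMap (fun b => [b.1, b.2]) ++ Levels.words t I.formula))
  param I := I.blocks.length + (I.blocks.map Prod.snd).sum
  yes := {I | Alternate (fun S => Levels.Holds S t true I.formula) 0 I.blocks ∅}

/-- `AW[t]`: the problems that are fpt-reducible to parameterized `QBFSAT_t`. -/
def AW (t : ℕ) : Set Problem := {L | FPTReducible L (QBFSAT t)}

/-- `AW[*]`, the union of the classes `AW[t]`. -/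
def AWStar : Set Problem := {L | ∃ t ≥ 1, L ∈ AW t}

end ParamComplexity

/-! ## The counting logic `FOC({>})` on graphs -/

namespace FOC

mutual
/-- Formulas of `FOC({>})` in the signature of graphs. -/
inductive Formula : Type
  | eq (x y : ℕ) : Formula
  | adj (x y : ℕ) : Formula
  | neg (φ : Formula) : Formula
  | or (φ ψ : Formula) : Formula
  | ex (y : ℕ) (φ : Formula) : Formula
  | gt (s t : Term) : Formula
/-- Counting terms of `FOC({>})`; `count [y_1, …, y_k] φ` is `#(y_1, …, y_k) φ`. -/
inductive Term : Type
  | const (N : ℤ) : Term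
  | count (ys : List ℕ) (φ : Formula) : Term
  | add (s t : Term) : Term
  | sub (s t : Term) : Term
  | mul (s t : Term) : Term
end

/-- The assignment `β[a / ys]`. -/
def assign {V : Type} (β : ℕ → V) (ys : List ℕ) (a : Fin ys.length → V) : ℕ → V :=
  fun z => if h : z ∈ ys then a ⟨ys.idxOf z, List.idxOf_lt_length_of_mem h⟩ else β z

mutual
/-- `(G, β) ⊨ φ`. -/
noncomputable def Formula.Sat {V : Type} (G : SimpleGraph V) : Formula → (ℕ → V) → Prop
  | .eq x y, β => β x = β y
  | .adj x y, β => G.Adj (β x) (β y)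
  | .neg φ, β => ¬ Formula.Sat G φ β
  | .or φ ψ, β => Formula.Sat G φ β ∨ Formula.Sat G ψ β
  | .ex y φ, β => ∃ a : V, Formula.Sat G φ (Function.update β y a)
  | .gt s t, β => Term.val G s β > Term.val G t β
/-- The value of a counting term. -/
noncomputable def Term.val {V : Type} (G : SimpleGraph V) : Term → (ℕ → V) → ℤ
  | .const N, _ => N
  | .count ys φ, β =>
      (Nat.card {a : Fin ys.length → V // Formula.Sat G φ (assign β ys a)} : ℤ)
  | .add s t, β => Term.val G s β + Term.val G t β
  | .sub s t, β => Term.val G s β - Term.val G t β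
  | .mul s t, β => Term.val G s β * Term.val G t β
end

mutual
/-- Free variables. -/
def Formula.free : Formula → Finset ℕ
  | .eq x y => {x, y}
  | .adj x y => {x, y}
  | .neg φ => Formula.free φ
  | .or φ ψ => Formula.free φ ∪ Formula.free ψ
  | .ex y φ => (Formula.free φ).erase y
  | .gt s t => Term.free s ∪ Term.free t
def Term.free : Term → Finset ℕ
  | .const _ => ∅
  | .count ys φ => Formula.free φ \ ys.toFinset
  | .add s t => Term.free s ∪ Term.free t
  | .sub s t => Term.free s ∪ Term.free t
  | .mul s t => Term.free s ∪ Term.free t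
end

mutual
/-- The length `|φ|`: the number of symbols (in prefix notation, without brackets and commas).
A number symbol has length one, whatever its size. -/
def Formula.length : Formula → ℕ
  | .eq _ _ => 3
  | .adj _ _ => 3
  | .neg φ => Formula.length φ + 1
  | .or φ ψ => Formula.length φ + Formula.length ψ + 1
  | .ex _ φ => Formula.length φ + 2
  | .gt s t => Term.length s + Term.length t + 1
def Term.length : Term → ℕ
  | .const _ => 1
  | .count ys φ => Formula.length φ + ys.length + 1
  | .add s t => Term.length s + Term.length t + 1
  | .sub s t => Term.length s + Term.length t + 1
  | .mul s t => Term.length s + Term.length t + 1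
end

def Formula.IsSentence (φ : Formula) : Prop := φ.free = ∅

/-- `G ⊨ φ`, for a sentence `φ`. -/
def Models {V : Type} (G : SimpleGraph V) (φ : Formula) : Prop := ∀ β : ℕ → V, φ.Sat G β

/-! ### Similarity and stability -/

mutual
/-- `Formula.Similar lam φ φ'`: the formula `φ'` is obtained from `φ` by replacing each atomic
counting term `N ∈ ℤ` by some `N' ∈ ℤ` with `N / lam ≤ N' ≤ lam * N`. -/
inductive Formula.Similar (lam : ℝ) : Formula → Formula → Prop
  | eq (x y : ℕ) : Formula.Similar lam (.eq x y) (.eq x y)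
  | adj (x y : ℕ) : Formula.Similar lam (.adj x y) (.adj x y)
  | neg {φ φ' : Formula} : Formula.Similar lam φ φ' → Formula.Similar lam (.neg φ) (.neg φ')
  | or {φ φ' ψ ψ' : Formula} : Formula.Similar lam φ φ' → Formula.Similar lam ψ ψ' →
      Formula.Similar lam (.or φ ψ) (.or φ' ψ')
  | ex (y : ℕ) {φ φ' : Formula} : Formula.Similar lam φ φ' →
      Formula.Similar lam (.ex y φ) (.ex y φ')
  | gt {s s' t t' : Term} : Term.Similar lam s s' → Term.Similar lam t t' →
      Formula.Similar lam (.gt s t) (.gt s' t')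
inductive Term.Similar (lam : ℝ) : Term → Term → Prop
  | const {N N' : ℤ} : (N : ℝ) / lam ≤ (N' : ℝ) → (N' : ℝ) ≤ lam * (N : ℝ) →
      Term.Similar lam (.const N) (.const N')
  | count (ys : List ℕ) {φ φ' : Formula} : Formula.Similar lam φ φ' →
      Term.Similar lam (.count ys φ) (.count ys φ')
  | add {s s' t t' : Term} : Term.Similar lam s s' → Term.Similar lam t t' →
      Term.Similar lam (.add s t) (.add s' t')
  | sub {s s' t t' : Term} : Term.Similar lam s s' → Term.Similar lam t t' →
      Term.Similar lam (.sub s t) (.sub s' t')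
  | mul {s s' t t' : Term} : Term.Similar lam s s' → Term.Similar lam t t' →
      Term.Similar lam (.mul s t) (.mul s' t')
end

/-- The sentence `φ` is `lam`-stable on `G`. -/
def Stable {V : Type} (lam : ℝ) (G : SimpleGraph V) (φ : Formula) : Prop :=
  ∀ φ' : Formula, φ.Similar lam φ' → (Models G φ ↔ Models G φ')

/-- The sentence `φ` is `lam`-unstable on `G`. -/
def Unstable {V : Type} (lam : ℝ) (G : SimpleGraph V) (φ : Formula) : Prop := ¬ Stable lam G φ

/-! ### The four extensions of first-order logic -/

/-- The four formation rules by which first-order logic is extended. -/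
inductive Rule : Type
  | comparison | subtraction | product | pairs

/-- `Fragment ρ φ`: the formula `φ` belongs to the extension of first-order logic by the
rule `ρ`. -/
inductive Fragment : Rule → Formula → Prop
  | eq (ρ : Rule) (x y : ℕ) : Fragment ρ (.eq x y)
  | adj (ρ : Rule) (x y : ℕ) : Fragment ρ (.adj x y)
  | neg {ρ : Rule} {φ : Formula} : Fragment ρ φ → Fragment ρ (.neg φ)
  | or {ρ : Rule} {φ ψ : Formula} : Fragment ρ φ → Fragment ρ ψ → Fragment ρ (.or φ ψ)
  | ex {ρ : Rule} (y : ℕ) {φ : Formula} : Fragment ρ φ → Fragment ρ (.ex y φ)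
  /-- `1 · #y φ₁ > 1 · #z φ₂` -/
  | comparison (y z : ℕ) {φ₁ φ₂ : Formula} :
      Fragment .comparison φ₁ → Fragment .comparison φ₂ →
      Fragment .comparison
        (.gt (.mul (.const 1) (.count [y] φ₁)) (.mul (.const 1) (.count [z] φ₂)))
  /-- `#y φ₁ - #z φ₂ > N` -/
  | subtraction (y z : ℕ) {φ₁ φ₂ : Formula} (N : ℤ) :
      Fragment .subtraction φ₁ → Fragment .subtraction φ₂ →
      Fragment .subtraction (.gt (.sub (.count [y] φ₁) (.count [z] φ₂)) (.const N))
  /-- `#y φ₁ · #z φ₂ > N` -/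
  | product (y z : ℕ) {φ₁ φ₂ : Formula} (N : ℤ) :
      Fragment .product φ₁ → Fragment .product φ₂ →
      Fragment .product (.gt (.mul (.count [y] φ₁) (.count [z] φ₂)) (.const N))
  /-- `#(y, z) φ > N` -/
  | pairs (y z : ℕ) {φ : Formula} (N : ℤ) : y ≠ z → Fragment .pairs φ →
      Fragment .pairs (.gt (.count [y, z] φ) (.const N))

/-! ### Trees, and the input and output of an algorithm -/

/-- A tree that can be rooted so that it has exactly `d` levels, that is, so that the longest path
from the root to a leaf has exactly `d` vertices. -/
def IsTreeOfDepth {V : Type} (T : SimpleGraph V) (d : ℕ) : Prop :=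
  T.IsTree ∧ ∃ r : V, (∀ v : V, T.dist r v + 1 ≤ d) ∧ ∃ v : V, T.dist r v + 1 = d

mutual
/-- A formula as a list of words, in prefix notation.  A number symbol becomes a tag, its sign and
its absolute value, so that it takes three words, whatever its size. -/
def Formula.words : Formula → List ℕ
  | .eq x y => [0, x, y]
  | .adj x y => [1, x, y]
  | .neg φ => 2 :: Formula.words φ
  | .or φ ψ => 3 :: (Formula.words φ ++ Formula.words ψ)
  | .ex y φ => 4 :: y :: Formula.words φ
  | .gt s t => 5 :: (Term.words s ++ Term.words t)
def Term.words : Term → List ℕ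
  | .const N => [6, if N < 0 then 1 else 0, N.natAbs]
  | .count ys φ => 7 :: ys.length :: (ys ++ Formula.words φ)
  | .add s t => 8 :: (Term.words s ++ Term.words t)
  | .sub s t => 9 :: (Term.words s ++ Term.words t)
  | .mul s t => 10 :: (Term.words s ++ Term.words t)
end

open Classical in
/-- A graph as a list of words: the number of its vertices and its adjacency matrix, row by
row. -/
noncomputable def graphWords {n : ℕ} (G : SimpleGraph (Fin n)) : List ℕ :=
  n :: (List.finRange n).flatMap fun u =>
    (List.finRange n).map fun v => if G.Adj u v then 1 else 0

/-- The input of a model-checking algorithm. -/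
noncomputable def inputWords {n : ℕ} (G : SimpleGraph (Fin n)) (φ : Formula) : List ℕ :=
  graphWords G ++ φ.words

/-- The possible answers of an approximate model-checking algorithm. -/
inductive Answer : Type
  | one | zero | bot

/-- The number that a program returns in order to give an answer. -/
def Answer.code : Answer → ℕ
  | .one => 1
  | .zero => 0
  | .bot => 2

end FOC

/-!
The theorem is proved by a reduction: with the help of such an algorithm, every problem in `AW[t]`
is decided in fpt time (`mem_FPT_of_modelChecker`).

*Games.* An instance of `QBFSAT_t` is first read as a game on a digraph of polynomial size
(`QBF.play_iff`). A token moves along the edges, through one layer of the digraph for each element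
of the sets that the players choose, and then down the formula tree to a literal; the order of
moves through the layers of a block forces every set to be listed in increasing order. The position
at the end, a literal, has edges to the positions at which its variable is chosen, and a loop if
the literal is negative. So the literal is true if and only if either there is an edge to a
position visited before or there is a loop, but not both (`Play`). The number of
moves depends on the parameter only.

*Trees.* The digraph is encoded in a tree of depth nine (`TreeData.labs`). Each edge has a record
in the tree, which holds the binary expansions of the numbers of its source and its target. A
binary expansion has `s * s` digits, and the digit at position `(i, j)` is a pair of adjacent
vertices, the first of which has `M ^ (2 * (i + 1))` leaves while the second has `M ^ (2 * c)`
leaves, where `c` encodes `j` and the digit. Here `s` is about the square root of the logarithm of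
the size of the instance, so that `M = 2 ^ (8 * s)` exceeds the permitted factor `2 ^ √(log n)` of
change several times (`TreeData.tolerance_le`), while even `M ^ (4 * s)` is polynomial in the size
of the instance. Splitting the `s * s` positions into two coordinates is what makes these two
demands compatible: only about `2 * s` different degrees are needed.

*Formulas.* Besides the records, the tree has rulers, vertices that have an odd power of `M` as
their number of leaves, and that are recognized by a first-order formula. A copy of the number of
the start vertex is attached to each of them. Two code vertices have the same code if no ruler
separates their degrees, and each of the four rules is able to compare the degree of a code vertex
with that of a ruler, either directly or, in the case of products and pairs, by comparing the
product of the two degrees with the fixed number `M ^ (4 * s + 2)`. Every such comparison has a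
margin of a factor `M` or so (`Labelling.separated`), and so it is stable. As a result the whole
sentence, which expresses that the existential player wins the game, is stable on the tree
(`stable_gameF`), and the answer `⊥` is excluded.

*Machines.* The tree and the sentence have to be computed by a random access machine. The reduction
is written in a language of bounded loops (`LoopLang.Cmd`), in which a command that passes each of
its loops at most `N` times takes a number of steps that is polynomial in `N` (`Cmd.cost`), and
which is compiled to the machine (`Cmd.compile_runs`). The program that comes with the problem in
`AW[t]`, the reduction, and the model checker are run one after the other on disjoint parts of the
registers and of the memory (`RAM.compose_returns`).
-/

/-! ### Running random access machines -/

namespace RAM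

/-- Started in `s`, the program `P` halts after at most `T` steps in a state that satisfies `Q`. -/
def Runs (P : Prog) (s : State) (T : ℕ) (Q : State → Prop) : Prop :=
  ∃ t s', Exec P s t s' ∧ t ≤ T ∧ Q s'

namespace Runs

variable {P P' : Prog} {s : State} {T T' : ℕ} {Q Q' : State → Prop}

theorem mono (h : Runs P s T Q) (hT : T ≤ T') (hQ : ∀ s', Q s' → Q' s') : Runs P s T' Q' := by
  obtain ⟨t, s', h1, h2, h3⟩ := h
  exact ⟨t, s', h1, h2.trans hT, hQ _ h3⟩

theorem seq (h : Runs P s T fun s' => Runs P' s' T' Q) : Runs (.seq P P') s (T + T') Q := by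
  obtain ⟨t, s', h1, h2, t', s'', h3, h4, h5⟩ := h
  exact ⟨_, s'', .seq h1 h3, by omega, h5⟩

theorem skip (h : Q s) : Runs .skip s 1 Q := ⟨1, _, .skip s, le_rfl, h⟩

theorem const {i k : ℕ} (h : Q (s.setReg i k)) : Runs (.const i k) s 1 Q :=
  ⟨1, _, .const s i k, le_rfl, h⟩

theorem add {i j l : ℕ} (h : Q (s.setReg i (s.reg j + s.reg l))) : Runs (.add i j l) s 1 Q :=
  ⟨1, _, .add s i j l, le_rfl, h⟩

theorem sub {i j l : ℕ} (h : Q (s.setReg i (s.reg j - s.reg l))) : Runs (.sub i j l) s 1 Q :=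
  ⟨1, _, .sub s i j l, le_rfl, h⟩

theorem half {i j : ℕ} (h : Q (s.setReg i (s.reg j / 2))) : Runs (.half i j) s 1 Q :=
  ⟨1, _, .half s i j, le_rfl, h⟩

theorem load {i j : ℕ} (h : Q (s.setReg i (s.mem (s.reg j)))) : Runs (.load i j) s 1 Q :=
  ⟨1, _, .load s i j, le_rfl, h⟩

theorem store {i j : ℕ} (h : Q (s.setMem (s.reg i) (s.reg j))) : Runs (.store i j) s 1 Q :=
  ⟨1, _, .store s i j, le_rfl, h⟩

theorem ite {i : ℕ} (h1 : s.reg i ≠ 0 → Runs P s T Q) (h2 : s.reg i = 0 → Runs P' s T Q) :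
    Runs (.ite i P P') s (T + 1) Q := by
  by_cases h : s.reg i = 0
  · obtain ⟨t, s', e, ht, hq⟩ := h2 h
    exact ⟨_, s', .ite_false h e, by omega, hq⟩
  · obtain ⟨t, s', e, ht, hq⟩ := h1 h
    exact ⟨_, s', .ite_true h e, by omega, hq⟩

/-- A loop with the invariant `I`, whose argument is the content of the tested register. -/
theorem loop {i : ℕ} (I : ℕ → State → Prop) (hI : ∀ n s, I n s → s.reg i = n)
    (step : ∀ n s, I (n + 1) s → Runs P s T (I n)) :
    ∀ n s, I n s → Runs (.loop i P) s (n * (T + 1) + 1) (I 0) := by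
  intro n
  induction n with
  | zero => intro s h; exact ⟨1, s, .loop_done (hI _ _ h), by omega, h⟩
  | succ n ih =>
    intro s h
    obtain ⟨t, s', e, ht, hq⟩ := step n s h
    obtain ⟨t', s'', e', ht', hq'⟩ := ih s' hq
    refine ⟨_, s'', .loop_step (by rw [hI _ _ h]; omega) e e', ?_, hq'⟩
    rw [Nat.succ_mul]; omega

end Runs

@[simp] theorem State.setReg_reg (s : State) (i v j : ℕ) :
    (s.setReg i v).reg j = if j = i then v else s.reg j := by
  simp [State.setReg, Function.update_apply]

@[simp] theorem State.setReg_mem (s : State) (i v : ℕ) : (s.setReg i v).mem = s.mem := rfl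

@[simp] theorem State.setMem_mem (s : State) (a v b : ℕ) :
    (s.setMem a v).mem b = if b = a then v else s.mem b := by
  simp [State.setMem, Function.update_apply]

@[simp] theorem State.setMem_reg (s : State) (a v : ℕ) : (s.setMem a v).reg = s.reg := rfl

/-! ### Relocating a program -/

/-- The program `P` with its registers moved to the registers `8 * i + c` and its memory moved to
the cells `8 * a + b`; the registers `2` and `10` serve to compute addresses. -/
def Prog.relocate (c b : ℕ) : Prog → Prog
  | .skip => .skip
  | .const i k => .const (8 * i + c) k
  | .add i j l => .add (8 * i + c) (8 * j + c) (8 * l + c)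
  | .sub i j l => .sub (8 * i + c) (8 * j + c) (8 * l + c)
  | .half i j => .half (8 * i + c) (8 * j + c)
  | .load i j => .seq (.add 2 (8 * j + c) (8 * j + c)) <| .seq (.add 2 2 2) <|
      .seq (.add 2 2 2) <| .seq (.const 10 b) <| .seq (.add 2 2 10) (.load (8 * i + c) 2)
  | .store i j => .seq (.add 2 (8 * i + c) (8 * i + c)) <| .seq (.add 2 2 2) <|
      .seq (.add 2 2 2) <| .seq (.const 10 b) <| .seq (.add 2 2 10) (.store 2 (8 * j + c))
  | .seq P Q => .seq (P.relocate c b) (Q.relocate c b)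
  | .ite i P Q => .ite (8 * i + c) (P.relocate c b) (Q.relocate c b)
  | .loop i P => .loop (8 * i + c) (P.relocate c b)

/-- The registers of class `c` and the memory cells of class `b` of `s` hold the state `u`. -/
def Sim (c b : ℕ) (s u : State) : Prop :=
  (∀ i, s.reg (8 * i + c) = u.reg i) ∧ ∀ a, s.mem (8 * a + b) = u.mem a

/-- The states `s` and `s'` differ at most in registers of the classes `c` and `2` and in memory
cells of class `b`. -/
def Frame (c b : ℕ) (s s' : State) : Prop :=
  (∀ i, i % 8 ≠ c → i % 8 ≠ 2 → s'.reg i = s.reg i) ∧ ∀ a, a % 8 ≠ b → s'.mem a = s.mem a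

theorem Frame.trans {c b : ℕ} {s s' s'' : State} (h : Frame c b s s') (h' : Frame c b s' s'') :
    Frame c b s s'' :=
  ⟨fun i h1 h2 => (h'.1 i h1 h2).trans (h.1 i h1 h2), fun a h1 => (h'.2 a h1).trans (h.2 a h1)⟩

/-- The factor `6` is the length of the code for a memory access. The class `2` is excluded because
it holds the registers that serve to compute addresses. -/
theorem Exec.relocate {c b : ℕ} (hc : c < 8) (hc2 : c ≠ 2) (hb : b < 8) {P : Prog}
    {u u' : State} {t : ℕ} (h : Exec P u t u') :
    ∀ s, Sim c b s u → Runs (P.relocate c b) s (6 * t) fun s' => Sim c b s' u' ∧ Frame c b s s' := by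
  have upd : ∀ (s u : State) (i v : ℕ), Sim c b s u →
      Sim c b (s.setReg (8 * i + c) v) (u.setReg i v) ∧ Frame c b s (s.setReg (8 * i + c) v) := by
    intro s u i v h
    refine ⟨⟨fun j => ?_, h.2⟩, fun j h1 h2 => ?_, fun a _ => rfl⟩
    · simp [h.1]
    · rw [State.setReg_reg, if_neg]; omega
  induction h with
  | skip u =>
    intro s hs
    exact (Runs.skip ⟨hs, fun _ _ _ => rfl, fun _ _ => rfl⟩).mono (by omega) fun _ h => h
  | const u i k =>
    intro s hs
    exact (Runs.const (upd s u i k hs)).mono (by omega) fun _ h => h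
  | add u i j l =>
    intro s hs
    refine (Runs.add ?_).mono (by omega) fun _ h => h
    rw [hs.1, hs.1]; exact upd s u i _ hs
  | sub u i j l =>
    intro s hs
    refine (Runs.sub ?_).mono (by omega) fun _ h => h
    rw [hs.1, hs.1]; exact upd s u i _ hs
  | half u i j =>
    intro s hs
    refine (Runs.half ?_).mono (by omega) fun _ h => h
    rw [hs.1]; exact upd s u i _ hs
  | load u i j =>
    intro s hs
    refine (Runs.seq <| Runs.add <| Runs.seq <| Runs.add <| Runs.seq <| Runs.add <| Runs.seq <|
      Runs.const <| Runs.seq <| Runs.add <| Runs.load ?_).mono (by omega) fun _ h => h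
    have h2 : ∀ k, (8 * k + c = 2) = False := fun k => by simp; omega
    simp only [State.setReg_reg, State.setReg_mem, if_true, if_false, hs.1,
      show (2 = 10) = False by simp]
    have e : u.reg j + u.reg j + (u.reg j + u.reg j) +
        (u.reg j + u.reg j + (u.reg j + u.reg j)) + b = 8 * u.reg j + b := by omega
    rw [e, hs.2]
    refine ⟨⟨fun k => ?_, fun a => hs.2 a⟩, fun k h1 h2 => ?_, fun a _ => rfl⟩
    · have := hs.1 k
      simp only [State.setReg_reg, h2, if_false]
      rw [if_neg (show ¬ 8 * k + c = 10 by omega)]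
      by_cases hk : k = i
      · simp [hk]
      · rw [if_neg (by omega), if_neg hk, this]
    · simp only [State.setReg_reg]
      rw [if_neg (by omega), if_neg (by omega), if_neg (by omega), if_neg (by omega),
        if_neg (by omega), if_neg (by omega)]
  | store u i j =>
    intro s hs
    refine (Runs.seq <| Runs.add <| Runs.seq <| Runs.add <| Runs.seq <| Runs.add <| Runs.seq <|
      Runs.const <| Runs.seq <| Runs.add <| Runs.store ?_).mono (by omega) fun _ h => h
    have h2 : ∀ k, (8 * k + c = 2) = False := fun k => by simp; omega
    have h10 : ∀ k, (8 * k + c = 10) = False := fun k => by simp; omega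
    simp only [State.setReg_reg, if_true, if_false, hs.1,
      show (2 = 10) = False by simp, h2, h10]
    have e : u.reg i + u.reg i + (u.reg i + u.reg i) +
        (u.reg i + u.reg i + (u.reg i + u.reg i)) + b = 8 * u.reg i + b := by omega
    rw [e]
    refine ⟨⟨fun k => ?_, fun a => ?_⟩, fun k h1 h2 => ?_, fun a ha => ?_⟩
    · simp only [State.setMem_reg, State.setReg_reg, h2, h10, if_false]
      exact hs.1 k
    · simp only [State.setMem_mem, State.setReg_mem, hs.2]
      by_cases h : a = u.reg i
      · simp [h]
      · rw [if_neg (by omega), if_neg h]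
    · simp only [State.setMem_reg, State.setReg_reg]
      rw [if_neg (by omega), if_neg (by omega), if_neg (by omega), if_neg (by omega),
        if_neg (by omega)]
    · simp only [State.setMem_mem, State.setReg_mem]
      rw [if_neg (by omega)]
  | seq h1 h2 ih1 ih2 =>
    intro s hs
    refine ((Runs.seq ((ih1 s hs).mono le_rfl fun s' h' =>
      (ih2 s' h'.1).mono le_rfl fun s'' h'' => ?_))).mono (by omega) fun _ h => h
    exact ⟨h''.1, h'.2.trans h''.2⟩
  | ite_true h0 h1 ih =>
    intro s hs
    refine (Runs.ite (fun _ => ih s hs) fun h => ?_).mono (by omega) fun _ h => h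
    rw [hs.1] at h; exact absurd h h0
  | ite_false h0 h1 ih =>
    intro s hs
    refine (Runs.ite (fun h => ?_) fun _ => ih s hs).mono (by omega) fun _ h => h
    rw [hs.1] at h; exact absurd h0 h
  | loop_done h0 =>
    intro s hs
    exact ⟨1, s, .loop_done (by rw [hs.1, h0]), by omega, hs, fun _ _ _ => rfl, fun _ _ => rfl⟩
  | loop_step h0 h1 h2 ih1 ih2 =>
    intro s hs
    obtain ⟨t1, s1, e1, ht1, hs1, f1⟩ := ih1 s hs
    obtain ⟨t2, s2, e2, ht2, hs2, f2⟩ := ih2 s1 hs1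
    exact ⟨_, s2, .loop_step (by rw [hs.1]; exact h0) e1 e2, by omega, hs2, f1.trans f2⟩

/-- Moves the input from the first memory cells to the memory cells of class `0`, and its length
to register `6`.  Processing the cells in descending order keeps the cell `8 * a` from being
overwritten before it has been moved. -/
def moveInput : Prog :=
  .seq (.const 2 0) <| .seq (.add 6 0 2) <|
  .seq (.loop 0 (.seq (.const 10 1) <| .seq (.sub 0 0 10) <| .seq (.load 18 0) <|
    .seq (.store 0 2) <| .seq (.add 26 0 0) <| .seq (.add 26 26 26) <| .seq (.add 26 26 26)
      (.store 26 18))) .skip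

theorem moveInput_runs (w : List ℕ) :
    Runs moveInput (init w) (12 * (w.length + 1)) fun s =>
      Sim 6 0 s (init w) ∧ (∀ i, i % 8 ≠ 6 → i % 8 ≠ 2 → s.reg i = 0) ∧
      ∀ a, a % 8 ≠ 0 → s.mem a = 0 := by
  have key := Runs.loop (i := 0) (T := 8)
    (P := .seq (.const 10 1) <| .seq (.sub 0 0 10) <| .seq (.load 18 0) <|
      .seq (.store 0 2) <| .seq (.add 26 0 0) <| .seq (.add 26 26 26) <| .seq (.add 26 26 26)
      (.store 26 18))
    (fun n s => n ≤ w.length ∧ s.reg 0 = n ∧ s.reg 2 = 0 ∧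
      (∀ i, s.reg (8 * i + 6) = (init w).reg i) ∧
      (∀ i, i ≠ 0 → i % 8 ≠ 6 → i % 8 ≠ 2 → s.reg i = 0) ∧
      (∀ a, a < n → s.mem a = w.getD a 0) ∧
      (∀ a, n ≤ a → s.mem a = if a % 8 = 0 ∧ n ≤ a / 8 then w.getD (a / 8) 0 else 0))
    (fun n s h => h.2.1) ?_ w.length ((init w).setReg 2 0 |>.setReg 6 w.length) ?_
  · refine (Runs.seq <| Runs.const <| Runs.seq <| Runs.add <| Runs.seq <| ?_).mono
      (by omega : 1 + (1 + (w.length * (8 + 1) + 1 + 1)) ≤ _) fun _ h => h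
    have e : ((init w).setReg 2 0).reg 0 + ((init w).setReg 2 0).reg 2 = w.length := by
      simp [init]
    rw [e]
    refine key.mono le_rfl fun s h => Runs.skip ?_
    obtain ⟨-, h0, h2, h6, hr, -, hm⟩ := h
    refine ⟨⟨h6, fun a => ?_⟩, fun i h1 h3 => ?_, fun a ha => ?_⟩
    · rw [Nat.add_zero, hm _ (Nat.zero_le _), if_pos ⟨by omega, by omega⟩]
      simp [init]
    · by_cases hi : i = 0
      · rw [hi, h0]
      · exact hr i hi h1 h3
    · rw [hm _ (Nat.zero_le _), if_neg (by omega)]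
  · rintro n s ⟨hn, h0, h2, h6, hr, hl, hm⟩
    refine (Runs.seq <| Runs.const <| Runs.seq <| Runs.sub <| Runs.seq <| Runs.load <| Runs.seq <|
      Runs.store <| Runs.seq <| Runs.add <| Runs.seq <| Runs.add <| Runs.seq <| Runs.add <|
      Runs.store ?_).mono le_rfl fun _ h => h
    simp only [State.setReg_reg, State.setMem_reg, State.setReg_mem, State.setMem_mem, h0, h2, if_true, if_false,
      Nat.add_sub_cancel, Nat.reduceEqDiff, OfNat.ofNat_ne_zero, OfNat.zero_ne_ofNat]
    have e : n + n + (n + n) + (n + n + (n + n)) = 8 * n := by omega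
    simp only [e]
    refine ⟨by omega, by simp, ?_, fun i => ?_, fun i i0 i6 i2 => ?_, fun a ha => ?_, fun a ha => ?_⟩
    · simp
    · split_ifs <;> first | omega | exact h6 i
    · rw [if_neg (by omega), if_neg (by omega), if_neg (by omega), if_neg (by omega),
        if_neg (by omega), if_neg (by omega), hr i i0 i6 i2]
    · rw [if_neg (by omega), if_neg (by omega), hl a (by omega)]
    · rw [hl n (by omega)]
      by_cases h8 : a = 8 * n
      · rw [if_pos h8, if_pos ⟨by omega, by omega⟩]; congr 1; omega
      · rw [if_neg h8]
        by_cases han : a = n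
        · rw [if_pos han, if_neg (by omega)]
        · rw [if_neg han, hm a (by omega)]
          by_cases hc : a % 8 = 0 ∧ n ≤ a / 8
          · rw [if_pos hc, if_pos ⟨hc.1, by omega⟩]
          · rw [if_neg hc, if_neg (by omega)]
  · refine ⟨le_rfl, ?_, ?_, fun i => ?_, fun i i0 i6 i2 => ?_, fun a ha => ?_, fun a ha => ?_⟩
    · simp [init]
    · simp
    · by_cases hi : i = 0
      · simp [init, hi]
      · simp only [State.setReg_reg, init]
        rw [if_neg (by omega), if_neg (by omega), if_neg (by omega), if_neg hi]
    · simp only [State.setReg_reg, init]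
      rw [if_neg (by omega), if_neg (by omega), if_neg i0]
    · simp [init]
    · have : (init w).mem a = 0 := List.getD_eq_default _ _ ha
      simp only [State.setReg_mem, this]
      split_ifs with hc
      · rw [List.getD_eq_default]; omega
      · rfl

end RAM

/-! ### A language of bounded loops with append-only arrays -/

namespace LoopLang

/-- A store: registers and eight arrays. -/
@[ext] structure Store where
  reg : ℕ → ℕ
  arr : Fin 8 → List ℕ

/-- Expressions.  `get b e` is the `e`-th entry of the array `b` (zero if there is none). -/
inductive Ex : Type
  | c (k : ℕ)
  | r (i : ℕ)
  | add (e e' : Ex)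
  | sub (e e' : Ex)
  | half (e : Ex)
  | get (b : Fin 8) (e : Ex)
  | len (b : Fin 8)

/-- The value of an expression. -/
def Ex.ev (v : Store) : Ex → ℕ
  | c k => k
  | r i => v.reg i
  | add e e' => e.ev v + e'.ev v
  | sub e e' => e.ev v - e'.ev v
  | half e => e.ev v / 2
  | get b e => (v.arr b).getD (e.ev v) 0
  | len b => (v.arr b).length

/-- Write `x` into register `i`. -/
def Store.set (v : Store) (i x : ℕ) : Store := { v with reg := Function.update v.reg i x }

/-- Append `l` to the array `b`. -/
def Store.app (v : Store) (b : Fin 8) (l : List ℕ) : Store :=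
  { v with arr := Function.update v.arr b (v.arr b ++ l) }

/-- Commands.  The variable of `loop i e P` runs through the numbers below the value of `e`, and
`loc i e P` runs `P` with register `i` set to the value of `e`; both restore the register. -/
inductive Cmd : Type
  | skip
  | set (i : ℕ) (e : Ex)
  | push (b : Fin 8) (e : Ex)
  | seq (P Q : Cmd)
  | ite (e : Ex) (P Q : Cmd)
  | loop (i : ℕ) (e : Ex) (P : Cmd)
  | loc (i : ℕ) (e : Ex) (P : Cmd)

/-- The iterates `v, F 0 v, F 1 (F 0 v), …` -/
def iter (F : ℕ → Store → Store) (v : Store) : ℕ → Store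
  | 0 => v
  | k + 1 => F k (iter F v k)

/-- The effect of a command. -/
def Cmd.run : Cmd → Store → Store
  | skip, v => v
  | set i e, v => v.set i (e.ev v)
  | push b e, v => v.app b [e.ev v]
  | seq P Q, v => Q.run (P.run v)
  | ite e P Q, v => if e.ev v ≠ 0 then P.run v else Q.run v
  | loop i e P, v =>
      iter (fun k u => (P.run (u.set i k)).set i (u.reg i)) v (e.ev v)
  | loc i e P, v => (P.run (v.set i (e.ev v))).set i (v.reg i)

/-- In the run of the command on `v`, every loop is passed at most `N` times. -/
def Cmd.Ok (N : ℕ) : Cmd → Store → Prop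
  | skip, _ => True
  | set _ _, _ => True
  | push _ _, _ => True
  | seq P Q, v => P.Ok N v ∧ Q.Ok N (P.run v)
  | ite e P Q, v => if e.ev v ≠ 0 then P.Ok N v else Q.Ok N v
  | loop i e P, v => e.ev v ≤ N ∧ ∀ k < e.ev v,
      P.Ok N ((iter (fun k u => (P.run (u.set i k)).set i (u.reg i)) v k).set i k)
  | loc i e P, v => P.Ok N (v.set i (e.ev v))

/-- The command turns `v` into `w`, passing every loop at most `N` times. -/
def Does (N : ℕ) (P : Cmd) (v w : Store) : Prop := P.run v = w ∧ P.Ok N v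

/-! ### Compilation to random access machines

The registers of the machine are divided into classes modulo `8`: class `0` holds the registers
of the store, class `1` the lengths of the arrays, class `2` intermediate values of expressions,
and the classes `3`, `4`, `5` hold, for every nesting depth, the number of remaining passes of a
loop, the value of its variable, and the saved content of a register.  The array `b` is stored in
the memory cells `8 * a + b`. -/

open RAM

/-- The program that computes an expression into the register `8 * d + 2`. -/
def Ex.compile : ℕ → Ex → Prog
  | d, c k => .const (8 * d + 2) k
  | d, r i => .seq (.const (8 * d + 2) 0) (.add (8 * d + 2) (8 * i) (8 * d + 2))
  | d, add e e' => .seq (e.compile d) (.seq (e'.compile (d + 1))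
      (.add (8 * d + 2) (8 * d + 2) (8 * (d + 1) + 2)))
  | d, sub e e' => .seq (e.compile d) (.seq (e'.compile (d + 1))
      (.sub (8 * d + 2) (8 * d + 2) (8 * (d + 1) + 2)))
  | d, half e => .seq (e.compile d) (.half (8 * d + 2) (8 * d + 2))
  | d, get b e => .seq (e.compile d) <|
      .seq (.sub (8 * (d + 1) + 2) (8 * b + 1) (8 * d + 2)) <|
      .ite (8 * (d + 1) + 2)
        (.seq (.add (8 * d + 2) (8 * d + 2) (8 * d + 2)) <|
         .seq (.add (8 * d + 2) (8 * d + 2) (8 * d + 2)) <|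
         .seq (.add (8 * d + 2) (8 * d + 2) (8 * d + 2)) <|
         .seq (.const (8 * (d + 1) + 2) b) <|
         .seq (.add (8 * d + 2) (8 * d + 2) (8 * (d + 1) + 2))
          (.load (8 * d + 2) (8 * d + 2)))
        (.const (8 * d + 2) 0)
  | d, len b => .seq (.const (8 * d + 2) 0) (.add (8 * d + 2) (8 * b + 1) (8 * d + 2))

/-- A bound for the running time of the compiled expression. -/
def Ex.cost : Ex → ℕ
  | c _ => 1
  | r _ => 2
  | add e e' => e.cost + e'.cost + 1
  | sub e e' => e.cost + e'.cost + 1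
  | half e => e.cost + 1
  | get _ e => e.cost + 8
  | len _ => 2

/-- The program that runs a command inside of `d` loops and local declarations. -/
def Cmd.compile : ℕ → Cmd → Prog
  | _, skip => .skip
  | _, set i e => .seq (e.compile 0) <| .seq (.const 10 0) (.add (8 * i) 2 10)
  | _, push b e => .seq (e.compile 0) <|
      .seq (.add 10 (8 * b + 1) (8 * b + 1)) <| .seq (.add 10 10 10) <| .seq (.add 10 10 10) <|
      .seq (.const 18 b) <| .seq (.add 10 10 18) <| .seq (.store 10 2) <|
      .seq (.const 10 1) (.add (8 * b + 1) (8 * b + 1) 10)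
  | d, seq P Q => .seq (P.compile d) (Q.compile d)
  | d, ite e P Q => .seq (e.compile 0) (.ite 2 (P.compile d) (Q.compile d))
  | d, loop i e P => .seq (e.compile 0) <| .seq (.const 10 0) <| .seq (.add (8 * d + 3) 2 10) <|
      .seq (.const (8 * d + 4) 0) <| .seq (.add (8 * d + 5) (8 * i) 10) <|
      .loop (8 * d + 3) <| .seq (.const 10 0) <| .seq (.add (8 * i) (8 * d + 4) 10) <|
        .seq (P.compile (d + 1)) <| .seq (.const 10 1) <|
        .seq (.add (8 * d + 4) (8 * d + 4) 10) <| .seq (.sub (8 * d + 3) (8 * d + 3) 10) <|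
        .seq (.const 10 0) (.add (8 * i) (8 * d + 5) 10)
  | d, loc i e P => .seq (e.compile 0) <| .seq (.const 10 0) <| .seq (.add (8 * d + 5) (8 * i) 10) <|
      .seq (.add (8 * i) 2 10) <| .seq (P.compile (d + 1)) <| .seq (.const 10 0)
        (.add (8 * i) (8 * d + 5) 10)

/-- A bound for the running time of a command all of whose loops are passed at most `N` times. -/
def Cmd.cost (N : ℕ) : Cmd → ℕ
  | skip => 1
  | set _ e => e.cost + 2
  | push _ e => e.cost + 8
  | seq P Q => P.cost N + Q.cost N
  | ite e P Q => e.cost + (P.cost N + Q.cost N) + 1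
  | loop _ e P => e.cost + 4 + (N * (P.cost N + 7 + 1) + 1)
  | loc _ e P => e.cost + P.cost N + 5

/-- The state `s` of the machine represents the store `v`.  The registers of class `7` are unused;
the memory cells behind the array `0` may hold anything. -/
def Rep (s : State) (v : Store) : Prop :=
  (∀ i, s.reg (8 * i) = v.reg i) ∧ (∀ b : Fin 8, s.reg (8 * b + 1) = (v.arr b).length) ∧
  (∀ i, s.reg (8 * i + 7) = 0) ∧
  (∀ (b : Fin 8) (a : ℕ), a < (v.arr b).length → s.mem (8 * a + b) = (v.arr b).getD a 0) ∧
  ∀ (b : Fin 8) (a : ℕ), b ≠ 0 → (v.arr b).length ≤ a → s.mem (8 * a + b) = 0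

theorem Rep.congr {s s' : State} {v : Store} (h : Rep s v) (hm : s'.mem = s.mem)
    (hr : ∀ i, i % 8 = 0 ∨ i % 8 = 1 ∨ i % 8 = 7 → s'.reg i = s.reg i) : Rep s' v := by
  obtain ⟨h1, h2, h3, h4, h5⟩ := h
  refine ⟨fun i => ?_, fun b => ?_, fun i => ?_, ?_, ?_⟩
  · rw [hr _ (by omega), h1]
  · rw [hr _ (by omega), h2]
  · rw [hr _ (by omega), h3]
  · rw [hm]; exact h4
  · rw [hm]; exact h5

theorem Rep.set {s s' : State} {v : Store} {i x : ℕ} (h : Rep s v) (hm : s'.mem = s.mem)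
    (hi : s'.reg (8 * i) = x)
    (hr : ∀ j, j ≠ 8 * i → j % 8 = 0 ∨ j % 8 = 1 ∨ j % 8 = 7 → s'.reg j = s.reg j) :
    Rep s' (v.set i x) := by
  obtain ⟨h1, h2, h3, h4, h5⟩ := h
  refine ⟨fun j => ?_, fun b => ?_, fun j => ?_, ?_, ?_⟩
  · by_cases hj : j = i
    · subst hj; simp [Store.set, hi]
    · rw [hr _ (by omega) (by omega), h1]; simp [Store.set, hj]
  · rw [hr _ (by omega) (by omega), h2]; rfl
  · rw [hr _ (by omega) (by omega), h3]
  · rw [hm]; exact h4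
  · rw [hm]; exact h5

theorem Ex.compile_runs {v : Store} (e : Ex) : ∀ (d : ℕ) (s : State), Rep s v →
    Runs (e.compile d) s e.cost fun s' => s'.reg (8 * d + 2) = e.ev v ∧ s'.mem = s.mem ∧
      ∀ i, (i % 8 ≠ 2 ∨ i < 8 * d + 2) → s'.reg i = s.reg i := by
  have bin : ∀ (e e' : Ex) (d : ℕ) (s : State), Rep s v →
      (∀ (d : ℕ) (s : State), Rep s v →
        Runs (e.compile d) s e.cost fun s' => s'.reg (8 * d + 2) = e.ev v ∧ s'.mem = s.mem ∧
          ∀ i, (i % 8 ≠ 2 ∨ i < 8 * d + 2) → s'.reg i = s.reg i) →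
      (∀ (d : ℕ) (s : State), Rep s v →
        Runs (e'.compile d) s e'.cost fun s' => s'.reg (8 * d + 2) = e'.ev v ∧ s'.mem = s.mem ∧
          ∀ i, (i % 8 ≠ 2 ∨ i < 8 * d + 2) → s'.reg i = s.reg i) →
      Runs (.seq (e.compile d) (e'.compile (d + 1))) s (e.cost + e'.cost)
        fun s' => s'.reg (8 * d + 2) = e.ev v ∧ s'.reg (8 * (d + 1) + 2) = e'.ev v ∧
          s'.mem = s.mem ∧ ∀ i, (i % 8 ≠ 2 ∨ i < 8 * d + 2) → s'.reg i = s.reg i := by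
    intro e e' d s hs ih ih'
    refine Runs.seq ((ih d s hs).mono le_rfl fun s1 h1 => ?_)
    refine (ih' (d + 1) s1 (hs.congr h1.2.1 fun i hi => h1.2.2 i (by omega))).mono le_rfl
      fun s2 h2 => ⟨?_, h2.1, h2.2.1.trans h1.2.1, fun i hi => ?_⟩
    · rw [h2.2.2 _ (by omega), h1.1]
    · rw [h2.2.2 i (by omega), h1.2.2 i hi]
  have assoc : ∀ {P Q R : Prog} {s : State} {T : ℕ} {q : State → Prop},
      Runs (.seq (.seq P Q) R) s T q → Runs (.seq P (.seq Q R)) s T q := by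
    rintro P Q R s T q ⟨t, s', h, ht, hq⟩
    cases h with
    | seq h h' => cases h with
      | seq h1 h2 => exact ⟨_, s', .seq h1 (.seq h2 h'), by omega, hq⟩
  induction e with
  | c k =>
    intro d s hs
    refine Runs.const ⟨by simp [ev], rfl, fun i hi => ?_⟩
    rw [State.setReg_reg, if_neg (by omega)]
  | r i =>
    intro d s hs
    refine Runs.seq <| Runs.const <| Runs.add ⟨?_, rfl, fun j hj => ?_⟩
    · simp only [State.setReg_reg, if_true, ev]
      rw [if_neg (by omega), hs.1, Nat.add_zero]
    · simp only [State.setReg_reg]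
      rw [if_neg (by omega), if_neg (by omega)]
  | len b =>
    intro d s hs
    refine Runs.seq <| Runs.const <| Runs.add ⟨?_, rfl, fun j hj => ?_⟩
    · simp only [State.setReg_reg, if_true, ev]
      rw [if_neg (by omega), hs.2.1, Nat.add_zero]
    · simp only [State.setReg_reg]
      rw [if_neg (by omega), if_neg (by omega)]
  | add e e' ih ih' =>
    intro d s hs
    refine assoc (Runs.seq ((bin e e' d s hs ih ih').mono le_rfl fun s1 h1 => Runs.add ?_))
    refine ⟨?_, h1.2.2.1, fun j hj => ?_⟩
    · simp only [State.setReg_reg, if_true, h1.1, h1.2.1, ev]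
    · rw [State.setReg_reg, if_neg (by omega), h1.2.2.2 j hj]
  | sub e e' ih ih' =>
    intro d s hs
    refine assoc (Runs.seq ((bin e e' d s hs ih ih').mono le_rfl fun s1 h1 => Runs.sub ?_))
    refine ⟨?_, h1.2.2.1, fun j hj => ?_⟩
    · simp only [State.setReg_reg, if_true, h1.1, h1.2.1, ev]
    · rw [State.setReg_reg, if_neg (by omega), h1.2.2.2 j hj]
  | half e ih =>
    intro d s hs
    refine Runs.seq ((ih d s hs).mono le_rfl fun s1 h1 => Runs.half ⟨?_, h1.2.1, fun j hj => ?_⟩)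
    · simp only [State.setReg_reg, if_true, h1.1, ev]
    · rw [State.setReg_reg, if_neg (by omega), h1.2.2 j hj]
  | get b e ih =>
    intro d s hs
    refine Runs.seq (((ih d s hs).mono le_rfl fun s1 h1 => ?_))
    have hlen : s1.reg (8 * b + 1) = (v.arr b).length := by
      rw [h1.2.2 _ (by omega), hs.2.1]
    refine (Runs.seq <| Runs.sub <| Runs.ite (T := 6) (fun h => ?_) fun h => ?_).mono
      (by omega) fun _ h => h
    · simp only [State.setReg_reg, if_true, hlen, h1.1] at h
      refine Runs.seq <| Runs.add <| Runs.seq <| Runs.add <| Runs.seq <| Runs.add <|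
        Runs.seq <| Runs.const <| Runs.seq <| Runs.add <| Runs.load ?_
      have h12 : (8 * d + 2 = 8 * (d + 1) + 2) = False := by simp
      have h21 : (8 * (d + 1) + 2 = 8 * d + 2) = False := by simp
      refine ⟨?_, h1.2.1, fun j hj => ?_⟩
      · simp only [State.setReg_reg, State.setReg_mem, if_true, h12, if_false, h1.1, h1.2.1]
        rw [show e.ev v + e.ev v + (e.ev v + e.ev v) +
          (e.ev v + e.ev v + (e.ev v + e.ev v)) + (b : ℕ) = 8 * e.ev v + b by omega]
        rw [hs.2.2.2.1 b _ (by omega)]; rfl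
      · simp only [State.setReg_reg]
        rw [if_neg (by omega), if_neg (by omega), if_neg (by omega), if_neg (by omega),
          if_neg (by omega), if_neg (by omega), if_neg (by omega), h1.2.2 j hj]
    · simp only [State.setReg_reg, if_true, hlen, h1.1] at h
      refine (Runs.const ⟨?_, h1.2.1, fun j hj => ?_⟩).mono (by omega) fun _ h => h
      · simp only [State.setReg_reg, if_true, ev]
        rw [List.getD_eq_default]; omega
      · simp only [State.setReg_reg]
        rw [if_neg (by omega), if_neg (by omega), h1.2.2 j hj]

/-- Besides, the program leaves the data of the enclosing loops and local declarations alone. -/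
theorem Cmd.compile_runs {N : ℕ} (P : Cmd) : ∀ (d : ℕ) (v : Store) (s : State), Rep s v →
    P.Ok N v → Runs (P.compile d) s (P.cost N) fun s' => Rep s' (P.run v) ∧
      ∀ i, i < 8 * d → i % 8 = 3 ∨ i % 8 = 4 ∨ i % 8 = 5 → s'.reg i = s.reg i := by
  induction P with
  | skip => intro d v s hs _; exact Runs.skip ⟨hs, fun _ _ _ => rfl⟩
  | set i e =>
    intro d v s hs _
    refine (Runs.seq ((e.compile_runs 0 s hs).mono le_rfl fun s1 h1 =>
      Runs.seq <| Runs.const <| Runs.add ⟨?_, fun j _ hj => ?_⟩))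
    · refine hs.set (by simp [h1.2.1]) ?_ fun j h hj => ?_
      · have := h1.1
        simp at this
        simp [this]
      · simp only [State.setReg_reg]
        rw [if_neg h, if_neg (by omega), h1.2.2 _ (by omega)]
    · simp only [State.setReg_reg]
      rw [if_neg (by omega), if_neg (by omega), h1.2.2 _ (by omega)]
  | push b e =>
    intro d v s hs _
    refine (Runs.seq ((e.compile_runs 0 s hs).mono le_rfl fun s1 h1 =>
      Runs.seq <| Runs.add <| Runs.seq <| Runs.add <| Runs.seq <| Runs.add <| Runs.seq <|
      Runs.const <| Runs.seq <| Runs.add <| Runs.seq <| Runs.store <| Runs.seq <| Runs.const <|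
      Runs.add ?_))
    have hb1 : (8 * (b : ℕ) + 1 = 10) = False := by simp; omega
    have hb2 : (8 * (b : ℕ) + 1 = 18) = False := by simp; omega
    have hlen : s1.reg (8 * b + 1) = (v.arr b).length := by
      rw [h1.2.2 _ (by omega), hs.2.1]
    have h2 : s1.reg 2 = e.ev v := h1.1
    simp only [State.setReg_reg, State.setMem_reg, if_true, if_false, hb1, hb2, hlen,
      Nat.reduceEqDiff, h2]
    set n := (v.arr b).length with hn
    rw [show n + n + (n + n) + (n + n + (n + n)) + (b : ℕ) = 8 * n + b by omega]
    refine ⟨⟨fun i => ?_, fun b' => ?_, fun i => ?_, fun b' a ha => ?_, fun b' a hb' ha => ?_⟩,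
      fun j _ hj => ?_⟩
    · simp only [State.setReg_reg, State.setMem_reg]
      iterate 7 rw [if_neg (by omega)]
      rw [h1.2.2 _ (by omega), hs.1]; rfl
    · simp only [State.setReg_reg, State.setMem_reg]
      by_cases hbb : b' = b
      · subst hbb; simp [run, Store.app, hn]
      · have : (b' : ℕ) ≠ b := fun h => hbb (Fin.ext h)
        iterate 7 rw [if_neg (by omega)]
        rw [h1.2.2 _ (by omega), hs.2.1]; simp [run, Store.app, hbb]
    · simp only [State.setReg_reg, State.setMem_reg]
      iterate 7 rw [if_neg (by omega)]
      rw [h1.2.2 _ (by omega), hs.2.2.1]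
    · simp only [State.setReg_mem, State.setMem_mem, h1.2.1]
      by_cases hbb : b' = b
      · subst hbb
        simp only [run, Store.app, Function.update_self, List.length_append, ← hn,
          List.length_singleton] at ha ⊢
        by_cases han : a = n
        · subst han; rw [if_pos rfl, List.getD_append_right _ _ _ _ (by omega)]; simp [hn]
        · rw [if_neg (by omega), hs.2.2.2.1 _ _ (by omega),
            List.getD_append _ _ _ _ (by omega)]
      · have : (b' : ℕ) ≠ b := fun h => hbb (Fin.ext h)
        simp only [run, Store.app, Function.update_of_ne hbb] at ha ⊢
        rw [if_neg (by omega), hs.2.2.2.1 _ _ ha]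
    · simp only [State.setReg_mem, State.setMem_mem, h1.2.1]
      by_cases hbb : b' = b
      · subst hbb
        simp only [run, Store.app, Function.update_self, List.length_append, ← hn,
          List.length_singleton] at ha
        rw [if_neg (by omega), hs.2.2.2.2 _ _ hb' (by omega)]
      · have : (b' : ℕ) ≠ b := fun h => hbb (Fin.ext h)
        simp only [run, Store.app, Function.update_of_ne hbb] at ha
        rw [if_neg (by omega), hs.2.2.2.2 _ _ hb' ha]
    · iterate 7 rw [if_neg (by omega)]
      rw [h1.2.2 _ (by omega)]
  | seq P Q ihP ihQ =>
    intro d v s hs hok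
    refine Runs.seq ((ihP d v s hs hok.1).mono le_rfl fun s1 h1 =>
      (ihQ d _ s1 h1.1 hok.2).mono le_rfl fun s2 h2 => ⟨h2.1, fun i hi h => ?_⟩)
    rw [h2.2 i hi h, h1.2 i hi h]
  | ite e P Q ihP ihQ =>
    intro d v s hs hok
    refine (Runs.seq ((e.compile_runs 0 s hs).mono le_rfl fun s1 h1 =>
      Runs.ite (T := P.cost N + Q.cost N) (fun h => ?_) fun h => ?_)).mono
      (by simp only [cost]; omega) fun _ h => h
    all_goals
      have hs1 : Rep s1 v := hs.congr h1.2.1 fun i hi => h1.2.2 i (by omega)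
      have h2 : s1.reg 2 = e.ev v := h1.1
      rw [h2] at h
      simp only [run, Ok, h, ne_eq, not_true_eq_false, not_false_eq_true, if_true, if_false]
        at hok ⊢
    · refine (ihP d v s1 hs1 hok).mono (by omega) fun s3 h3 => ⟨h3.1, fun i hi hc => ?_⟩
      rw [h3.2 i hi hc, h1.2.2 i (by omega)]
    · refine (ihQ d v s1 hs1 hok).mono (by omega) fun s3 h3 => ⟨h3.1, fun i hi hc => ?_⟩
      rw [h3.2 i hi hc, h1.2.2 i (by omega)]
  | loc i e P ih =>
    intro d v s hs hok
    refine (Runs.seq ((e.compile_runs 0 s hs).mono le_rfl fun s1 h1 =>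
      Runs.seq <| Runs.const <| Runs.seq <| Runs.add <| Runs.seq <| Runs.add <| Runs.seq <|
      (ih (d + 1) (v.set i (e.ev v)) _ ?_ hok).mono le_rfl fun s2 h2 => Runs.seq <| Runs.const <|
      Runs.add ?_)).mono (by simp only [cost]; omega) fun _ h => h
    · refine hs.set (by simp [h1.2.1]) ?_ fun j h hj => ?_
      · have h2 : s1.reg 2 = e.ev v := h1.1
        simp only [State.setReg_reg, if_true, Nat.reduceEqDiff, if_false]
        rw [if_neg (by omega), h2, Nat.add_zero]
      · simp only [State.setReg_reg]
        rw [if_neg h, if_neg (by omega), if_neg (by omega), h1.2.2 _ (by omega)]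
    · have h5 := h2.2 (8 * d + 5) (by omega) (by omega)
      simp only [State.setReg_reg, if_true] at h5
      rw [if_neg (by omega), if_neg (by omega), h1.2.2 _ (by omega), hs.1] at h5
      refine ⟨h2.1.set rfl ?_ fun j h hj => ?_, fun j hj hc => ?_⟩
      · simp only [State.setReg_reg, if_true]
        rw [if_neg (by omega), h5, Nat.add_zero]
      · simp only [State.setReg_reg]
        rw [if_neg h, if_neg (by omega)]
      · simp only [State.setReg_reg]
        rw [if_neg (by omega), if_neg (by omega), h2.2 j (by omega) hc]
        simp only [State.setReg_reg]
        rw [if_neg (by omega), if_neg (by omega), if_neg (by omega), h1.2.2 _ (by omega)]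
  | loop i e P ih =>
    intro d v s hs hok
    set n := e.ev v with hn
    set g := iter (fun k u => (P.run (u.set i k)).set i (u.reg i)) v with hg
    have hgi : ∀ k, (g k).reg i = v.reg i := by
      intro k
      induction k with
      | zero => rfl
      | succ k ih => rw [hg, iter, ← ih]; simp [Store.set]; rfl
    refine (Runs.seq ((e.compile_runs 0 s hs).mono le_rfl fun s1 h1 =>
      Runs.seq <| Runs.const <| Runs.seq <| Runs.add <| Runs.seq <| Runs.const <| Runs.seq <|
      Runs.add ?_)).mono
      (by
        have := Nat.mul_le_mul_right (P.cost N + 7 + 1) hok.1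
        rw [← hn] at this
        simp only [cost]; omega : e.cost + (1 + (1 + (1 + (1 + (n * (P.cost N + 7 + 1) + 1))))) ≤ _)
      fun _ h => h
    have h2 : s1.reg 2 = n := h1.1
    have key := Runs.loop (i := 8 * d + 3) (T := P.cost N + 7)
      (P := .seq (.const 10 0) <| .seq (.add (8 * i) (8 * d + 4) 10) <|
        .seq (P.compile (d + 1)) <| .seq (.const 10 1) <|
        .seq (.add (8 * d + 4) (8 * d + 4) 10) <| .seq (.sub (8 * d + 3) (8 * d + 3) 10) <|
        .seq (.const 10 0) (.add (8 * i) (8 * d + 5) 10))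
      (fun m s' => m ≤ n ∧ s'.reg (8 * d + 3) = m ∧ s'.reg (8 * d + 4) = n - m ∧
        s'.reg (8 * d + 5) = v.reg i ∧ Rep s' (g (n - m)) ∧
        ∀ i, i < 8 * d → i % 8 = 3 ∨ i % 8 = 4 ∨ i % 8 = 5 → s'.reg i = s.reg i)
      (fun m s' h => h.2.1) ?_ n
    · refine (key _ ?_).mono le_rfl fun s' h => ⟨h.2.2.2.2.1, h.2.2.2.2.2⟩
      refine ⟨le_rfl, ?_, ?_, ?_, ?_, fun j hj hc => ?_⟩
      · simp only [State.setReg_reg, if_true, Nat.reduceEqDiff, if_false]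
        rw [if_neg (by omega), if_neg (by omega), h2, Nat.add_zero]
      · simp only [State.setReg_reg, if_true]
        rw [if_neg (by omega)]; omega
      · simp only [State.setReg_reg, if_true]
        iterate 5 rw [if_neg (by omega)]
        rw [h1.2.2 _ (by omega), hs.1]; omega
      · rw [Nat.sub_self]
        refine hs.congr h1.2.1 fun j hj => ?_
        simp only [State.setReg_reg]
        iterate 4 rw [if_neg (by omega)]
        rw [h1.2.2 _ (by omega)]
      · simp only [State.setReg_reg]
        iterate 4 rw [if_neg (by omega)]
        rw [h1.2.2 _ (by omega)]
    · rintro m s' ⟨hm, h3, h4, h5, hrep, hfr⟩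
      have hk : n - m = n - (m + 1) + 1 := by omega
      refine (Runs.seq <| Runs.const <| Runs.seq <| Runs.add <| Runs.seq <|
        (ih (d + 1) ((g (n - (m + 1))).set i (n - (m + 1))) _ ?_ (hok.2 _ (by omega))).mono le_rfl
        fun s2 hs2 => Runs.seq <| Runs.const <| Runs.seq <| Runs.add <| Runs.seq <| Runs.sub <|
        Runs.seq <| Runs.const <| Runs.add ?_).mono (by omega) fun _ h => h
      · refine hrep.set (by simp) ?_ fun j h hj => ?_
        · simp only [State.setReg_reg, if_true]
          rw [if_neg (by omega), h4, Nat.add_zero]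
        · simp only [State.setReg_reg]
          rw [if_neg h, if_neg (by omega)]
      · obtain ⟨hs2, hfr2⟩ := hs2
        have e3 := hfr2 (8 * d + 3) (by omega) (by omega)
        have e4 := hfr2 (8 * d + 4) (by omega) (by omega)
        have e5 := hfr2 (8 * d + 5) (by omega) (by omega)
        simp only [State.setReg_reg] at e3 e4 e5
        rw [if_neg (by omega), if_neg (by omega)] at e3 e4 e5
        refine ⟨by omega, ?_, ?_, ?_, ?_, fun j hj hc => ?_⟩
        · simp only [State.setReg_reg, if_true]
          iterate 2 rw [if_neg (by omega)]
          iterate 3 rw [if_neg (by omega)]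
          rw [e3, h3]; omega
        · simp only [State.setReg_reg, if_true]
          iterate 4 rw [if_neg (by omega)]
          rw [e4, h4]; omega
        · simp only [State.setReg_reg]
          iterate 5 rw [if_neg (by omega)]
          rw [e5, h5]
        · rw [hk]
          refine hs2.set (by simp) ?_ fun j h hj => ?_
          · simp only [State.setReg_reg, if_true]
            iterate 4 rw [if_neg (by omega)]
            rw [e5, h5, Nat.add_zero]; exact (hgi _).symm
          · simp only [State.setReg_reg]
            iterate 5 rw [if_neg (by omega)]
        · simp only [State.setReg_reg]
          iterate 5 rw [if_neg (by omega)]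
          rw [hfr2 j (by omega) hc]
          simp only [State.setReg_reg]
          iterate 2 rw [if_neg (by omega)]
          exact hfr j hj hc

end LoopLang

/-! ### Stable formulas -/

namespace FOC

/-- `φ'` is `φ` or is similar to it. -/
def Variant (lam : ℝ) (φ φ' : Formula) : Prop := φ' = φ ∨ φ.Similar lam φ'

/-- Under the assignment `β`, the formula `φ` and all formulas similar to it express `p`.  This
judgement determines the meaning of a formula and establishes its stability at the same time. -/
def Means {V : Type} (lam : ℝ) (G : SimpleGraph V) (φ : Formula) (β : ℕ → V) (p : Prop) : Prop :=
  ∀ φ', Variant lam φ φ' → (φ'.Sat G β ↔ p)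

/-- Conjunction. -/
def conj (φ ψ : Formula) : Formula := .neg (.or (.neg φ) (.neg ψ))

/-- Exclusive disjunction. -/
def xor (φ ψ : Formula) : Formula := .or (conj φ (.neg ψ)) (conj (.neg φ) ψ)

namespace Means

variable {V : Type} {lam : ℝ} {G : SimpleGraph V} {φ ψ : Formula} {β : ℕ → V} {p q : Prop}

theorem congr (h : Means lam G φ β p) (e : p ↔ q) : Means lam G φ β q :=
  fun φ' h' => (h φ' h').trans e

theorem eq (x y : ℕ) : Means lam G (.eq x y) β (β x = β y) := by
  rintro _ (rfl | h)
  · rfl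
  · cases h; rfl

theorem adj (x y : ℕ) : Means lam G (.adj x y) β (G.Adj (β x) (β y)) := by
  rintro _ (rfl | h)
  · rfl
  · cases h; rfl

theorem neg (h : Means lam G φ β p) : Means lam G (.neg φ) β ¬ p := by
  rintro _ (rfl | h')
  · simp only [Formula.Sat, h _ (.inl rfl)]
  · cases h' with
    | neg h' => simp only [Formula.Sat, h _ (.inr h')]

theorem or (h : Means lam G φ β p) (h2 : Means lam G ψ β q) :
    Means lam G (.or φ ψ) β (p ∨ q) := by
  rintro _ (rfl | h')
  · simp only [Formula.Sat, h _ (.inl rfl), h2 _ (.inl rfl)]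
  · cases h' with
    | or h' h2' => simp only [Formula.Sat, h _ (.inr h'), h2 _ (.inr h2')]

theorem ex (y : ℕ) {p : V → Prop} (h : ∀ a, Means lam G φ (Function.update β y a) (p a)) :
    Means lam G (.ex y φ) β (∃ a, p a) := by
  rintro _ (rfl | h')
  · simp only [Formula.Sat, h _ _ (.inl rfl)]
  · cases h' with
    | ex _ h' => simp only [Formula.Sat, h _ _ (.inr h')]

theorem conj (h : Means lam G φ β p) (h2 : p → Means lam G ψ β q) :
    Means lam G (conj φ ψ) β (p ∧ q) := by
  have key : ∀ φ' ψ', Variant lam φ φ' → Variant lam ψ ψ' →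
      ((FOC.conj φ' ψ').Sat G β ↔ p ∧ q) := by
    intro φ' ψ' h1 h3
    simp only [FOC.conj, Formula.Sat, h _ h1, not_or, not_not]
    exact and_congr_right fun hp => h2 hp _ h3
  rintro _ (rfl | h')
  · exact key _ _ (.inl rfl) (.inl rfl)
  · cases h' with
    | neg h' => cases h' with
      | or h1 h3 => cases h1 with
        | neg h1 => cases h3 with
          | neg h3 => exact key _ _ (.inr h1) (.inr h3)

theorem xor (h : Means lam G φ β p) (h2 : Means lam G ψ β q) :
    Means lam G (xor φ ψ) β (Xor p q) :=
  (((h.conj fun _ => h2.neg)).or (h.neg.conj fun _ => h2)).congr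
    (by unfold Xor; tauto)

end Means

/-- The number of neighbours of a vertex. -/
noncomputable def deg {V : Type} (G : SimpleGraph V) (v : V) : ℕ := Nat.card {w // G.Adj v w}

/-- The formula that compares the degree of `x` with that of `r`, in the form that the rule
admits: the two degrees are compared with each other, or their product with the number `N`. -/
def cmp (N : ℤ) (x r : ℕ) : Rule → Formula
  | .comparison => .gt (.mul (.const 1) (.count [0] (.adj x 0)))
      (.mul (.const 1) (.count [0] (.adj r 0)))
  | .subtraction => .gt (.sub (.count [0] (.adj x 0)) (.count [0] (.adj r 0))) (.const 0)
  | .product => .gt (.mul (.count [0] (.adj x 0)) (.count [0] (.adj r 0))) (.const N)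
  | .pairs => .gt (.count [0, 1] (conj (.adj x 0) (.adj r 1))) (.const N)

/-- On vertices of degrees `A` and `B`, the formula `cmp` expresses `p`, with so large a margin
that it is stable. -/
def Margin (lam : ℝ) (N : ℤ) (A B : ℕ) (p : Prop) : Rule → Prop
  | .comparison => (p → lam * B < A) ∧ (¬ p → lam * A ≤ B)
  | .subtraction => (p → B < A) ∧ (¬ p → A ≤ B)
  | .product => (p → lam * N < A * B) ∧ (¬ p → (A * B : ℝ) ≤ N / lam)
  | .pairs => (p → lam * N < A * B) ∧ (¬ p → (A * B : ℝ) ≤ N / lam)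

variable {V : Type} {lam : ℝ} {G : SimpleGraph V}

theorem sat_gt (s t : Term) (β : ℕ → V) :
    Formula.Sat G (.gt s t) β ↔ Term.val G s β > Term.val G t β := by simp only [Formula.Sat]

theorem val_const (N : ℤ) (β : ℕ → V) : Term.val G (.const N) β = N := by simp only [Term.val]

theorem val_sub (s t : Term) (β : ℕ → V) :
    Term.val G (.sub s t) β = Term.val G s β - Term.val G t β := by simp only [Term.val]

theorem val_mul (s t : Term) (β : ℕ → V) :
    Term.val G (.mul s t) β = Term.val G s β * Term.val G t β := by simp only [Term.val]

theorem val_count_adj {x : ℕ} (hx : x ≠ 0) (β : ℕ → V) :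
    Term.val G (.count [0] (.adj x 0)) β = deg G (β x) := by
  simp only [Term.val, Formula.Sat, deg, Nat.cast_inj]
  refine Nat.card_congr ((Equiv.funUnique (Fin 1) V).subtypeEquiv fun a => ?_)
  simp [assign, hx]

theorem val_count_pairs {x r : ℕ} (hx : 1 < x) (hr : 1 < r) (β : ℕ → V) :
    Term.val G (.count [0, 1] (conj (.adj x 0) (.adj r 1))) β = deg G (β x) * deg G (β r) := by
  simp only [Term.val, conj, Formula.Sat, deg, ← Nat.cast_mul, Nat.cast_inj, not_or, not_not]
  rw [← Nat.card_prod]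
  refine Nat.card_congr (((finTwoArrowEquiv V).subtypeEquiv fun a => ?_).trans
    (Equiv.subtypeProdEquivProd (p := fun w => G.Adj (β x) w) (q := fun w => G.Adj (β r) w)))
  have h0 : x ≠ 0 := by omega
  have h1 : x ≠ 1 := by omega
  have h2 : r ≠ 0 := by omega
  have h3 : r ≠ 1 := by omega
  simp [assign, h0, h1, h2, h3, finTwoArrowEquiv]

theorem similar_const {N : ℤ} {t : Term} (h : Term.Similar lam (.const N) t) :
    ∃ N' : ℤ, t = .const N' ∧ (N : ℝ) / lam ≤ N' ∧ (N' : ℝ) ≤ lam * N := by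
  cases h with
  | const h1 h2 => exact ⟨_, rfl, h1, h2⟩

theorem similar_count_adj {x : ℕ} {t : Term} (h : Term.Similar lam (.count [0] (.adj x 0)) t) :
    t = .count [0] (.adj x 0) := by
  cases h with
  | count _ h => cases h; rfl

theorem similar_count_pairs {x r : ℕ} {t : Term}
    (h : Term.Similar lam (.count [0, 1] (conj (.adj x 0) (.adj r 1))) t) :
    t = .count [0, 1] (conj (.adj x 0) (.adj r 1)) := by
  cases h with
  | count _ h => cases h with
    | neg h => cases h with
      | or h1 h2 => cases h1 with
        | neg h1 => cases h2 with
          | neg h2 => cases h1; cases h2; rfl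

theorem Means.cmp (hlam : 1 ≤ lam) {N : ℤ} (hN : 0 ≤ N) {x r : ℕ} (hx : 1 < x) (hr : 1 < r)
    {ρ : Rule} {β : ℕ → V} {p : Prop} (h : Margin lam N (deg G (β x)) (deg G (β r)) p ρ) :
    Means lam G (cmp N x r ρ) β p := by
  have hx0 : x ≠ 0 := by omega
  have hr0 : r ≠ 0 := by omega
  have hpos : 0 < lam := by linarith
  have hNlam : (N : ℝ) / lam ≤ N :=
    div_le_self (by exact_mod_cast hN) hlam
  have hNlam' : (N : ℝ) ≤ lam * N := le_mul_of_one_le_left (by exact_mod_cast hN) hlam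
  have prod : ∀ N' : ℤ, (N : ℝ) / lam ≤ N' → (N' : ℝ) ≤ lam * N →
      (p → lam * N < deg G (β x) * deg G (β r)) ∧
        (¬ p → (deg G (β x) * deg G (β r) : ℝ) ≤ N / lam) →
      ((deg G (β x) * deg G (β r) : ℤ) > N' ↔ p) := by
    intro N' h1 h2 hm
    constructor
    · intro hgt
      by_contra hp
      have := hm.2 hp
      have h3 : (N' : ℝ) < deg G (β x) * deg G (β r) := by exact_mod_cast hgt
      linarith
    · intro hp
      have := hm.1 hp
      have h3 : (N' : ℝ) < deg G (β x) * deg G (β r) := by linarith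
      exact_mod_cast h3
  cases ρ with
  | comparison =>
    have key : ∀ c d : ℤ, (1 : ℝ) ≤ c → (c : ℝ) ≤ lam → (1 : ℝ) ≤ d → (d : ℝ) ≤ lam →
        (((c * deg G (β x) : ℤ) > (d * deg G (β r) : ℤ)) ↔ p) := by
      intro c d hc hc' hd hd'
      have hA : (0 : ℝ) ≤ deg G (β x) := Nat.cast_nonneg _
      have hB : (0 : ℝ) ≤ deg G (β r) := Nat.cast_nonneg _
      constructor
      · intro hgt
        by_contra hp
        have h1 := h.2 hp
        have h2 : (d * deg G (β r) : ℝ) < c * deg G (β x) := by exact_mod_cast hgt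
        nlinarith [mul_le_mul_of_nonneg_right hc' hA, mul_le_mul_of_nonneg_right hd hB]
      · intro hp
        have h1 := h.1 hp
        have h2 : (d * deg G (β r) : ℝ) < c * deg G (β x) := by
          nlinarith [mul_le_mul_of_nonneg_right hc hA, mul_le_mul_of_nonneg_right hd' hB]
        exact_mod_cast h2
    have one : ∀ c : ℤ, ((1 : ℤ) : ℝ) / lam ≤ c → (1 : ℝ) ≤ c := by
      intro c hc
      have : (0 : ℝ) < c := lt_of_lt_of_le (by positivity) hc
      have : 0 < c := by exact_mod_cast this
      exact_mod_cast this
    rintro _ (rfl | h')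
    · have := key 1 1 (by simp) (by simpa using hlam) (by simp) (by simpa using hlam)
      simpa only [FOC.cmp, sat_gt, val_mul, val_const, val_count_adj hx0, val_count_adj hr0] using this
    · cases h' with
      | gt h1 h2 => cases h1 with
        | mul h1 h3 => cases h2 with
          | mul h2 h4 =>
            obtain ⟨c, rfl, hc, hc'⟩ := similar_const h1
            obtain ⟨d, rfl, hd, hd'⟩ := similar_const h2
            obtain rfl := similar_count_adj h3
            obtain rfl := similar_count_adj h4
            have := key c d (one c hc) (by simpa using hc') (one d hd) (by simpa using hd')
            simpa only [sat_gt, val_mul, val_const, val_count_adj hx0, val_count_adj hr0] using this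
  | subtraction =>
    have key : ((deg G (β x) : ℤ) - deg G (β r) > 0) ↔ p := by
      constructor
      · intro hgt
        by_contra hp
        have := h.2 hp
        omega
      · intro hp
        have := h.1 hp
        omega
    rintro _ (rfl | h')
    · simpa only [FOC.cmp, sat_gt, val_sub, val_mul, val_const, val_count_adj hx0, val_count_adj hr0,
        val_count_pairs hx hr] using key
    · cases h' with
      | gt h1 h2 => cases h1 with
        | sub h1 h3 =>
          obtain ⟨c, rfl, hc, hc'⟩ := similar_const h2
          obtain rfl := similar_count_adj h1
          obtain rfl := similar_count_adj h3
          have : c = 0 := by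
            simp only [Int.cast_zero, zero_div, mul_zero] at hc hc'
            exact_mod_cast le_antisymm hc' hc
          subst this
          simpa only [sat_gt, val_sub, val_mul, val_const, val_count_adj hx0, val_count_adj hr0,
            val_count_pairs hx hr] using key
  | product =>
    rintro _ (rfl | h')
    · simpa only [FOC.cmp, sat_gt, val_sub, val_mul, val_const, val_count_adj hx0, val_count_adj hr0,
        val_count_pairs hx hr] using prod N hNlam hNlam' h
    · cases h' with
      | gt h1 h2 => cases h1 with
        | mul h1 h3 =>
          obtain ⟨c, rfl, hc, hc'⟩ := similar_const h2
          obtain rfl := similar_count_adj h1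
          obtain rfl := similar_count_adj h3
          simpa only [sat_gt, val_sub, val_mul, val_const, val_count_adj hx0, val_count_adj hr0,
            val_count_pairs hx hr] using prod c hc hc' h
  | pairs =>
    rintro _ (rfl | h')
    · simpa only [FOC.cmp, sat_gt, val_sub, val_mul, val_const, val_count_adj hx0, val_count_adj hr0,
        val_count_pairs hx hr] using prod N hNlam hNlam' h
    · cases h' with
      | gt h1 h2 =>
        obtain ⟨c, rfl, hc, hc'⟩ := similar_const h2
        obtain rfl := similar_count_pairs h1
        simpa only [sat_gt, val_sub, val_mul, val_const, val_count_adj hx0, val_count_adj hr0,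
            val_count_pairs hx hr] using prod c hc hc' h

theorem Fragment.conj {ρ : Rule} {φ ψ : Formula} (h : Fragment ρ φ) (h' : Fragment ρ ψ) :
    Fragment ρ (conj φ ψ) := .neg (.or (.neg h) (.neg h'))

theorem Fragment.xor {ρ : Rule} {φ ψ : Formula} (h : Fragment ρ φ) (h' : Fragment ρ ψ) :
    Fragment ρ (xor φ ψ) := .or (h.conj (.neg h')) (.conj (.neg h) h')

theorem Fragment.cmp (N : ℤ) (x r : ℕ) (ρ : Rule) : Fragment ρ (cmp N x r ρ) := by
  cases ρ
  · exact .comparison _ _ (.adj _ _ _) (.adj _ _ _)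
  · exact .subtraction _ _ _ (.adj _ _ _) (.adj _ _ _)
  · exact .product _ _ _ (.adj _ _ _) (.adj _ _ _)
  · exact .pairs _ _ _ (by decide) (.conj (.adj _ _ _) (.adj _ _ _))

end FOC

/-! ### Games on directed graphs -/

/-- The game in which a token is moved along the edges of a digraph, starting from `u`.  The list
tells whose turn it is (`true` stands for the existential player), and `h` is the list of the
previous positions.  When the token has come to rest on `u`, the existential player wins if either
there is an edge from `u` to a previous position, or there is a loop at `u`, but not both. -/
def Play (E : ℕ → ℕ → Prop) : List Bool → List ℕ → ℕ → Prop
  | [], h, u => Xor (∃ w, E u w ∧ w ∈ h) (E u u)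
  | true :: os, h, u => ∃ v, E u v ∧ Play E os (u :: h) v
  | false :: os, h, u => ∀ v, E u v → Play E os (u :: h) v

namespace FOC

/-! ### Formulas that read the encoding of a game in a tree -/

section Predicates

variable {V : Type} (G : SimpleGraph V)

/-- `x` has at most one neighbour. -/
def IsLeaf (x : V) : Prop := ¬ ∃ a b, G.Adj x a ∧ G.Adj x b ∧ ¬ a = b

/-- `x` has a leaf among its neighbours. -/
def HasLeaf (x : V) : Prop := ∃ a, G.Adj x a ∧ IsLeaf G a

/-- `x` has a leaf among its neighbours, but none of its neighbours has. -/
def IsRuler (x : V) : Prop := HasLeaf G x ∧ ¬ ∃ a, G.Adj x a ∧ HasLeaf G a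

/-- `x` and one of its neighbours have leaves among their neighbours. -/
def IsCode (x : V) : Prop := HasLeaf G x ∧ ∃ y, G.Adj x y ∧ HasLeaf G y

/-- `(x, y)` is a pair of adjacent code vertices, the first of them next to `e`. -/
def SrcPair (e x y : V) : Prop := G.Adj e x ∧ HasLeaf G x ∧ G.Adj x y ∧ HasLeaf G y

/-- `(x, y)` is a pair of adjacent code vertices, joined to `e` by `z`. -/
def DstPair (e z x y : V) : Prop := G.Adj e z ∧ ¬ HasLeaf G z ∧ SrcPair G z x y

/-- No ruler separates `x` from `y`. -/
def SameCode (above : V → V → Prop) (x y : V) : Prop :=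
  ¬ ∃ r, IsRuler G r ∧ Xor (above x r) (above y r)

/-- Every pair of code vertices joined to `e` has the same codes as one next to `e'`. -/
def Matches (above : V → V → Prop) (e e' : V) : Prop :=
  ¬ ∃ z x y, DstPair G e z x y ∧
    ¬ ∃ x' y', SrcPair G e' x' y' ∧ SameCode G above x x' ∧ SameCode G above y y'

end Predicates

/-- The formula for `IsLeaf`. -/
def leafF (x : ℕ) : Formula :=
  .neg (.ex 2 (.ex 3 (conj (.adj x 2) (conj (.adj x 3) (.neg (.eq 2 3))))))

/-- The formula for `HasLeaf`. -/
def hasLeafF (x : ℕ) : Formula := .ex 4 (conj (.adj x 4) (leafF 4))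

/-- The formula for `IsRuler`. -/
def rulerF (x : ℕ) : Formula :=
  conj (hasLeafF x) (.neg (.ex 5 (conj (.adj x 5) (hasLeafF 5))))

/-- The formula for `SrcPair`. -/
def srcF (e x y : ℕ) : Formula :=
  conj (.adj e x) (conj (hasLeafF x) (conj (.adj x y) (hasLeafF y)))

/-- The formula for `DstPair`. -/
def dstF (e z x y : ℕ) : Formula := conj (.adj e z) (conj (.neg (hasLeafF z)) (srcF z x y))

/-- The formula for `SameCode`. -/
def sameF (ρ : Rule) (N : ℤ) (x y : ℕ) : Formula :=
  .neg (.ex 6 (conj (rulerF 6) (xor (cmp N x 6 ρ) (cmp N y 6 ρ))))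

/-- The formula for `Matches`. -/
def matchF (ρ : Rule) (N : ℤ) (e e' : ℕ) : Formula :=
  .neg (.ex 7 (.ex 8 (.ex 9 (conj (dstF e 7 8 9) (.neg (.ex 10 (.ex 11
    (conj (srcF e' 10 11) (conj (sameF ρ N 8 10) (sameF ρ N 9 11))))))))))

/-- The edge `19` leads to a vertex from which one of the edges `21, …, 20 + l` starts. -/
def hitF (ρ : Rule) (N : ℤ) : ℕ → Formula
  | 0 => .neg (.eq 19 19)
  | l + 1 => .or (matchF ρ N 19 (20 + (l + 1))) (hitF ρ N l)

/-- The winning condition after the edges `21, …, 20 + l` have been chosen. -/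
def finalF (ρ : Rule) (N : ℤ) (l : ℕ) : Formula :=
  xor (.ex 19 (conj (matchF ρ N (20 + l) 19) (hitF ρ N l)))
    (.ex 19 (conj (matchF ρ N (20 + l) 19) (matchF ρ N 19 19)))

/-- The formula for `Play`, where the variables `21, …, 20 + l` stand for the edges chosen so
far. -/
def playF (ρ : Rule) (N : ℤ) : List Bool → ℕ → Formula
  | [], l => finalF ρ N l
  | true :: os, l => .ex (20 + (l + 1)) (.neg (.or (.neg (matchF ρ N (20 + l) (20 + (l + 1))))
      (.neg (playF ρ N os (l + 1)))))
  | false :: os, l => .neg (.ex (20 + (l + 1)) (.neg (.or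
      (.neg (matchF ρ N (20 + l) (20 + (l + 1)))) (playF ρ N os (l + 1)))))

/-- The sentence for `Play`, where the rulers play the part of the edges that lead to the start. -/
def gameF (ρ : Rule) (N : ℤ) (os : List Bool) : Formula :=
  .ex 20 (conj (rulerF 20) (playF ρ N os 0))

section Meaning

variable {V : Type} {lam : ℝ} {G : SimpleGraph V} {β : ℕ → V}

open Function (update_self update_of_ne)

theorem means_leafF {x : ℕ} (hx : 3 < x) : Means lam G (leafF x) β (IsLeaf G (β x)) := by
  refine .neg (.ex 2 fun a => .ex 3 fun b => .conj ?_ fun _ => .conj ?_ fun _ => .neg ?_)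
  · refine (Means.adj _ _).congr ?_
    simp (disch := omega) only [update_self, update_of_ne]
  · refine (Means.adj _ _).congr ?_
    simp (disch := omega) only [update_self, update_of_ne]
  · refine (Means.eq _ _).congr ?_
    simp (disch := omega) only [update_self, update_of_ne]

theorem means_hasLeafF {x : ℕ} (hx : 4 < x) : Means lam G (hasLeafF x) β (HasLeaf G (β x)) := by
  refine .ex 4 fun a => .conj ?_ fun _ => ?_
  · refine (Means.adj _ _).congr ?_
    simp (disch := omega) only [update_self, update_of_ne]
  · refine (means_leafF (by omega)).congr ?_
    simp (disch := omega) only [update_self]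

theorem means_rulerF {x : ℕ} (hx : 5 < x) : Means lam G (rulerF x) β (IsRuler G (β x)) := by
  refine .conj (means_hasLeafF (by omega)) fun _ => .neg (.ex 5 fun a => .conj ?_ fun _ => ?_)
  · refine (Means.adj _ _).congr ?_
    simp (disch := omega) only [update_self, update_of_ne]
  · refine (means_hasLeafF (by omega)).congr ?_
    simp (disch := omega) only [update_self]

theorem means_srcF {e x y : ℕ} (hx : 4 < x) (hy : 4 < y) :
    Means lam G (srcF e x y) β (SrcPair G (β e) (β x) (β y)) :=
  .conj (.adj _ _) fun _ => .conj (means_hasLeafF hx) fun _ =>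
    .conj (.adj _ _) fun _ => means_hasLeafF hy

theorem means_dstF {e z x y : ℕ} (hz : 4 < z) (hx : 4 < x) (hy : 4 < y) :
    Means lam G (dstF e z x y) β (DstPair G (β e) (β z) (β x) (β y)) :=
  .conj (.adj _ _) fun _ => .conj (means_hasLeafF hz).neg fun _ => means_srcF hx hy

/-- The degrees of code vertices can be compared with those of rulers by the rule `ρ`. -/
def Separated (lam : ℝ) (G : SimpleGraph V) (ρ : Rule) (N : ℤ) (above : V → V → Prop) : Prop :=
  1 ≤ lam ∧ 0 ≤ N ∧
    ∀ x r, IsCode G x → IsRuler G r → Margin lam N (deg G x) (deg G r) (above x r) ρ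

variable {ρ : Rule} {N : ℤ} {above : V → V → Prop} (hsep : Separated lam G ρ N above)

include hsep

theorem means_sameF {x y : ℕ} (hx : 6 < x) (hy : 6 < y) (cx : IsCode G (β x))
    (cy : IsCode G (β y)) : Means lam G (sameF ρ N x y) β (SameCode G above (β x) (β y)) := by
  refine .neg (.ex 6 fun r => .conj ((means_rulerF (by omega)).congr ?_) fun hr => .xor ?_ ?_)
  · simp (disch := omega) only [update_self]
  · refine .cmp hsep.1 hsep.2.1 (by omega) (by omega) ?_
    simp (disch := omega) only [update_self, update_of_ne]
    exact hsep.2.2 _ _ cx hr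
  · refine .cmp hsep.1 hsep.2.1 (by omega) (by omega) ?_
    simp (disch := omega) only [update_self, update_of_ne]
    exact hsep.2.2 _ _ cy hr

theorem means_matchF {x y : ℕ} (hx : 11 < x) (hy : 11 < y) :
    Means lam G (matchF ρ N x y) β (Matches G above (β x) (β y)) := by
  refine .neg (.ex 7 fun z => .ex 8 fun a => .ex 9 fun b =>
    .conj ((means_dstF (by omega) (by omega) (by omega)).congr ?_) fun hd =>
    .neg (.ex 10 fun a' => .ex 11 fun b' => .conj
      ((means_srcF (by omega) (by omega)).congr ?_) fun hs => .conj ?_ fun _ => ?_))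
  · simp (disch := omega) only [update_self, update_of_ne]
  · simp (disch := omega) only [update_self, update_of_ne]
  all_goals
    obtain ⟨-, -, -, h1, h2, h3⟩ := hd
    obtain ⟨-, h4, h5, h6⟩ := hs
    refine (means_sameF hsep (by omega) (by omega) ?_ ?_).congr ?_
    all_goals simp (disch := omega) only [update_self, update_of_ne]
  · exact ⟨h1, _, h2, h3⟩
  · exact ⟨h4, _, h5, h6⟩
  · exact ⟨h3, _, h2.symm, h1⟩
  · exact ⟨h6, _, h5.symm, h4⟩

omit hsep in
/-- The vertices of `G` encode the edges of the digraph `E`: `src` and `dst` are the ends of the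
edge that a vertex encodes, if it encodes one, and the rulers encode half-edges to `u₀`. -/
structure Encodes (G : SimpleGraph V) (above : V → V → Prop) (src dst : V → Option ℕ)
    (E : ℕ → ℕ → Prop) (u₀ : ℕ) : Prop where
  edge : ∀ u v, E u v ↔ ∃ e, src e = some u ∧ dst e = some v
  dst_of_src : ∀ e u, src e = some u → ∃ v, dst e = some v
  ruler : ∀ r, IsRuler G r → dst r = some u₀
  exists_ruler : ∃ r, IsRuler G r
  matches_iff : ∀ e u, dst e = some u → ∀ e', Matches G above e e' ↔ src e' = some u

omit hsep in
/-- The edges `21, …, 20 + l` start in the vertices listed in `h`, in reverse order. -/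
def History (src : V → Option ℕ) (β : ℕ → V) : ℕ → List ℕ → Prop
  | 0, h => h = []
  | _ + 1, [] => False
  | l + 1, u :: h => src (β (20 + (l + 1))) = some u ∧ History src β l h

omit hsep in
theorem History.congr {src : V → Option ℕ} {β β' : ℕ → V} :
    ∀ {l : ℕ} {h : List ℕ}, History src β l h →
      (∀ i, 20 < i → i ≤ 20 + l → β' i = β i) → History src β' l h
  | 0, _, hh, _ => hh
  | _ + 1, [], hh, _ => hh
  | l + 1, u :: h, hh, e =>
    ⟨by rw [e _ (by omega) le_rfl]; exact hh.1, hh.2.congr fun i h1 h2 => e i h1 (by omega)⟩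

variable {src dst : V → Option ℕ} {E : ℕ → ℕ → Prop} {u₀ : ℕ}
  (henc : Encodes G above src dst E u₀)

include henc

theorem means_hitF {w : ℕ} (hw : dst (β 19) = some w) :
    ∀ {l : ℕ} {h : List ℕ}, History src β l h → Means lam G (hitF ρ N l) β (w ∈ h)
  | 0, _, rfl => (Means.eq _ _).neg.congr (by simp)
  | _ + 1, [], hh => hh.elim
  | l + 1, u :: h, hh => by
    refine (Means.or (means_matchF hsep (by omega) (by omega)) (means_hitF hw hh.2)).congr ?_
    rw [henc.matches_iff _ _ hw, hh.1, List.mem_cons, Option.some_inj, eq_comm]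

theorem means_finalF {u l : ℕ} {h : List ℕ} (hu : dst (β (20 + l)) = some u)
    (hh : History src β l h) :
    Means lam G (finalF ρ N l) β (Xor (∃ w, E u w ∧ w ∈ h) (E u u)) := by
  have hm : ∀ a, Means lam G (matchF ρ N (20 + l) 19) (Function.update β 19 a)
      (src a = some u) := fun a => by
    refine (means_matchF hsep (by omega) (by omega)).congr ?_
    simp (disch := omega) only [update_self, update_of_ne]
    exact henc.matches_iff _ _ hu _
  refine Means.xor
    ((Means.ex 19 (p := fun a => src a = some u ∧ ∃ w, dst a = some w ∧ w ∈ h)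
      fun a => .conj (hm a) fun ha => ?_).congr ?_)
    ((Means.ex 19 (p := fun a => src a = some u ∧ dst a = some u)
      fun a => .conj (hm a) fun ha => ?_).congr ?_)
  · obtain ⟨w, hw⟩ := henc.dst_of_src a u ha
    refine (means_hitF hsep henc (w := w) (by rwa [update_self])
      (hh.congr fun i h1 h2 => update_of_ne (by omega) _ _)).congr ?_
    simp [hw]
  · constructor
    · rintro ⟨a, h1, w, h2, h3⟩; exact ⟨w, (henc.edge _ _).2 ⟨a, h1, h2⟩, h3⟩
    · rintro ⟨w, h1, h3⟩
      obtain ⟨a, h1, h2⟩ := (henc.edge _ _).1 h1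
      exact ⟨a, h1, w, h2, h3⟩
  · obtain ⟨w, hw⟩ := henc.dst_of_src a u ha
    refine (means_matchF hsep (by omega) (by omega)).congr ?_
    simp only [update_self]
    rw [henc.matches_iff _ _ hw, ha, hw, Option.some_inj, Option.some_inj, eq_comm]
  · exact (henc.edge u u).symm

theorem means_playF (os : List Bool) : ∀ {β : ℕ → V} {u l : ℕ} {h : List ℕ},
    dst (β (20 + l)) = some u → History src β l h →
    Means lam G (playF ρ N os l) β (Play E os h u) := by
  have hm : ∀ {β : ℕ → V} {u l : ℕ}, dst (β (20 + l)) = some u → ∀ a,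
      Means lam G (matchF ρ N (20 + l) (20 + (l + 1))) (Function.update β (20 + (l + 1)) a)
        (src a = some u) := fun hu a => by
    refine (means_matchF hsep (by omega) (by omega)).congr ?_
    simp (disch := omega) only [update_self, update_of_ne]
    exact henc.matches_iff _ _ hu _
  have hhist : ∀ {β : ℕ → V} {u l : ℕ} {h : List ℕ}, History src β l h → ∀ a, src a = some u →
      History src (Function.update β (20 + (l + 1)) a) (l + 1) (u :: h) := fun hh a ha =>
    ⟨by rwa [update_self], hh.congr fun i h1 h2 => update_of_ne (by omega) _ _⟩
  induction os with
  | nil => intro β u l h hu hh; exact means_finalF hsep henc hu hh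
  | cons o os ih =>
    intro β u l h hu hh
    have step : ∀ a, src a = some u → Means lam G (playF ρ N os (l + 1))
        (Function.update β (20 + (l + 1)) a) (∀ v, dst a = some v → Play E os (u :: h) v) := by
      intro a ha
      obtain ⟨v, hv⟩ := henc.dst_of_src a u ha
      refine (ih (u := v) (by rwa [update_self]) (hhist hh a ha)).congr ?_
      simp [hv]
    cases o with
    | true =>
      refine (Means.ex _ (p := fun a => src a = some u ∧
        ∀ v, dst a = some v → Play E os (u :: h) v) fun a => .conj (hm hu a) (step a)).congr ?_
      constructor
      · rintro ⟨a, h1, h2⟩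
        obtain ⟨v, hv⟩ := henc.dst_of_src a u h1
        exact ⟨v, (henc.edge _ _).2 ⟨a, h1, hv⟩, h2 v hv⟩
      · rintro ⟨v, h1, h2⟩
        obtain ⟨a, h1, hv⟩ := (henc.edge _ _).1 h1
        refine ⟨a, h1, fun w hw => ?_⟩
        rw [hv, Option.some_inj] at hw
        exact hw ▸ h2
    | false =>
      refine (Means.neg (Means.ex _ (p := fun a => src a = some u ∧
        ¬ ∀ v, dst a = some v → Play E os (u :: h) v) fun a => ?_)).congr ?_
      · by_cases ha : src a = some u
        · exact ((((hm hu a).neg).or (step a ha)).neg).congr (by tauto)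
        · have h1 := (hm hu a)
          intro φ' hφ'
          have : ∃ χ ψ, φ' = .neg (.or (.neg χ) ψ) ∧
              Variant lam (matchF ρ N (20 + l) (20 + (l + 1))) χ := by
            rcases hφ' with rfl | h'
            · exact ⟨_, _, rfl, .inl rfl⟩
            · cases h' with
              | neg h' => cases h' with
                | or h2 h3 => cases h2 with
                  | neg h2 => exact ⟨_, _, rfl, .inr h2⟩
          obtain ⟨χ, ψ, rfl, hχ⟩ := this
          simp only [Formula.Sat, h1 χ hχ, ha]
          simp
      · constructor
        · intro h1 v hv
          obtain ⟨a, h2, h3⟩ := (henc.edge _ _).1 hv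
          by_contra h4
          exact h1 ⟨a, h2, fun h5 => h4 (h5 v h3)⟩
        · rintro h1 ⟨a, h2, h3⟩
          exact h3 fun v hv => h1 v ((henc.edge _ _).2 ⟨a, h2, hv⟩)

/-- Any ruler may play the part of the edge that leads to the start, so the existential quantifier
over rulers does not give the existential player a choice. -/
theorem means_gameF (os : List Bool) : Means lam G (gameF ρ N os) β (Play E os [] u₀) := by
  refine (Means.ex 20 (p := fun r => IsRuler G r ∧ Play E os [] u₀) fun r =>
    .conj ((means_rulerF (by omega)).congr (by rw [update_self])) fun hr => ?_).congr ?_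
  · refine means_playF hsep henc os (l := 0) ?_ rfl
    rw [Nat.add_zero, update_self]
    exact henc.ruler r hr
  · obtain ⟨r, hr⟩ := henc.exists_ruler
    exact ⟨fun ⟨_, _, h⟩ => h, fun h => ⟨r, hr, h⟩⟩

theorem models_gameF_iff [Nonempty V] (os : List Bool) :
    Models G (gameF ρ N os) ↔ Play E os [] u₀ := by
  obtain ⟨v⟩ := ‹Nonempty V›
  exact ⟨fun h => (means_gameF hsep henc (β := fun _ => v) os _ (.inl rfl)).1 (h _),
    fun h β => (means_gameF hsep henc os _ (.inl rfl)).2 h⟩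

theorem stable_gameF [Nonempty V] (os : List Bool) : Stable lam G (gameF ρ N os) := by
  intro φ' hφ'
  obtain ⟨v⟩ := ‹Nonempty V›
  rw [models_gameF_iff hsep henc]
  exact ⟨fun h β => (means_gameF hsep henc os _ (.inr hφ')).2 h,
    fun h => (means_gameF hsep henc (β := fun _ => v) os _ (.inr hφ')).1 (h _)⟩

end Meaning

section Form

variable {ρ : Rule} {N : ℤ}

theorem Fragment.leafF (x : ℕ) : Fragment ρ (leafF x) :=
  .neg (.ex _ (.ex _ (.conj (.adj _ _ _) (.conj (.adj _ _ _) (.neg (.eq _ _ _))))))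

theorem Fragment.hasLeafF (x : ℕ) : Fragment ρ (hasLeafF x) :=
  .ex _ (.conj (.adj _ _ _) (.leafF _))

theorem Fragment.rulerF (x : ℕ) : Fragment ρ (rulerF x) :=
  .conj (.hasLeafF _) (.neg (.ex _ (.conj (.adj _ _ _) (.hasLeafF _))))

theorem Fragment.srcF (e x y : ℕ) : Fragment ρ (srcF e x y) :=
  .conj (.adj _ _ _) (.conj (.hasLeafF _) (.conj (.adj _ _ _) (.hasLeafF _)))

theorem Fragment.sameF (x y : ℕ) : Fragment ρ (sameF ρ N x y) :=
  .neg (.ex _ (.conj (.rulerF _) (.xor (.cmp _ _ _ _) (.cmp _ _ _ _))))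

theorem Fragment.matchF (x y : ℕ) : Fragment ρ (matchF ρ N x y) :=
  .neg (.ex _ (.ex _ (.ex _ (.conj (.conj (.adj _ _ _) (.conj (.neg (.hasLeafF _)) (.srcF _ _ _)))
    (.neg (.ex _ (.ex _ (.conj (.srcF _ _ _) (.conj (.sameF _ _) (.sameF _ _))))))))))

theorem Fragment.hitF : ∀ l, Fragment ρ (hitF ρ N l)
  | 0 => .neg (.eq _ _ _)
  | l + 1 => .or (.matchF _ _) (.hitF l)

theorem Fragment.playF : ∀ os l, Fragment ρ (playF ρ N os l)
  | [], l => .xor (.ex _ (.conj (.matchF _ _) (.hitF l))) (.ex _ (.conj (.matchF _ _) (.matchF _ _)))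
  | true :: os, l => .ex _ (.conj (.matchF _ _) (.playF os (l + 1)))
  | false :: os, l => .neg (.ex _ (.neg (.or (.neg (.matchF _ _)) (.playF os (l + 1)))))

theorem Fragment.gameF (os : List Bool) : Fragment ρ (gameF ρ N os) :=
  .ex _ (.conj (.rulerF _) (.playF _ _))

theorem free_conj (φ ψ : Formula) : (conj φ ψ).free = φ.free ∪ ψ.free := by
  simp [conj, Formula.free]

theorem free_xor (φ ψ : Formula) : (xor φ ψ).free = φ.free ∪ ψ.free := by
  simp [xor, free_conj, Formula.free]

theorem free_hasLeafF {x z : ℕ} (hz : z ∈ (hasLeafF x).free) : z = x := by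
  simp only [hasLeafF, leafF, free_conj, Formula.free, Finset.mem_erase, Finset.mem_union,
    Finset.mem_insert, Finset.mem_singleton] at hz
  omega

theorem free_rulerF {x z : ℕ} (hz : z ∈ (rulerF x).free) : z = x := by
  simp only [rulerF, free_conj, Formula.free, Finset.mem_erase, Finset.mem_union,
    Finset.mem_insert, Finset.mem_singleton] at hz
  rcases hz with hz | ⟨h, (rfl | rfl) | hz⟩
  · exact free_hasLeafF hz
  · rfl
  · exact absurd rfl h
  · exact absurd (free_hasLeafF hz) h

theorem free_srcF {e x y z : ℕ} (hz : z ∈ (srcF e x y).free) : z = e ∨ z = x ∨ z = y := by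
  simp only [srcF, free_conj, Formula.free, Finset.mem_union,
    Finset.mem_insert, Finset.mem_singleton] at hz
  rcases hz with hz | hz | hz | hz
  · omega
  · have := free_hasLeafF hz; omega
  · omega
  · have := free_hasLeafF hz; omega

theorem free_cmp {x r z : ℕ} (hz : z ∈ (cmp N x r ρ).free) : z = x ∨ z = r := by
  cases ρ <;>
  simp [cmp, free_conj, Formula.free, Term.free] at hz <;>
  omega

theorem free_sameF {x y z : ℕ} (hz : z ∈ (sameF ρ N x y).free) : z = x ∨ z = y := by
  simp only [sameF, free_conj, free_xor, Formula.free, Finset.mem_erase, Finset.mem_union] at hz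
  rcases hz with ⟨h, hz | hz | hz⟩
  · exact absurd (free_rulerF hz) h
  · have := free_cmp hz; omega
  · have := free_cmp hz; omega

theorem free_matchF {x y z : ℕ} (hz : z ∈ (matchF ρ N x y).free) : z = x ∨ z = y := by
  simp only [matchF, dstF, free_conj, Formula.free, Finset.mem_erase, Finset.mem_union,
    Finset.mem_insert, Finset.mem_singleton] at hz
  rcases hz with ⟨h7, h8, h9, (hz | hz | hz) | ⟨h10, h11, hz | hz | hz⟩⟩
  · omega
  · have := free_hasLeafF hz; omega
  · have := free_srcF hz; omega
  · have := free_srcF hz; omega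
  · have := free_sameF hz; omega
  · have := free_sameF hz; omega

theorem free_hitF {z : ℕ} : ∀ {l : ℕ}, z ∈ (hitF ρ N l).free →
    z = 19 ∨ (20 < z ∧ z ≤ 20 + l)
  | 0, hz => by simp [hitF, Formula.free] at hz; omega
  | l + 1, hz => by
    simp only [hitF, Formula.free, Finset.mem_union] at hz
    rcases hz with hz | hz
    · have := free_matchF hz; omega
    · have := free_hitF hz; omega

theorem free_finalF {l z : ℕ} (hz : z ∈ (finalF ρ N l).free) : 20 ≤ z ∧ z ≤ 20 + l := by
  simp only [finalF, free_xor, free_conj, Formula.free, Finset.mem_erase, Finset.mem_union] at hz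
  rcases hz with ⟨h, hz | hz⟩ | ⟨h, hz | hz⟩
  · have := free_matchF hz; omega
  · have := free_hitF hz; omega
  · have := free_matchF hz; omega
  · have := free_matchF hz; omega

theorem free_playF {z : ℕ} : ∀ {os : List Bool} {l : ℕ}, z ∈ (playF ρ N os l).free →
    20 ≤ z ∧ z ≤ 20 + l
  | [], _, hz => free_finalF hz
  | true :: os, l, hz => by
    simp only [playF, Formula.free, Finset.mem_erase, Finset.mem_union] at hz
    rcases hz with ⟨h, hz | hz⟩
    · have := free_matchF hz; omega
    · have := free_playF hz; omega
  | false :: os, l, hz => by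
    simp only [playF, Formula.free, Finset.mem_erase, Finset.mem_union] at hz
    rcases hz with ⟨h, hz | hz⟩
    · have := free_matchF hz; omega
    · have := free_playF hz; omega

theorem isSentence_gameF (os : List Bool) : (gameF ρ N os).IsSentence := by
  refine Finset.eq_empty_of_forall_notMem fun z hz => ?_
  simp only [gameF, free_conj, Formula.free, Finset.mem_erase, Finset.mem_union] at hz
  rcases hz with ⟨h, hz | hz⟩
  · exact h (free_rulerF hz)
  · have := free_playF hz; omega

theorem length_matchF (x y : ℕ) : (matchF ρ N x y).length = (matchF ρ 0 0 0).length := by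
  cases ρ <;> rfl

theorem length_hitF (l : ℕ) :
    (hitF ρ N l).length = l * ((matchF ρ 0 0 0).length + 1) + 4 := by
  induction l with
  | zero => simp [hitF, Formula.length]
  | succ l ih => rw [hitF, Formula.length, ih, length_matchF]; ring

theorem length_playF (os : List Bool) : ∀ l : ℕ, (playF ρ N os l).length ≤
    (2 * os.length + l + 4) * (2 * (matchF ρ 0 0 0).length + 20) := by
  induction os with
  | nil =>
    intro l
    simp only [playF, finalF, xor, conj, Formula.length, length_hitF, length_matchF, List.length_nil]
    ring_nf; omega
  | cons o os ih =>
    intro l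
    have := ih (l + 1)
    cases o <;>
    · simp only [playF, Formula.length, length_matchF, List.length_cons]
      ring_nf at this ⊢; omega

/-- The length of the sentence is bounded in terms of the number of moves. -/
theorem length_gameF (os : List Bool) : (gameF ρ N os).length ≤
    (2 * os.length + 4) * (2 * (matchF ρ 0 0 0).length + 20) + 100 := by
  have := length_playF (ρ := ρ) (N := N) os 0
  have h : (rulerF 20).length ≤ 80 := by decide
  simp only [gameF, conj, Formula.length]
  simp only [Nat.add_zero] at this
  omega

end Form

end FOC

/-! ### Trees given by a parent function -/

/-- The graph that joins every vertex to its parent. -/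
def parentGraph {V : Type} (par : V → V) : SimpleGraph V where
  Adj u v := u ≠ v ∧ (par u = v ∨ par v = u)
  symm := ⟨fun _ _ h => ⟨h.1.symm, h.2.symm⟩⟩
  loopless := ⟨fun _ h => h.1 rfl⟩

namespace parentGraph

variable {V : Type} {par : V → V} {lvl : V → ℕ} {r : V} (hr : lvl r = 0)
  (hl : ∀ v, v ≠ r → lvl (par v) + 1 = lvl v) (hpr : par r = r)

include hl in
theorem adj_par {v : V} (hv : v ≠ r) : (parentGraph par).Adj v (par v) :=
  ⟨fun h => by have := hl v hv; rw [← h] at this; omega, .inl rfl⟩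

include hr hl in
theorem exists_walk (v : V) : ∃ w : (parentGraph par).Walk r v, w.length = lvl v := by
  induction h : lvl v generalizing v with
  | zero =>
    by_cases hv : v = r
    · subst hv; exact ⟨.nil, rfl⟩
    · have := hl v hv; omega
  | succ n ih =>
    have hv : v ≠ r := by rintro rfl; omega
    have := hl v hv
    obtain ⟨w, hw⟩ := ih (par v) (by omega)
    exact ⟨w.concat (adj_par hl hv).symm, by rw [SimpleGraph.Walk.length_concat, hw]⟩

include hr hl hpr in
theorem lvl_le_of_adj {u v : V} (h : (parentGraph par).Adj u v) : lvl v ≤ lvl u + 1 := by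
  obtain ⟨hne, h | h⟩ := h
  · by_cases hu : u = r
    · subst hu; exact absurd (hpr.symm.trans h) hne
    · have := hl u hu; rw [h] at this; omega
  · by_cases hv : v = r
    · subst hv; omega
    · have := hl v hv; rw [h] at this; omega

include hr hl hpr in
theorem dist_eq (v : V) : (parentGraph par).dist r v = lvl v := by
  obtain ⟨w, hw⟩ := exists_walk hr hl v
  apply le_antisymm
  · rw [← hw]; exact SimpleGraph.dist_le w
  · obtain ⟨w', hw'⟩ := (w.reachable).exists_walk_length_eq_dist
    rw [← hw']
    have : ∀ {a b : V} (p : (parentGraph par).Walk a b), lvl b ≤ lvl a + p.length := by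
      intro a b p
      induction p with
      | nil => simp
      | cons h p ih =>
        have := lvl_le_of_adj hr hl hpr h
        rw [SimpleGraph.Walk.length_cons]; omega
    have := this w'
    omega

include hr hl hpr in
theorem isTree [Finite V] : (parentGraph par).IsTree := by
  classical
  have := Fintype.ofFinite V
  rw [SimpleGraph.isTree_iff_connected_and_card]
  refine ⟨(SimpleGraph.connected_iff _).2 ⟨fun u v => ?_, ⟨r⟩⟩, ?_⟩
  · obtain ⟨w, -⟩ := exists_walk hr hl u
    obtain ⟨w', -⟩ := exists_walk hr hl v
    exact w.reachable.symm.trans w'.reachable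
  · -- The edges are in bijection with the vertices other than the root.
    let f : {v : V // v ≠ r} → (parentGraph par).edgeSet := fun v =>
      ⟨s(v.1, par v.1), (SimpleGraph.mem_edgeSet _).2 (adj_par hl v.2)⟩
    have hf : Function.Bijective f := by
      constructor
      · rintro ⟨u, hu⟩ ⟨v, hv⟩ h
        have h' : s(u, par u) = s(v, par v) := congrArg Subtype.val h
        rw [Sym2.eq_iff] at h'
        rcases h' with ⟨h1, -⟩ | ⟨h1, h2⟩
        · exact Subtype.ext h1
        · have := hl u hu
          have := hl v hv
          rw [h2] at *
          rw [← h1] at *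
          omega
      · rintro ⟨e, he⟩
        induction e with
        | _ a b =>
          obtain ⟨hne, h | h⟩ := (SimpleGraph.mem_edgeSet _).1 he
          · exact ⟨⟨a, fun h' => hne (by rw [← h, h', hpr])⟩, Subtype.ext (by simp [f, h])⟩
          · exact ⟨⟨b, fun h' => hne (by rw [← h, h', hpr])⟩,
              Subtype.ext (by simp [f, h, Sym2.eq_swap])⟩
    rw [← Nat.card_congr (Equiv.ofBijective f hf), Nat.card_eq_fintype_card,
      Nat.card_eq_fintype_card, Fintype.card_subtype_compl, Fintype.card_subtype_eq]
    have : 0 < Fintype.card V := Fintype.card_pos_iff.2 ⟨r⟩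
    omega

end parentGraph

/-! ### The tree that encodes a digraph -/

/-- A place to which the code of a vertex of the digraph is attached: the source or the target of
the edge number `e`, or the start vertex, a copy of which is attached to the ruler number `p`. -/
inductive Host : Type
  | src (e : ℕ)
  | dst (e : ℕ)
  | st (p : ℕ)

/-- The vertices of the tree: a chain, rulers and their leaves, records (one for each edge of the
digraph), and for every host `h` and every position `(i, j)` of the binary expansion of the number
encoded there the code vertices `a1` and `a2` with their leaves `l1` and `l2`, together with a
spacer above them unless the host is the source of an edge. -/
inductive Lab : Type
  | ch (k : ℕ)
  | rul (p : ℕ)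
  | rleaf (p x : ℕ)
  | rc (e : ℕ)
  | sp (h : Host) (i j : ℕ)
  | a1 (h : Host) (i j : ℕ)
  | a2 (h : Host) (i j : ℕ)
  | l1 (h : Host) (i j x : ℕ)
  | l2 (h : Host) (i j x : ℕ)

namespace Lab

/-- The parent of a vertex; the root is its own parent. -/
def par : Lab → Lab
  | ch k => ch (k - 1)
  | rul _ => ch 0
  | rleaf p _ => rul p
  | rc _ => ch 3
  | sp (.src e) _ _ => rc e
  | sp (.dst e) _ _ => rc e
  | sp (.st p) _ _ => rul p
  | a1 (.src e) _ _ => rc e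
  | a1 (.dst e) i j => sp (.dst e) i j
  | a1 (.st p) i j => sp (.st p) i j
  | a2 h i j => a1 h i j
  | l1 h i j _ => a1 h i j
  | l2 h i j _ => a2 h i j

/-- The distance of the vertex `a1 h i j` from the root. -/
def hostLvl : Host → ℕ
  | .src _ => 5
  | .dst _ => 6
  | .st _ => 3

/-- The distance of a vertex from the root. -/
def lvl : Lab → ℕ
  | ch k => k
  | rul _ => 1
  | rleaf _ _ => 2
  | rc _ => 4
  | sp (.src _) _ _ => 5
  | sp (.dst _) _ _ => 5
  | sp (.st _) _ _ => 2
  | a1 h _ _ => hostLvl h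
  | a2 h _ _ => hostLvl h + 1
  | l1 h _ _ _ => hostLvl h + 1
  | l2 h _ _ _ => hostLvl h + 2

theorem lvl_par (x : Lab) (hx : x ≠ ch 0) : lvl (par x) + 1 = lvl x := by
  rcases x with k | _ | _ | _ | ⟨_ | _ | _⟩ | ⟨_ | _ | _⟩ | ⟨_ | _ | _⟩ | ⟨_ | _ | _⟩ |
    ⟨_ | _ | _⟩ <;> simp only [par, lvl, hostLvl]
  have : k ≠ 0 := fun h => hx (by rw [h])
  omega

end Lab

/-- The data that determine the tree: numbers of `s * s` binary digits are encoded with leaves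
whose numbers are powers of `M`. -/
structure TreeData where
  s : ℕ
  M : ℕ
  start : ℕ
  edges : List (ℕ × ℕ)

namespace TreeData

open Lab

variable (D : TreeData)

/-- The number encoded at a host. -/
def num : Host → ℕ
  | .src e => (D.edges.getD e (0, 0)).1
  | .dst e => (D.edges.getD e (0, 0)).2
  | .st _ => D.start

/-- The code of the vertex `a2 h i j`: it tells the position `j` and the digit there. -/
def code (h : Host) (i j : ℕ) : ℕ := 2 * j + D.num h / 2 ^ (i * D.s + j) % 2 + 1

/-- The vertices below position `(i, j)` of a number, in the order of their creation. -/
def bitLabs (h : Host) (i j : ℕ) : List Lab :=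
  [a1 h i j, a2 h i j] ++ (List.range (D.M ^ (2 * D.code h i j))).map (l2 h i j) ++
    (List.range (D.M ^ (2 * (i + 1)))).map (l1 h i j)

/-- The vertices that encode the number at a source. -/
def srcLabs (h : Host) : List Lab :=
  (List.range D.s).flatMap fun i => (List.range D.s).flatMap fun j => D.bitLabs h i j

/-- The vertices that encode the number at another host. -/
def dstLabs (h : Host) : List Lab :=
  (List.range D.s).flatMap fun i => (List.range D.s).flatMap fun j => sp h i j :: D.bitLabs h i j

/-- The vertices of a ruler. -/
def rulerLabs (p : ℕ) : List Lab :=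
  rul p :: (D.dstLabs (.st p) ++ (List.range (D.M ^ (2 * p + 3))).map (rleaf p))

/-- The vertices of a record. -/
def recordLabs (e : ℕ) : List Lab := rc e :: (D.srcLabs (.src e) ++ D.dstLabs (.dst e))

/-- All vertices of the tree, in the order of their creation. -/
def labs : List Lab :=
  [ch 0, ch 1, ch 2, ch 3] ++ ((List.range (2 * D.s - 1)).flatMap D.rulerLabs ++
    (List.range D.edges.length).flatMap D.recordLabs)

/-- The host belongs to the tree. -/
def HostValid : Host → Prop
  | .src e => e < D.edges.length
  | .dst e => e < D.edges.length
  | .st p => p < 2 * D.s - 1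

/-- The vertex belongs to the tree. -/
def Valid : Lab → Prop
  | ch k => k < 4
  | rul p => p < 2 * D.s - 1
  | rleaf p x => p < 2 * D.s - 1 ∧ x < D.M ^ (2 * p + 3)
  | rc e => e < D.edges.length
  | sp h i j => D.HostValid h ∧ (∀ e, h ≠ .src e) ∧ i < D.s ∧ j < D.s
  | a1 h i j => D.HostValid h ∧ i < D.s ∧ j < D.s
  | a2 h i j => D.HostValid h ∧ i < D.s ∧ j < D.s
  | l1 h i j x => D.HostValid h ∧ i < D.s ∧ j < D.s ∧ x < D.M ^ (2 * (i + 1))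
  | l2 h i j x => D.HostValid h ∧ i < D.s ∧ j < D.s ∧ x < D.M ^ (2 * D.code h i j)

theorem mem_labs (x : Lab) : x ∈ D.labs ↔ D.Valid x := by
  have hk : ∀ k : ℕ, (k = 0 ∨ k = 1 ∨ k = 2 ∨ k = 3) ↔ k < 4 := by intro k; omega
  rcases x with k | _ | _ | _ | ⟨_ | _ | _⟩ | ⟨_ | _ | _⟩ | ⟨_ | _ | _⟩ | ⟨_ | _ | _⟩ |
    ⟨_ | _ | _⟩ <;>
  simp [labs, rulerLabs, recordLabs, srcLabs, dstLabs, bitLabs, Valid, HostValid, hk]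

theorem _root_.List.nodup_flatMap_of_tag {α β : Type} {l : List α} {f : α → List β}
    (tag : β → α) (hl : l.Nodup) (hf : ∀ a, (f a).Nodup) (ht : ∀ a, ∀ b ∈ f a, tag b = a) :
    (l.flatMap f).Nodup := by
  rw [List.nodup_flatMap]
  refine ⟨fun a _ => hf a, hl.imp ?_⟩
  intro a b hab x h1 h2
  exact hab ((ht _ _ h1).symm.trans (ht _ _ h2))

theorem nodup_bitLabs (h : Host) (i j : ℕ) : (sp h i j :: D.bitLabs h i j).Nodup := by
  simp only [bitLabs, List.nodup_cons, List.nodup_append, List.mem_append, List.mem_cons,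
    List.mem_map, List.not_mem_nil]
  refine ⟨by simp, ⟨⟨by simp, List.Nodup.map (fun a b h => by simpa using h) List.nodup_range,
    by simp⟩, List.Nodup.map (fun a b h => by simpa using h) List.nodup_range, by grind⟩⟩

theorem nodup_srcLabs (h : Host) : (D.srcLabs h).Nodup := by
  refine List.nodup_flatMap_of_tag
    (fun x => match x with | a1 _ i _ => i | a2 _ i _ => i | l1 _ i _ _ => i | l2 _ i _ _ => i | _ => 0)
    List.nodup_range (fun i => ?_) ?_
  · refine List.nodup_flatMap_of_tag
      (fun x => match x with | a1 _ _ j => j | a2 _ _ j => j | l1 _ _ j _ => j | l2 _ _ j _ => j | _ => 0)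
      List.nodup_range (fun j => (D.nodup_bitLabs h i j).of_cons) ?_
    simp only [bitLabs, List.mem_append, List.mem_cons, List.mem_map, List.not_mem_nil]
    grind
  · simp only [bitLabs, List.mem_append, List.mem_cons, List.mem_map, List.not_mem_nil,
      List.mem_flatMap]
    grind

theorem nodup_dstLabs (h : Host) : (D.dstLabs h).Nodup := by
  refine List.nodup_flatMap_of_tag
    (fun x => match x with | sp _ i _ => i | a1 _ i _ => i | a2 _ i _ => i | l1 _ i _ _ => i | l2 _ i _ _ => i | _ => 0)
    List.nodup_range (fun i => ?_) ?_
  · refine List.nodup_flatMap_of_tag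
      (fun x => match x with | sp _ _ j => j | a1 _ _ j => j | a2 _ _ j => j | l1 _ _ j _ => j | l2 _ _ j _ => j | _ => 0)
      List.nodup_range (fun j => D.nodup_bitLabs h i j) ?_
    simp only [bitLabs, List.mem_append, List.mem_cons, List.mem_map, List.not_mem_nil]
    grind
  · simp only [bitLabs, List.mem_append, List.mem_cons, List.mem_map, List.not_mem_nil,
      List.mem_flatMap]
    grind

/-- The host to which a vertex belongs (with arbitrary values on other vertices). -/
def hostOf : Lab → Host
  | sp h _ _ => h
  | a1 h _ _ => h
  | a2 h _ _ => h
  | l1 h _ _ _ => h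
  | l2 h _ _ _ => h
  | rul p => .st p
  | rleaf p _ => .st p
  | rc e => .src e
  | ch _ => .src 0

theorem hostOf_srcLabs {h : Host} {x : Lab} (hx : x ∈ D.srcLabs h) :
    hostOf x = h ∧ (∀ p, x ≠ rul p) ∧ (∀ p y, x ≠ rleaf p y) ∧ (∀ e, x ≠ rc e) ∧ ∀ k, x ≠ ch k := by
  simp only [srcLabs, bitLabs, List.mem_append, List.mem_cons, List.mem_map, List.not_mem_nil,
      List.mem_flatMap] at hx
  grind [hostOf]

theorem hostOf_dstLabs {h : Host} {x : Lab} (hx : x ∈ D.dstLabs h) :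
    hostOf x = h ∧ (∀ p, x ≠ rul p) ∧ (∀ p y, x ≠ rleaf p y) ∧ (∀ e, x ≠ rc e) ∧ ∀ k, x ≠ ch k := by
  simp only [dstLabs, bitLabs, List.mem_append, List.mem_cons, List.mem_map, List.not_mem_nil,
      List.mem_flatMap] at hx
  grind [hostOf]

theorem nodup_labs : D.labs.Nodup := by
  have hrul : ∀ p, ∀ x ∈ D.rulerLabs p, hostOf x = .st p ∧ ∀ k, x ≠ ch k := by
    intro p x hx
    simp only [rulerLabs, List.mem_cons, List.mem_append, List.mem_map] at hx
    rcases hx with rfl | hx | ⟨y, -, rfl⟩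
    · exact ⟨rfl, by simp⟩
    · exact ⟨(D.hostOf_dstLabs hx).1, (D.hostOf_dstLabs hx).2.2.2.2⟩
    · exact ⟨rfl, by simp⟩
  have hrec : ∀ e, ∀ x ∈ D.recordLabs e, (hostOf x = .src e ∨ hostOf x = .dst e) ∧
      ∀ k, x ≠ ch k := by
    intro e x hx
    simp only [recordLabs, List.mem_cons, List.mem_append] at hx
    rcases hx with rfl | hx | hx
    · exact ⟨.inl rfl, by simp⟩
    · exact ⟨.inl (D.hostOf_srcLabs hx).1, (D.hostOf_srcLabs hx).2.2.2.2⟩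
    · exact ⟨.inr (D.hostOf_dstLabs hx).1, (D.hostOf_dstLabs hx).2.2.2.2⟩
  simp only [labs, List.nodup_append]
  refine ⟨by simp, ⟨?_, ?_, ?_⟩, ?_⟩
  · refine List.nodup_flatMap_of_tag
      (fun x => match hostOf x with | .st p => p | _ => 0) List.nodup_range (fun p => ?_) ?_
    · simp only [rulerLabs, List.nodup_cons, List.nodup_append, List.mem_append, List.mem_map]
      refine ⟨?_, D.nodup_dstLabs _, List.Nodup.map (fun a b h => by simpa using h)
        List.nodup_range, ?_⟩
      · rintro (h | ⟨y, -, h⟩)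
        · exact (D.hostOf_dstLabs h).2.1 p rfl
        · simp at h
      · rintro x hx y ⟨z, -, rfl⟩ rfl
        exact (D.hostOf_dstLabs hx).2.2.1 p z rfl
    · intro p x hx; simp [(hrul p x hx).1]
  · refine List.nodup_flatMap_of_tag
      (fun x => match hostOf x with | .src p => p | .dst p => p | _ => 0)
      List.nodup_range (fun e => ?_) ?_
    · simp only [recordLabs, List.nodup_cons, List.nodup_append, List.mem_append]
      refine ⟨?_, D.nodup_srcLabs _, D.nodup_dstLabs _, ?_⟩
      · rintro (h | h)
        · exact (D.hostOf_srcLabs h).2.2.2.1 e rfl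
        · exact (D.hostOf_dstLabs h).2.2.2.1 e rfl
      · rintro x hx y hy rfl
        have := (D.hostOf_srcLabs hx).1.symm.trans (D.hostOf_dstLabs hy).1
        simp at this
    · intro e x hx
      rcases (hrec e x hx).1 with h | h <;> simp [h]
  · simp only [List.mem_flatMap]
    rintro x ⟨p, -, hp⟩ y ⟨e, -, he⟩ rfl
    rcases (hrec e x he).1 with h | h <;> rw [(hrul p x hp).1] at h <;> simp at h
  · simp only [List.mem_append, List.mem_flatMap]
    rintro x hx y (⟨p, -, hp⟩ | ⟨p, -, hp⟩) rfl
    · simp only [List.mem_cons, List.not_mem_nil] at hx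
      rcases hx with h | h | h | h | h <;> first | exact (hrul p x hp).2 _ h | exact h
    · simp only [List.mem_cons, List.not_mem_nil] at hx
      rcases hx with h | h | h | h | h <;> first | exact (hrec p x hp).2 _ h | exact h

theorem valid_par {x : Lab} (hx : D.Valid x) : D.Valid (par x) := by
  rcases x with k | _ | _ | _ | ⟨_ | _ | _⟩ | ⟨_ | _ | _⟩ | ⟨_ | _ | _⟩ | ⟨_ | _ | _⟩ |
    ⟨_ | _ | _⟩ <;> simp [Valid, par, HostValid] at hx ⊢ <;> omega

end TreeData

/-! ### Reading the tree -/

namespace TreeData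

open Lab FOC

variable (D : TreeData)

/-- A set `V` of vertices identified with the vertices of the tree. -/
structure Labelling (V : Type) where
  lab : V → Lab
  up : V → V
  inj : Function.Injective lab
  valid : ∀ v, D.Valid (lab v)
  surj : ∀ x, D.Valid x → ∃ v, lab v = x
  lab_up : ∀ v, lab (up v) = par (lab v)

/-- The leaves of the tree. -/
def LeafLab : Lab → Prop
  | rleaf _ _ => True
  | l1 _ _ _ _ => True
  | l2 _ _ _ _ => True
  | _ => False

/-- The vertices of the tree that have leaves as children. -/
def CodeLab : Lab → Prop
  | rul _ => True
  | a1 _ _ _ => True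
  | a2 _ _ _ => True
  | _ => False

/-- The code of a vertex, expressed by the number of its leaves. -/
def codeOf : Lab → ℕ
  | a1 _ i _ => i + 1
  | a2 h i j => D.code h i j
  | _ => 0

/-- The number of a ruler. -/
def rulerOf : Lab → ℕ
  | rul p => p + 1
  | _ => 0

/-- The number from which the edge encoded at a vertex starts. -/
def srcOf : Lab → Option ℕ
  | rc e => some (D.num (.src e))
  | _ => none

/-- The number to which the edge encoded at a vertex leads. -/
def dstOf : Lab → Option ℕ
  | rc e => some (D.num (.dst e))
  | rul _ => some D.start
  | _ => none

/-- The requirements on the parameters of the tree. -/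
structure Good : Prop where
  two_le_s : 2 ≤ D.s
  sq_lt_M : D.s * D.s + 1 ≤ D.M
  edges_ne : D.edges ≠ []
  lt_start : D.start < 2 ^ (D.s * D.s)
  lt_edges : ∀ p ∈ D.edges, p.1 < 2 ^ (D.s * D.s) ∧ p.2 < 2 ^ (D.s * D.s)

theorem not_leafLab_par (x : Lab) : ¬ LeafLab (par x) := by
  rcases x with _ | _ | _ | _ | ⟨_ | _ | _⟩ | ⟨_ | _ | _⟩ | _ | _ | _ <;> simp [par, LeafLab]

theorem codeLab_par {x : Lab} (h : LeafLab x) : CodeLab (par x) := by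
  rcases x with _ | _ | _ | _ | ⟨_ | _ | _⟩ | ⟨_ | _ | _⟩ | _ | _ | _ <;>
    simp [par, LeafLab, CodeLab] at h ⊢

theorem eq_a2_of_codeLab {x : Lab} (hx : CodeLab x) (h : CodeLab (par x)) :
    ∃ h i j, x = a2 h i j := by
  rcases x with _ | _ | _ | _ | ⟨_ | _ | _⟩ | ⟨_ | _ | _⟩ | _ | _ | _ <;>
    simp [par, CodeLab] at h hx ⊢

/-- The vertex `a1` or `a2` next to a given vertex that is not a record. -/
def codeNbr : Lab → Lab
  | sp h i j => a1 h i j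
  | a1 h i j => a2 h i j
  | a2 h i j => a1 h i j
  | l1 h i j _ => a1 h i j
  | l2 h i j _ => a2 h i j
  | _ => ch 0

theorem eq_codeNbr {x y : Lab} (hy : ∀ k, y ≠ rc k)
    (hx : ∃ h i j, x = a1 h i j ∨ x = a2 h i j) (hxy : par y = x ∨ par x = y) :
    x = codeNbr y := by
  obtain ⟨h, i, j, rfl | rfl⟩ := hx <;> rcases hxy with hxy | hxy
  · rcases y with _ | _ | _ | _ | ⟨_ | _ | _⟩ | ⟨_ | _ | _⟩ | _ | _ | _ <;>
      simp [par, codeNbr] at hxy ⊢ <;> simp [hxy]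
  · subst hxy
    rcases h with e | _ | _
    · exact absurd rfl (hy e)
    · rfl
    · rfl
  · rcases y with _ | _ | _ | _ | ⟨_ | _ | _⟩ | ⟨_ | _ | _⟩ | _ | _ | _ <;>
      simp [par, codeNbr] at hxy ⊢
    simp [hxy]
  · subst hxy
    rfl

/-- Next to a vertex that is not a record, there is at most one vertex `a1` or `a2`. -/
theorem code_nbr_unique {y x x' : Lab} (hy : ∀ k, y ≠ rc k)
    (hx : ∃ h i j, x = a1 h i j ∨ x = a2 h i j) (hx' : ∃ h i j, x' = a1 h i j ∨ x' = a2 h i j)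
    (h : par y = x ∨ par x = y) (h' : par y = x' ∨ par x' = y) : x = x' :=
  (eq_codeNbr hy hx h).trans (eq_codeNbr hy hx' h').symm

variable {D} {V : Type} (L : D.Labelling V)

namespace Good

variable (hD : D.Good)
include hD

theorem M_pos : 0 < D.M := by have := hD.sq_lt_M; omega

theorem pow_pos (k : ℕ) : 0 < D.M ^ k := Nat.pow_pos hD.M_pos

theorem length_pos : 0 < D.edges.length := List.length_pos_iff.2 hD.edges_ne

theorem s_pos : 0 < D.s := by have := hD.two_le_s; omega

theorem num_lt (h : Host) : D.num h < 2 ^ (D.s * D.s) := by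
  have key : ∀ e, (D.edges.getD e (0, 0)).1 < 2 ^ (D.s * D.s) ∧
      (D.edges.getD e (0, 0)).2 < 2 ^ (D.s * D.s) := by
    intro e
    by_cases he : e < D.edges.length
    · rw [List.getD_eq_getElem _ _ he]; exact hD.lt_edges _ (List.getElem_mem _)
    · rw [List.getD_eq_default _ _ (by omega)]; simp
  cases h with
  | src e => exact (key e).1
  | dst e => exact (key e).2
  | st p => exact hD.lt_start

end Good

namespace Labelling

/-- The tree on the vertices `V`. -/
def graph : SimpleGraph V := parentGraph L.up

theorem adj_iff (u v : V) : L.graph.Adj u v ↔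
    L.lab u ≠ L.lab v ∧ (par (L.lab u) = L.lab v ∨ par (L.lab v) = L.lab u) := by
  have h : ∀ u v, L.up u = v ↔ par (L.lab u) = L.lab v := fun u v => by
    rw [← L.lab_up]; exact ⟨fun h => by rw [h], fun h => L.inj h⟩
  change (u ≠ v ∧ _) ↔ _
  rw [h, h, ne_eq, ← L.inj.eq_iff]

theorem exists_adj {v : V} {y : Lab} (hy : D.Valid y) (hne : L.lab v ≠ y)
    (h : par (L.lab v) = y ∨ par y = L.lab v) : ∃ w, L.lab w = y ∧ L.graph.Adj v w := by
  obtain ⟨w, rfl⟩ := L.surj y hy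
  exact ⟨w, rfl, (L.adj_iff _ _).2 ⟨hne, h⟩⟩

/-- The number of a ruler and the code of a vertex stand in the relation that the rule `ρ` can
express. -/
def above (ρ : Rule) (x r : V) : Prop :=
  match ρ with
  | .comparison => rulerOf (L.lab r) < D.codeOf (L.lab x)
  | .subtraction => rulerOf (L.lab r) < D.codeOf (L.lab x)
  | .product => 2 * D.s < D.codeOf (L.lab x) + rulerOf (L.lab r)
  | .pairs => 2 * D.s < D.codeOf (L.lab x) + rulerOf (L.lab r)

variable (hD : D.Good)
include hD

theorem isLeaf_iff (v : V) : IsLeaf L.graph v ↔ LeafLab (L.lab v) := by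
  constructor
  · -- All other vertices have two different neighbours.
    contrapose!
    have two : ∀ y y', D.Valid y → D.Valid y' → L.lab v ≠ y → L.lab v ≠ y' → y ≠ y' →
        (par (L.lab v) = y ∨ par y = L.lab v) → (par (L.lab v) = y' ∨ par y' = L.lab v) →
        ¬ IsLeaf L.graph v := by
      intro y y' hy hy' h1 h2 h3 h4 h5
      obtain ⟨w, rfl, hw⟩ := L.exists_adj hy h1 h4
      obtain ⟨w', rfl, hw'⟩ := L.exists_adj hy' h2 h5
      exact fun h => h ⟨w, w', hw, hw', fun e => h3 (by rw [e])⟩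
    have hv := L.valid v
    have hs := hD.two_le_s
    have hR := hD.length_pos
    intro hl
    rcases hx : L.lab v with k | p | _ | e | ⟨h, i, j⟩ | ⟨h, i, j⟩ | ⟨h, i, j⟩ | _ | _ <;>
      rw [hx] at hl two hv <;> simp only [LeafLab, not_true_eq_false, not_false_eq_true] at hl
    · simp only [Valid] at hv
      rcases k with _ | _ | _ | _ | k
      · exact two (ch 1) (rul 0) (by simp [Valid]) (by simp [Valid]; omega) (by simp) (by simp)
          (by simp) (by simp [par]) (by simp [par])
      · exact two (ch 0) (ch 2) (by simp [Valid]) (by simp [Valid]) (by simp) (by simp)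
          (by simp) (by simp [par]) (by simp [par])
      · exact two (ch 1) (ch 3) (by simp [Valid]) (by simp [Valid]) (by simp) (by simp)
          (by simp) (by simp [par]) (by simp [par])
      · exact two (ch 2) (rc 0) (by simp [Valid]) (by simpa [Valid]) (by simp) (by simp)
          (by simp) (by simp [par]) (by simp [par])
      · omega
    · exact two (ch 0) (rleaf p 0) (by simp [Valid]) ⟨hv, hD.pow_pos _⟩ (by simp) (by simp)
          (by simp) (by simp [par]) (by simp [par])
    · exact two (ch 3) (a1 (.src e) 0 0) (by simp [Valid]) ⟨hv, hD.s_pos, hD.s_pos⟩ (by simp)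
          (by simp) (by simp) (by simp [par]) (by simp [par])
    · refine two (par (sp h i j)) (a1 h i j) (D.valid_par hv) ⟨hv.1, hv.2.2⟩ ?_ (by simp) ?_
        (.inl rfl) (.inr ?_) <;> cases h <;> simp [par]
      exact hv.2.1 _ rfl
    · refine two (par (a1 h i j)) (a2 h i j) (D.valid_par hv) hv ?_ (by simp) ?_
        (.inl rfl) (.inr ?_) <;> cases h <;> simp [par]
    · exact two (a1 h i j) (l2 h i j 0) hv ⟨hv.1, hv.2.1, hv.2.2, hD.pow_pos _⟩ (by simp) (by simp)
          (by simp) (by simp [par]) (by simp [par])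
  · rintro hl ⟨a, b, ha, hb, hab⟩
    have key : ∀ w, L.graph.Adj v w → L.lab w = par (L.lab v) := by
      intro w hw
      rcases ((L.adj_iff _ _).1 hw).2 with h | h
      · exact h.symm
      · exfalso
        rw [← h] at hl
        exact not_leafLab_par _ hl
    exact hab (L.inj ((key a ha).trans (key b hb).symm))

theorem hasLeaf_iff (v : V) : HasLeaf L.graph v ↔ CodeLab (L.lab v) := by
  constructor
  · rintro ⟨a, ha, hl⟩
    rw [L.isLeaf_iff hD] at hl
    obtain ⟨-, h | h⟩ := (L.adj_iff _ _).1 ha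
    · rw [← h] at hl
      exact absurd hl (not_leafLab_par _)
    · rw [← h]
      exact codeLab_par hl
  · intro hc
    have hv := L.valid v
    have leaf : ∀ y, D.Valid y → L.lab v ≠ y → par y = L.lab v → LeafLab y →
        HasLeaf L.graph v := by
      intro y hy h1 h2 h3
      obtain ⟨w, rfl, hw⟩ := L.exists_adj hy h1 (.inr h2)
      exact ⟨w, hw, (L.isLeaf_iff hD w).2 h3⟩
    rcases hx : L.lab v with k | p | _ | e | ⟨h, i, j⟩ | ⟨h, i, j⟩ | ⟨h, i, j⟩ | _ | _ <;>
      rw [hx] at hc leaf hv <;> simp only [CodeLab] at hc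
    · exact leaf (rleaf p 0) ⟨hv, hD.pow_pos _⟩ (by simp) rfl trivial
    · exact leaf (l1 h i j 0) ⟨hv.1, hv.2.1, hv.2.2, hD.pow_pos _⟩ (by simp) rfl trivial
    · exact leaf (l2 h i j 0) ⟨hv.1, hv.2.1, hv.2.2, hD.pow_pos _⟩ (by simp) rfl trivial

/-- Two adjacent vertices with leaves are the two code vertices of one digit. -/
theorem codeLab_adj {x y : V} (hxy : L.graph.Adj x y) (hx : HasLeaf L.graph x)
    (hy : HasLeaf L.graph y) : ∃ h i j, (L.lab x = a1 h i j ∧ L.lab y = a2 h i j) ∨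
      (L.lab x = a2 h i j ∧ L.lab y = a1 h i j) := by
  rw [L.hasLeaf_iff hD] at hx hy
  obtain ⟨-, h | h⟩ := (L.adj_iff _ _).1 hxy
  · rw [← h] at hy ⊢
    obtain ⟨h', i, j, h1⟩ := eq_a2_of_codeLab hx hy
    exact ⟨h', i, j, .inr ⟨h1, by rw [h1]; rfl⟩⟩
  · rw [← h] at hx ⊢
    obtain ⟨h', i, j, h1⟩ := eq_a2_of_codeLab hy hx
    exact ⟨h', i, j, .inl ⟨by rw [h1]; rfl, h1⟩⟩

theorem isRuler_iff (v : V) : IsRuler L.graph v ↔ ∃ p, L.lab v = rul p := by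
  constructor
  · rintro ⟨h1, h2⟩
    have hv := L.valid v
    have h1' := (L.hasLeaf_iff hD v).1 h1
    rcases hx : L.lab v with k | p | _ | e | _ | ⟨h, i, j⟩ | ⟨h, i, j⟩ | _ | _ <;>
      rw [hx] at h1' hv <;> simp only [CodeLab] at h1'
    · exact ⟨p, rfl⟩
    · exfalso
      obtain ⟨w, hw, hadj⟩ := L.exists_adj (v := v) (y := a2 h i j) hv (by simp [hx])
        (by simp [hx, par])
      exact h2 ⟨w, hadj, (L.hasLeaf_iff hD w).2 (by simp [hw, CodeLab])⟩
    · exfalso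
      obtain ⟨w, hw, hadj⟩ := L.exists_adj (v := v) (y := a1 h i j) hv (by simp [hx])
        (by simp [hx, par])
      exact h2 ⟨w, hadj, (L.hasLeaf_iff hD w).2 (by simp [hw, CodeLab])⟩
  · rintro ⟨p, hp⟩
    have h1 : HasLeaf L.graph v := (L.hasLeaf_iff hD v).2 (by simp [hp, CodeLab])
    refine ⟨h1, ?_⟩
    rintro ⟨w, hw, h2⟩
    obtain ⟨h, i, j, ⟨h3, -⟩ | ⟨h3, -⟩⟩ := L.codeLab_adj hD hw h1 h2 <;> simp [hp] at h3

theorem isCode_lab {v : V} (hv : IsCode L.graph v) :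
    ∃ h i j, L.lab v = a1 h i j ∨ L.lab v = a2 h i j := by
  obtain ⟨h1, w, hw, h2⟩ := hv
  obtain ⟨h, i, j, ⟨h3, -⟩ | ⟨h3, -⟩⟩ := L.codeLab_adj hD hw h1 h2
  · exact ⟨h, i, j, .inl h3⟩
  · exact ⟨h, i, j, .inr h3⟩

omit hD in
theorem codeOf_mem {v : V} {h : Host} {i j : ℕ}
    (hv : L.lab v = a1 h i j ∨ L.lab v = a2 h i j) :
    1 ≤ D.codeOf (L.lab v) ∧ D.codeOf (L.lab v) ≤ 2 * D.s := by
  have h1 := L.valid v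
  rcases hv with hv | hv <;> rw [hv] at h1 ⊢ <;> simp only [Valid] at h1 <;>
    simp only [codeOf, code] <;> omega

theorem sameCode_iff (ρ : Rule) {x y : V} (hx : IsCode L.graph x) (hy : IsCode L.graph y) :
    SameCode L.graph (L.above ρ) x y ↔ D.codeOf (L.lab x) = D.codeOf (L.lab y) := by
  constructor
  · intro h
    obtain ⟨h1, i, j, hx⟩ := L.isCode_lab hD hx
    obtain ⟨h2, i', j', hy⟩ := L.isCode_lab hD hy
    have hx := L.codeOf_mem hx
    have hy := L.codeOf_mem hy
    by_contra hne
    -- A ruler between the two codes separates the vertices.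
    have sep : ∀ p, p < 2 * D.s - 1 →
        (∀ r : V, L.lab r = rul p → Xor (L.above ρ x r) (L.above ρ y r)) → False := by
      intro p hp hr
      obtain ⟨r, hr'⟩ := L.surj (rul p) hp
      exact h ⟨r, (L.isRuler_iff hD r).2 ⟨p, hr'⟩, hr r hr'⟩
    cases ρ
    case comparison | subtraction =>
      refine sep (min (D.codeOf (L.lab x)) (D.codeOf (L.lab y)) - 1) (by omega) fun r hr => ?_
      simp only [above, hr, rulerOf, Xor]; omega
    case product | pairs =>
      refine sep (2 * D.s - min (D.codeOf (L.lab x)) (D.codeOf (L.lab y)) - 1) (by omega)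
        fun r hr => ?_
      simp only [above, hr, rulerOf, Xor]; omega
  · rintro h ⟨r, -, hr⟩
    cases ρ <;> simp only [above, h, Xor] at hr <;> omega

omit hD in
theorem bits_injective {a b s : ℕ} (hs : 0 < s) (ha : a < 2 ^ (s * s)) (hb : b < 2 ^ (s * s))
    (h : ∀ i < s, ∀ j < s, a / 2 ^ (i * s + j) % 2 = b / 2 ^ (i * s + j) % 2) : a = b := by
  refine Nat.eq_of_testBit_eq fun q => ?_
  by_cases hq : q < s * s
  · have h1 := h (q / s) (Nat.div_lt_of_lt_mul hq) (q % s) (Nat.mod_lt _ hs)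
    rw [Nat.div_add_mod' q s] at h1
    simp [Nat.testBit, Nat.shiftRight_eq_div_pow, Nat.one_and_eq_mod_two, h1]
  · have : 2 ^ (s * s) ≤ 2 ^ q := Nat.pow_le_pow_right (by norm_num) (by omega)
    rw [Nat.testBit_lt_two_pow (by omega), Nat.testBit_lt_two_pow (by omega)]

theorem matches_iff (ρ : Rule) {e : V} {u : ℕ} (he : D.dstOf (L.lab e) = some u) (e' : V) :
    Matches L.graph (L.above ρ) e e' ↔ D.srcOf (L.lab e') = some u := by
  -- The host of the digits joined to `e`.
  obtain ⟨h₀, hv₀, hnum, hsrc, hown⟩ : ∃ h₀, D.HostValid h₀ ∧ D.num h₀ = u ∧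
      (∀ k, h₀ ≠ .src k) ∧ ∀ h i j, L.lab e = par (sp h i j) → (∀ k, h ≠ .src k) → h = h₀ := by
    have hv := L.valid e
    rcases hx : L.lab e with k | p | _ | k | _ | _ | _ | _ | _ <;> rw [hx] at he hv <;>
      simp only [dstOf, reduceCtorEq, Option.some_inj] at he
    · refine ⟨.st p, hv, he, by simp, fun h i j h1 h2 => ?_⟩
      cases h <;> simp [par] at h1 h2 ⊢
      exact h1.symm
    · refine ⟨.dst k, hv, he, by simp, fun h i j h1 h2 => ?_⟩
      cases h <;> simp [par] at h1 h2 ⊢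
      exact h1.symm
  have hpar : L.lab e = par (sp h₀ 0 0) := by
    rcases hx : L.lab e with k | p | _ | k | _ | _ | _ | _ | _ <;> rw [hx] at he <;>
      simp only [dstOf, reduceCtorEq] at he
    · have := hown (.st p) 0 0 (by simp [hx, par]) (by simp)
      rw [← this]; rfl
    · have := hown (.dst k) 0 0 (by simp [hx, par]) (by simp)
      rw [← this]; rfl
  have hpar' : ∀ i j, par (sp h₀ i j) = L.lab e := by
    intro i j; rw [hpar]; cases h₀ <;> rfl
  have hdst : ∀ z x y, DstPair L.graph e z x y →
      ∃ i j, i < D.s ∧ j < D.s ∧ L.lab x = a1 h₀ i j ∧ L.lab y = a2 h₀ i j := by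
    rintro z x y ⟨h1, h2, h3, h4, h5, h6⟩
    obtain ⟨h, i, j, h7⟩ := L.codeLab_adj hD h5 h4 h6
    have hvx := L.valid x
    obtain ⟨-, h8⟩ := (L.adj_iff _ _).1 h3
    obtain ⟨-, h9⟩ := (L.adj_iff _ _).1 h1
    rw [L.hasLeaf_iff hD] at h2
    rcases h7 with ⟨h7, h7'⟩ | ⟨h7, h7'⟩
    · rw [h7] at h8 hvx
      have hz : L.lab z = par (a1 h i j) := by
        rcases h8 with h8 | h8
        · exfalso
          rcases hz : L.lab z with _ | _ | _ | _ | ⟨_ | _ | _⟩ | ⟨_ | _ | _⟩ | _ | _ | _ <;>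
            rw [hz] at h8 h2 h9 <;> simp [par, CodeLab] at h8 h2
          rcases h9 with h9 | h9
          · rcases hx : L.lab e with _ | _ | _ | _ | ⟨_ | _ | _⟩ | ⟨_ | _ | _⟩ | _ | _ | _ <;>
              rw [hx] at h9 <;> simp [par] at h9
          · rw [← h9] at he; simp [par, dstOf] at he
        · exact h8.symm
      have hh : ∀ k, h ≠ .src k := by
        rintro k rfl
        rw [hz] at h9
        simp only [par] at h9
        rcases h9 with h9 | h9
        · rcases hx : L.lab e with _ | _ | _ | _ | ⟨_ | _ | _⟩ | ⟨_ | _ | _⟩ | _ | _ | _ <;>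
            rw [hx] at h9 he <;> simp [dstOf] at h9 he
        · rw [← h9] at he; simp [dstOf] at he
      have hz' : L.lab z = sp h i j := by
        rw [hz]; cases h <;> simp [par] at hh ⊢
      rw [hz'] at h9
      rcases h9 with h9 | h9
      · exfalso
        rcases hx : L.lab e with _ | _ | _ | _ | ⟨_ | _ | _⟩ | ⟨_ | _ | _⟩ | _ | _ | _ <;>
            rw [hx] at h9 he <;> simp [par, dstOf] at h9 he
      · have := hown h i j h9.symm hh
        subst this
        exact ⟨i, j, hvx.2.1, hvx.2.2, h7, h7'⟩
    · exfalso
      rw [h7] at h8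
      rcases h8 with h8 | h8
      · rcases hz : L.lab z with _ | _ | _ | _ | ⟨_ | _ | _⟩ | ⟨_ | _ | _⟩ | _ | _ | _ <;>
            rw [hz] at h8 h2 h9 <;> simp [par, CodeLab] at h8 h2
        rcases h9 with h9 | h9
        · rcases hx : L.lab e with _ | _ | _ | _ | ⟨_ | _ | _⟩ | ⟨_ | _ | _⟩ | _ | _ | _ <;>
            rw [hx] at h9 <;> simp [par] at h9
        · rw [← h9] at he; simp [par, dstOf] at he
      · rw [← h8] at h2; simp [par, CodeLab] at h2
  have hdst' : ∀ i j, i < D.s → j < D.s → ∃ z x y, DstPair L.graph e z x y ∧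
      L.lab x = a1 h₀ i j ∧ L.lab y = a2 h₀ i j := by
    intro i j hi hj
    obtain ⟨z, hz, hez⟩ := L.exists_adj (v := e) (y := sp h₀ i j) ⟨hv₀, hsrc, hi, hj⟩
      (by intro h; rw [h] at he; simp [dstOf] at he) (.inr (hpar' i j))
    obtain ⟨x, hx, hzx⟩ := L.exists_adj (v := z) (y := a1 h₀ i j) ⟨hv₀, hi, hj⟩
      (by simp [hz]) (.inr (by rw [hz]; cases h₀ <;> simp [par] at hsrc ⊢))
    obtain ⟨y, hy, hxy⟩ := L.exists_adj (v := x) (y := a2 h₀ i j) ⟨hv₀, hi, hj⟩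
      (by simp [hx]) (by simp [hx, par])
    refine ⟨z, x, y, ⟨hez, ?_, hzx, ?_, hxy, ?_⟩, hx, hy⟩ <;> rw [L.hasLeaf_iff hD] <;>
      simp [hx, hy, hz, CodeLab]
  have hsame : ∀ {e₁ e₂ x y x' y'}, SrcPair L.graph e₁ x y → SrcPair L.graph e₂ x' y' →
      (SameCode L.graph (L.above ρ) x x' ∧ SameCode L.graph (L.above ρ) y y' ↔
        D.codeOf (L.lab x) = D.codeOf (L.lab x') ∧ D.codeOf (L.lab y) = D.codeOf (L.lab y')) := by
    rintro e₁ e₂ x y x' y' ⟨-, h1, h2, h3⟩ ⟨-, h4, h5, h6⟩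
    rw [L.sameCode_iff hD ρ ⟨h1, _, h2, h3⟩ ⟨h4, _, h5, h6⟩,
      L.sameCode_iff hD ρ ⟨h3, _, h2.symm, h1⟩ ⟨h6, _, h5.symm, h4⟩]
  by_cases hrc : ∃ k, L.lab e' = rc k
  · obtain ⟨k, hk⟩ := hrc
    have hvk : k < D.edges.length := by have := L.valid e'; rwa [hk] at this
    have hs : ∀ x y, SrcPair L.graph e' x y ↔ ∃ i j, i < D.s ∧ j < D.s ∧
        L.lab x = a1 (.src k) i j ∧ L.lab y = a2 (.src k) i j := by
      intro x y
      constructor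
      · rintro ⟨h1, h2, h3, h4⟩
        obtain ⟨h, i, j, h7⟩ := L.codeLab_adj hD h3 h2 h4
        have hvx := L.valid x
        obtain ⟨-, h8⟩ := (L.adj_iff _ _).1 h1
        rw [hk] at h8
        rcases h7 with ⟨h7, h7'⟩ | ⟨h7, h7'⟩ <;> rw [h7] at h8 hvx <;> cases h <;>
          simp [par] at h8
        subst h8
        exact ⟨i, j, hvx.2.1, hvx.2.2, h7, h7'⟩
      · rintro ⟨i, j, hi, hj, hx, hy⟩
        refine ⟨(L.adj_iff _ _).2 (by simp [hk, hx, par]), ?_, (L.adj_iff _ _).2 (by simp [hx, hy, par]),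
          ?_⟩ <;> rw [L.hasLeaf_iff hD] <;> simp [hx, hy, CodeLab]
    rw [hk, srcOf, Option.some_inj, ← hnum]
    constructor
    · intro hm
      refine (bits_injective hD.s_pos (hD.num_lt _) (hD.num_lt _) fun i hi j hj => ?_)
      obtain ⟨z, x, y, hd, hx, hy⟩ := hdst' i j hi hj
      by_contra hne
      refine hm ⟨z, x, y, hd, ?_⟩
      rintro ⟨x', y', hs', hc⟩
      rw [hsame hd.2.2 hs'] at hc
      obtain ⟨i', j', -, -, hx', hy'⟩ := (hs _ _).1 hs'
      rw [hx, hy, hx', hy'] at hc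
      simp only [codeOf, code] at hc
      obtain rfl : i = i' := by omega
      obtain rfl : j = j' := by omega
      omega
    · rintro heq ⟨z, x, y, hd, hno⟩
      obtain ⟨i, j, hi, hj, hx, hy⟩ := hdst _ _ _ hd
      obtain ⟨x', hx'⟩ := L.surj (a1 (.src k) i j) ⟨hvk, hi, hj⟩
      obtain ⟨y', hy'⟩ := L.surj (a2 (.src k) i j) ⟨hvk, hi, hj⟩
      have hs' := (hs x' y').2 ⟨i, j, hi, hj, hx', hy'⟩
      refine hno ⟨x', y', hs', (hsame hd.2.2 hs').2 ?_⟩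
      rw [hx, hx', hy, hy']
      simp [codeOf, code, heq]
  · -- Next to any other vertex, there is at most one pair of code vertices.
    have hsrc' : D.srcOf (L.lab e') = none := by
      rcases hx : L.lab e' with _ | _ | _ | k | _ | _ | _ | _ | _ <;> simp only [srcOf]
      exact absurd ⟨k, hx⟩ hrc
    simp only [hsrc', reduceCtorEq, iff_false]
    intro hm
    have huniq : ∀ x y x' y', SrcPair L.graph e' x y → SrcPair L.graph e' x' y' →
        L.lab x = L.lab x' := by
      rintro x y x' y' ⟨h1, h2, h3, h4⟩ ⟨h1', h2', h3', h4'⟩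
      obtain ⟨h, i, j, h7⟩ := L.codeLab_adj hD h3 h2 h4
      obtain ⟨h', i', j', h7'⟩ := L.codeLab_adj hD h3' h2' h4'
      obtain ⟨-, h8⟩ := (L.adj_iff _ _).1 h1
      obtain ⟨-, h8'⟩ := (L.adj_iff _ _).1 h1'
      exact code_nbr_unique (fun k hk => hrc ⟨k, hk⟩) ⟨h, i, j, by tauto⟩ ⟨h', i', j', by tauto⟩
        h8 h8'
    have hpair : ∀ i < D.s, ∃ x y, SrcPair L.graph e' x y ∧ D.codeOf (L.lab x) = i + 1 := by
      intro i hi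
      obtain ⟨z, x, y, hd, hx, hy⟩ := hdst' i 0 hi hD.s_pos
      by_contra hno
      refine hm ⟨z, x, y, hd, ?_⟩
      rintro ⟨x', y', hs', hc⟩
      rw [hsame hd.2.2 hs', hx] at hc
      exact hno ⟨x', y', hs', hc.1.symm⟩
    obtain ⟨x, y, hs0, hc0⟩ := hpair 0 hD.s_pos
    obtain ⟨x', y', hs1, hc1⟩ := hpair 1 hD.two_le_s
    rw [huniq _ _ _ _ hs0 hs1, hc1] at hc0
    omega

theorem encodes (ρ : Rule) : Encodes L.graph (L.above ρ) (fun v => D.srcOf (L.lab v))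
    (fun v => D.dstOf (L.lab v)) (fun u v => (u, v) ∈ D.edges) D.start where
  edge u v := by
    constructor
    · intro h
      obtain ⟨k, hk, he⟩ := List.mem_iff_getElem.1 h
      obtain ⟨e, hle⟩ := L.surj (rc k) hk
      refine ⟨e, ?_, ?_⟩ <;> simp [hle, srcOf, dstOf, num, hk, he]
    · rintro ⟨e, h1, h2⟩
      have hv := L.valid e
      rcases hx : L.lab e with _ | _ | _ | k | _ | _ | _ | _ | _ <;> rw [hx] at h1 h2 hv <;>
        simp only [srcOf, dstOf, reduceCtorEq, Option.some_inj, num] at h1 h2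
      rw [List.getD_eq_getElem _ _ hv] at h1 h2
      rw [← h1, ← h2]
      exact List.getElem_mem _
  dst_of_src e u h := by
    rcases hx : L.lab e with _ | _ | _ | k | _ | _ | _ | _ | _ <;>
      simp [hx, srcOf, dstOf] at h ⊢
  ruler r hr := by
    obtain ⟨p, hp⟩ := (L.isRuler_iff hD r).1 hr
    simp [hp, dstOf]
  exists_ruler := by
    have hs := hD.two_le_s
    obtain ⟨r, hr⟩ := L.surj (rul 0) (by simp only [Valid]; omega)
    exact ⟨r, (L.isRuler_iff hD r).2 ⟨0, hr⟩⟩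
  matches_iff e u he e' := L.matches_iff hD ρ he e'

end Labelling

end TreeData

/-! ### The size of the tree and its degrees -/

namespace TreeData

open Lab FOC

variable {D : TreeData}

namespace Labelling

variable {V : Type} (L : D.Labelling V)

theorem deg_le {v : V} (F : Finset Lab)
    (h : ∀ y, D.Valid y → par (L.lab v) = y ∨ par y = L.lab v → y ∈ F) :
    deg L.graph v ≤ F.card := by
  rw [← Set.ncard_coe_finset, ← Nat.card_coe_set_eq]
  exact Nat.card_le_card_of_injective
    (fun w : {w // L.graph.Adj v w} =>
      (⟨L.lab w, h _ (L.valid _) ((L.adj_iff _ _).1 w.2).2⟩ : (F : Set Lab)))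
    fun a b hab => Subtype.ext (L.inj (congrArg Subtype.val hab))

theorem le_deg [Finite V] {v : V} (F : Finset Lab)
    (h : ∀ y ∈ F, D.Valid y ∧ L.lab v ≠ y ∧ par y = L.lab v) : F.card ≤ deg L.graph v := by
  rw [← Set.ncard_coe_finset, ← Nat.card_coe_set_eq]
  have h' : ∀ y : (F : Set Lab), ∃ w : {w // L.graph.Adj v w}, L.lab w = y := by
    intro y
    obtain ⟨h1, h2, h3⟩ := h y y.2
    obtain ⟨w, hw, hadj⟩ := L.exists_adj h1 h2 (.inr h3)
    exact ⟨⟨w, hadj⟩, hw⟩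
  choose g hg using h'
  exact Nat.card_le_card_of_injective g fun a b hab => Subtype.ext (by rw [← hg, ← hg, hab])

theorem card_image_range {f : ℕ → Lab} (hf : Function.Injective f) (n : ℕ) [DecidableEq Lab] :
    ((Finset.range n).image f).card = n := by
  rw [Finset.card_image_of_injective _ hf, Finset.card_range]

variable (hD : D.Good)
include hD

/-- The degree of a code vertex is, up to a factor of two, a power of `M` with an even exponent. -/
theorem deg_code [Finite V] {v : V} (hv : IsCode L.graph v) :
    D.M ^ (2 * D.codeOf (L.lab v)) ≤ deg L.graph v ∧
      deg L.graph v ≤ 2 * D.M ^ (2 * D.codeOf (L.lab v)) := by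
  classical
  obtain ⟨h, i, j, hx⟩ := L.isCode_lab hD hv
  have hc := (L.codeOf_mem hx).1
  have hM : 2 ≤ D.M ^ (2 * D.codeOf (L.lab v)) := by
    have h2 : 2 ≤ D.M := by have := hD.sq_lt_M; have := hD.two_le_s; nlinarith
    calc 2 ≤ D.M := h2
      _ = D.M ^ 1 := (pow_one _).symm
      _ ≤ _ := Nat.pow_le_pow_right hD.M_pos (by omega)
  have hval := L.valid v
  rcases hx with hx | hx <;> rw [hx] at hM hval ⊢ <;> simp only [codeOf] at hM ⊢
  · have hinj : Function.Injective (l1 h i j) := fun a b hab => by simpa using hab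
    constructor
    · calc _ = _ := (card_image_range hinj _).symm
        _ ≤ _ := L.le_deg _ ?_
      simp only [Finset.mem_image, Finset.mem_range]
      rintro y ⟨x, hx', rfl⟩
      exact ⟨⟨hval.1, hval.2.1, hval.2.2, hx'⟩, by simp [hx], by simp [par, hx]⟩
    · refine (L.deg_le ({par (a1 h i j), a2 h i j} ∪
        (Finset.range (D.M ^ (2 * (i + 1)))).image (l1 h i j)) ?_).trans ?_
      · rintro y hy (h' | h')
        · simp [← h', hx]
        · rw [hx] at h'
          rcases y with _ | _ | _ | _ | ⟨_ | _ | _⟩ | ⟨_ | _ | _⟩ | _ | _ | _ <;>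
            simp [par] at h' <;> obtain ⟨rfl, rfl, rfl⟩ := h' <;> simp
          exact .inr hy.2.2.2
      · refine (Finset.card_union_le _ _).trans ?_
        rw [card_image_range hinj]
        have := Finset.card_le_two (a := par (a1 h i j)) (b := a2 h i j)
        omega
  · have hinj : Function.Injective (l2 h i j) := fun a b hab => by simpa using hab
    constructor
    · calc _ = _ := (card_image_range hinj _).symm
        _ ≤ _ := L.le_deg _ ?_
      simp only [Finset.mem_image, Finset.mem_range]
      rintro y ⟨x, hx', rfl⟩
      exact ⟨⟨hval.1, hval.2.1, hval.2.2, hx'⟩, by simp [hx], by simp [par, hx]⟩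
    · refine (L.deg_le ({par (a2 h i j)} ∪
        (Finset.range (D.M ^ (2 * D.code h i j))).image (l2 h i j)) ?_).trans ?_
      · rintro y hy (h' | h')
        · simp [← h', hx]
        · rw [hx] at h'
          rcases y with _ | _ | _ | _ | ⟨_ | _ | _⟩ | ⟨_ | _ | _⟩ | _ | _ | _ <;>
            simp [par] at h'
          obtain ⟨rfl, rfl, rfl⟩ := h'
          have := hy.2.2.2
          simp [this]
      · refine (Finset.card_union_le _ _).trans ?_
        rw [card_image_range hinj, Finset.card_singleton]
        omega

/-- The degree of a ruler is, up to a factor of two, a power of `M` with an odd exponent. -/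
theorem deg_ruler [Finite V] {v : V} (hv : IsRuler L.graph v) :
    D.M ^ (2 * rulerOf (L.lab v) + 1) ≤ deg L.graph v ∧
      deg L.graph v ≤ 2 * D.M ^ (2 * rulerOf (L.lab v) + 1) := by
  classical
  obtain ⟨p, hx⟩ := (L.isRuler_iff hD v).1 hv
  have hval := L.valid v
  have hM : D.s * D.s + 1 ≤ D.M ^ (2 * p + 3) :=
    calc _ ≤ D.M := hD.sq_lt_M
      _ = D.M ^ 1 := (pow_one _).symm
      _ ≤ _ := Nat.pow_le_pow_right hD.M_pos (by omega)
  rw [hx] at hval ⊢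
  simp only [rulerOf, show 2 * (p + 1) + 1 = 2 * p + 3 by ring]
  have hinj : Function.Injective (rleaf p) := fun a b hab => by simpa using hab
  constructor
  · calc _ = _ := (card_image_range hinj _).symm
      _ ≤ _ := L.le_deg _ ?_
    simp only [Finset.mem_image, Finset.mem_range]
    rintro y ⟨x, hx', rfl⟩
    exact ⟨⟨hval, hx'⟩, by simp [hx], by simp [par, hx]⟩
  · refine (L.deg_le ({ch 0} ∪ ((Finset.range D.s ×ˢ Finset.range D.s).image
      (fun q => sp (.st p) q.1 q.2) ∪
        (Finset.range (D.M ^ (2 * p + 3))).image (rleaf p))) ?_).trans ?_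
    · rintro y hy (h' | h')
      · simp [← h', hx, par]
      · rw [hx] at h'
        rcases y with _ | _ | ⟨p', x⟩ | _ | ⟨_ | _ | _, i, j⟩ | ⟨_ | _ | _⟩ | _ | _ | _ <;>
          simp [par] at h' <;> subst h'
        · simp [hy.2]
        · simp [hy.2.2.1, hy.2.2.2]
    · refine (Finset.card_union_le _ _).trans ?_
      have h1 := Finset.card_union_le ((Finset.range D.s ×ˢ Finset.range D.s).image
        (fun q => sp (.st p) q.1 q.2)) ((Finset.range (D.M ^ (2 * p + 3))).image (rleaf p))
      have h2 : ((Finset.range D.s ×ˢ Finset.range D.s).image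
        (fun q => sp (.st p) q.1 q.2)).card ≤ D.s * D.s :=
        Finset.card_image_le.trans (by simp)
      rw [card_image_range hinj] at h1
      rw [Finset.card_singleton]
      omega

/-- The degrees of code vertices are about even powers of `M`, those of rulers about odd powers.
So their quotient is off from one by a factor of about `M`, and their product, an odd power, is off
from the even power `M ^ (4 * s + 2)` by such a factor. -/
theorem separated [Finite V] (ρ : Rule) {lam : ℝ} (hlam : 1 ≤ lam) (hlamM : 4 * lam ≤ D.M) :
    Separated lam L.graph ρ ((D.M ^ (4 * D.s + 2) : ℕ) : ℤ) (L.above ρ) := by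
  refine ⟨hlam, by positivity, fun x r hx hr => ?_⟩
  obtain ⟨hA1, hA2⟩ := L.deg_code hD hx
  obtain ⟨hB1, hB2⟩ := L.deg_ruler hD hr
  have hM0 : 0 < D.M := hD.M_pos
  have hpow : ∀ {a b : ℕ}, a ≤ b → (D.M : ℝ) ^ a ≤ (D.M : ℝ) ^ b := fun h =>
    pow_le_pow_right₀ (by exact_mod_cast hM0) h
  have hA1' : (D.M : ℝ) ^ (2 * D.codeOf (L.lab x)) ≤ deg L.graph x := by exact_mod_cast hA1
  have hA2' : (deg L.graph x : ℝ) ≤ 2 * (D.M : ℝ) ^ (2 * D.codeOf (L.lab x)) := by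
    exact_mod_cast hA2
  have hB1' : (D.M : ℝ) ^ (2 * rulerOf (L.lab r) + 1) ≤ deg L.graph r := by exact_mod_cast hB1
  have hB2' : (deg L.graph r : ℝ) ≤ 2 * (D.M : ℝ) ^ (2 * rulerOf (L.lab r) + 1) := by
    exact_mod_cast hB2
  have hpos : ∀ k : ℕ, 0 < (D.M : ℝ) ^ k := fun k => by positivity
  -- Passing to the next power of `M` more than makes up for the factor `lam` and the factors two.
  have step : ∀ k, 4 * lam * (D.M : ℝ) ^ k ≤ (D.M : ℝ) ^ (k + 1) := fun k => by
    rw [pow_succ, mul_comm (4 * lam)]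
    exact mul_le_mul_of_nonneg_left hlamM (hpos k).le
  have hlt : ∀ k, lam * (D.M : ℝ) ^ k < (D.M : ℝ) ^ (k + 1) := fun k => by
    have := step k
    have := mul_pos (by linarith : 0 < lam) (hpos k)
    linarith
  have h0 : (0 : ℝ) ≤ deg L.graph x := by positivity
  have h0' : (0 : ℝ) ≤ deg L.graph r := by positivity
  have lt_of_above : rulerOf (L.lab r) < D.codeOf (L.lab x) →
      lam * deg L.graph r < deg L.graph x := fun h => by
    have h1 := step (2 * rulerOf (L.lab r) + 1)
    have h2 := hpow (show 2 * rulerOf (L.lab r) + 1 + 1 ≤ 2 * D.codeOf (L.lab x) by omega)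
    have h3 := mul_le_mul_of_nonneg_left hB2' (by linarith : 0 ≤ lam)
    have h4 := mul_pos (by linarith : 0 < lam) (hpos (2 * rulerOf (L.lab r) + 1))
    linarith
  have le_of_not_above : ¬ rulerOf (L.lab r) < D.codeOf (L.lab x) →
      lam * deg L.graph x ≤ deg L.graph r := fun h => by
    have h1 := step (2 * D.codeOf (L.lab x))
    have h2 := hpow (show 2 * D.codeOf (L.lab x) + 1 ≤ 2 * rulerOf (L.lab r) + 1 by omega)
    have h3 := mul_le_mul_of_nonneg_left hA2' (by linarith : 0 ≤ lam)
    have h4 := mul_pos (by linarith : 0 < lam) (hpos (2 * D.codeOf (L.lab x)))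
    linarith
  have hAB : (D.M : ℝ) ^ (2 * D.codeOf (L.lab x)) * (D.M : ℝ) ^ (2 * rulerOf (L.lab r) + 1) =
      (D.M : ℝ) ^ (2 * (D.codeOf (L.lab x) + rulerOf (L.lab r)) + 1) := by
    rw [← pow_add]; congr 1; ring
  have prod_gt : 2 * D.s < D.codeOf (L.lab x) + rulerOf (L.lab r) →
      lam * (((D.M ^ (4 * D.s + 2) : ℕ) : ℤ) : ℝ) < deg L.graph x * deg L.graph r := fun h => by
    push_cast
    have h1 := hpow (show 4 * D.s + 2 + 1 ≤
      2 * (D.codeOf (L.lab x) + rulerOf (L.lab r)) + 1 by omega)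
    have h2 := mul_le_mul hA1' hB1' (hpos _).le h0
    have h3 := hlt (4 * D.s + 2)
    linarith
  have prod_le : ¬ 2 * D.s < D.codeOf (L.lab x) + rulerOf (L.lab r) →
      (deg L.graph x * deg L.graph r : ℝ) ≤ (((D.M ^ (4 * D.s + 2) : ℕ) : ℤ) : ℝ) / lam :=
      fun h => by
    rw [le_div_iff₀ (by linarith)]
    push_cast
    have h1 := hpow (show 2 * (D.codeOf (L.lab x) + rulerOf (L.lab r)) + 1 ≤ 4 * D.s + 1 by omega)
    have h2 := mul_le_mul hA2' hB2' h0' (by positivity)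
    have h3 := step (4 * D.s + 1)
    have h4 : (deg L.graph x * deg L.graph r : ℝ) ≤ 4 * (D.M : ℝ) ^ (4 * D.s + 1) := by linarith
    have h5 := mul_le_mul_of_nonneg_right h4 (by linarith : 0 ≤ lam)
    linarith
  cases ρ
  · exact ⟨lt_of_above, le_of_not_above⟩
  · refine ⟨fun h => ?_, fun h => ?_⟩
    · have := lt_of_above h
      have := mul_le_mul_of_nonneg_right hlam h0'
      exact_mod_cast (by linarith : (deg L.graph r : ℝ) < deg L.graph x)
    · have := le_of_not_above h
      have := mul_le_mul_of_nonneg_right hlam h0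
      exact_mod_cast (by linarith : (deg L.graph x : ℝ) ≤ deg L.graph r)
  · exact ⟨prod_gt, prod_le⟩
  · exact ⟨prod_gt, prod_le⟩

omit hD in
theorem isTreeOfDepth [Finite V] (hD : D.Good) : IsTreeOfDepth L.graph 9 := by
  obtain ⟨r, hr⟩ := L.surj (ch 0) (by simp [Valid])
  have h1 : lvl (L.lab r) = 0 := by rw [hr]; rfl
  have h2 : ∀ v, v ≠ r → lvl (L.lab (L.up v)) + 1 = lvl (L.lab v) := fun v hv => by
    rw [L.lab_up]
    exact lvl_par _ fun h => hv (L.inj (h.trans hr.symm))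
  have h3 : L.up r = r := L.inj (by rw [L.lab_up, hr]; rfl)
  refine ⟨parentGraph.isTree (lvl := fun v => lvl (L.lab v)) h1 h2 h3, r, fun v => ?_, ?_⟩
  · rw [graph, parentGraph.dist_eq (lvl := fun v => lvl (L.lab v)) h1 h2 h3]
    have hv := L.valid v
    generalize L.lab v = x at hv ⊢
    rcases x with k | _ | _ | _ | ⟨_ | _ | _⟩ | ⟨_ | _ | _⟩ | ⟨_ | _ | _⟩ | ⟨_ | _ | _⟩ |
      ⟨_ | _ | _⟩ <;> simp only [lvl, hostLvl, Valid] at hv ⊢ <;> omega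
  · obtain ⟨v, hv⟩ := L.surj (l2 (.dst 0) 0 0 0)
      ⟨hD.length_pos, hD.s_pos, hD.s_pos, hD.pow_pos _⟩
    refine ⟨v, ?_⟩
    rw [graph, parentGraph.dist_eq (lvl := fun v => lvl (L.lab v)) h1 h2 h3, hv]
    rfl

end Labelling

open Classical in
/-- The number of a vertex; the vertices are numbered in the order of their creation. -/
noncomputable def place (D : TreeData) (x : Lab) : ℕ := D.labs.idxOf x

/-- The number of the parent of a vertex. -/
noncomputable def up (D : TreeData) (x : Lab) : ℕ := D.place (par x)

theorem place_eq {x : Lab} {pre post : List Lab} (h : D.labs = pre ++ x :: post) :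
    D.place x = pre.length := by
  classical
  have hn := D.nodup_labs
  rw [h, List.nodup_append] at hn
  rw [place, h, List.idxOf_append_of_notMem fun hx => hn.2.2 x hx x (by simp) rfl,
    List.idxOf_cons_self]
  rfl

theorem place_lt {x : Lab} (hx : D.Valid x) : D.place x < D.labs.length := by
  classical
  exact List.idxOf_lt_length_of_mem ((D.mem_labs _).2 hx)

theorem getElem_place {x : Lab} (hx : D.Valid x) : D.labs[D.place x]'(place_lt hx) = x := by
  classical
  exact List.getElem_idxOf _

theorem valid_getElem (v : Fin D.labs.length) : D.Valid D.labs[v] :=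
  (D.mem_labs _).1 (List.getElem_mem _)

/-- The tree on the numbers of its vertices. -/
noncomputable def labelling (D : TreeData) : D.Labelling (Fin D.labs.length) where
  lab v := D.labs[v]
  up v := ⟨D.up D.labs[v], place_lt (D.valid_par (valid_getElem v))⟩
  inj u v h := Fin.ext ((D.nodup_labs.getElem_inj_iff).1 h)
  valid := valid_getElem
  surj x hx := ⟨⟨D.place x, place_lt hx⟩, getElem_place hx⟩
  lab_up v := getElem_place (D.valid_par (valid_getElem v))

theorem length_bitLabs (hD : D.Good) {h : Host} {i j : ℕ} (hi : i < D.s) (hj : j < D.s) :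
    (D.bitLabs h i j).length ≤ 4 * D.M ^ (4 * D.s) := by
  have h1 : D.M ^ (2 * D.code h i j) ≤ D.M ^ (4 * D.s) :=
    Nat.pow_le_pow_right hD.M_pos (by simp only [code]; omega)
  have h2 : D.M ^ (2 * (i + 1)) ≤ D.M ^ (4 * D.s) :=
    Nat.pow_le_pow_right hD.M_pos (by omega)
  have h3 := hD.pow_pos (4 * D.s)
  simp [bitLabs]
  omega

theorem length_flatMap_range_le {α : Type} (n b : ℕ) (f : ℕ → List α)
    (h : ∀ i < n, (f i).length ≤ b) : ((List.range n).flatMap f).length ≤ n * b := by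
  rw [List.length_flatMap]
  refine (List.sum_le_card_nsmul _ b ?_).trans (by simp)
  simpa using h

theorem length_srcLabs (hD : D.Good) (h : Host) :
    (D.srcLabs h).length ≤ D.s * (D.s * (5 * D.M ^ (4 * D.s))) :=
  length_flatMap_range_le _ _ _ fun _ hi => length_flatMap_range_le _ _ _ fun _ hj =>
    (length_bitLabs hD hi hj).trans (by gcongr; omega)

theorem length_dstLabs (hD : D.Good) (h : Host) :
    (D.dstLabs h).length ≤ D.s * (D.s * (5 * D.M ^ (4 * D.s))) :=
  length_flatMap_range_le _ _ _ fun _ hi => length_flatMap_range_le _ _ _ fun _ hj => by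
    have := length_bitLabs hD (h := h) hi hj
    have := hD.pow_pos (4 * D.s)
    rw [List.length_cons]
    omega

/-- The exponent comes from the largest rulers and codes, which have at most `M ^ (4 * s)` leaves;
the numbers of hosts and of digits add a factor of at most `M ^ 2` for every edge. -/
theorem length_labs (hD : D.Good) :
    D.labs.length ≤ 32 * D.edges.length * D.M ^ (4 * D.s + 2) := by
  have hP := hD.pow_pos (4 * D.s)
  have hs := hD.s_pos
  have hsM : D.s * D.s ≤ D.M := (Nat.le_succ _).trans hD.sq_lt_M
  have hR := hD.length_pos
  have h1 : ((List.range (2 * D.s - 1)).flatMap D.rulerLabs).length ≤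
      (2 * D.s - 1) * (7 * (D.s * D.s) * D.M ^ (4 * D.s)) := by
    refine length_flatMap_range_le _ _ _ fun p hp => ?_
    have h2 := length_dstLabs hD (.st p)
    have h3 : D.M ^ (2 * p + 3) ≤ D.M ^ (4 * D.s) := Nat.pow_le_pow_right hD.M_pos (by omega)
    have h4 : D.M ^ (4 * D.s) ≤ D.s * D.s * D.M ^ (4 * D.s) := Nat.le_mul_of_pos_left _ (by positivity)
    simp only [rulerLabs, List.length_cons, List.length_append, List.length_map, List.length_range]
    calc _ ≤ D.s * (D.s * (5 * D.M ^ (4 * D.s))) + 2 * (D.s * D.s * D.M ^ (4 * D.s)) := by omega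
      _ = _ := by ring
  have h2 : ((List.range D.edges.length).flatMap D.recordLabs).length ≤
      D.edges.length * (11 * (D.s * D.s) * D.M ^ (4 * D.s)) := by
    refine length_flatMap_range_le _ _ _ fun e he => ?_
    have h2 := length_srcLabs hD (.src e)
    have h3 := length_dstLabs hD (.dst e)
    have h4 : D.M ^ (4 * D.s) ≤ D.s * D.s * D.M ^ (4 * D.s) := Nat.le_mul_of_pos_left _ (by positivity)
    simp only [recordLabs, List.length_cons, List.length_append]
    calc _ ≤ 2 * (D.s * (D.s * (5 * D.M ^ (4 * D.s)))) + D.s * D.s * D.M ^ (4 * D.s) := by omega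
      _ = _ := by ring
  have h3 : D.labs.length = 4 + (((List.range (2 * D.s - 1)).flatMap D.rulerLabs).length +
      ((List.range D.edges.length).flatMap D.recordLabs).length) := by
    simp only [labs, List.length_append, List.length_cons, List.length_nil]
  have hMM : D.M ≤ D.M * D.M := Nat.le_mul_of_pos_left _ hD.M_pos
  have hs1 : D.s ≤ D.M := (Nat.le_mul_of_pos_left _ hs).trans hsM
  calc D.labs.length ≤ 4 + (2 * D.s * (7 * (D.s * D.s) * D.M ^ (4 * D.s)) +
        D.edges.length * (11 * (D.s * D.s) * D.M ^ (4 * D.s))) := by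
        rw [h3]
        have : (2 * D.s - 1) * (7 * (D.s * D.s) * D.M ^ (4 * D.s)) ≤
            2 * D.s * (7 * (D.s * D.s) * D.M ^ (4 * D.s)) := Nat.mul_le_mul_right _ (by omega)
        omega
    _ ≤ 4 * (D.edges.length * (D.M * D.M) * D.M ^ (4 * D.s)) +
        (2 * D.M * (7 * (D.edges.length * D.M) * D.M ^ (4 * D.s)) +
        D.edges.length * (11 * (D.M * D.M) * D.M ^ (4 * D.s))) := by
        have h4 : 0 < D.edges.length * (D.M * D.M) * D.M ^ (4 * D.s) := by
          have := hD.M_pos; positivity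
        have h5 : D.s * D.s ≤ D.edges.length * D.M := hsM.trans (Nat.le_mul_of_pos_left _ hR)
        have h6 : D.s * D.s ≤ D.M * D.M := hsM.trans hMM
        generalize D.s * D.s = q at *
        gcongr
        omega
    _ ≤ 32 * D.edges.length * (D.M * D.M) * D.M ^ (4 * D.s) := by
        have : 0 < D.edges.length * (D.M * D.M) * D.M ^ (4 * D.s) := by
          have := hD.M_pos; positivity
        nlinarith
    _ = _ := by ring

/-- For a suitable choice of `M`, the tolerance of the stability is small compared to `M`. -/
theorem tolerance_le (hD : D.Good) (hs : 3 ≤ D.s) (hM : D.M = 2 ^ (8 * D.s))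
    (hR : D.edges.length ≤ 2 ^ (2 * D.s * D.s)) :
    1 ≤ (2 : ℝ) ^ Real.sqrt (Real.logb 2 D.labs.length) ∧
      4 * (2 : ℝ) ^ Real.sqrt (Real.logb 2 D.labs.length) ≤ D.M := by
  refine ⟨Real.one_le_rpow (by norm_num) (Real.sqrt_nonneg _), ?_⟩
  have hn : D.labs.length ≤ 2 ^ ((8 * D.s - 3) ^ 2) := by
    refine (length_labs hD).trans ?_
    calc _ ≤ 2 ^ 5 * 2 ^ (2 * D.s * D.s) * (2 ^ (8 * D.s)) ^ (4 * D.s + 2) := by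
          rw [← hM]; gcongr; norm_num
      _ = 2 ^ (5 + 2 * D.s * D.s + 8 * D.s * (4 * D.s + 2)) := by rw [← pow_mul, ← pow_add, ← pow_add]
      _ ≤ _ := by
          apply Nat.pow_le_pow_right (by norm_num)
          obtain ⟨k, hk⟩ := Nat.exists_eq_add_of_le hs
          rw [hk, show 8 * (3 + k) - 3 = 8 * k + 21 by omega]
          nlinarith
  have h0 : 0 < D.labs.length := List.length_pos_of_mem ((D.mem_labs (ch 0)).2 (by simp [Valid]))
  have h1 : Real.logb 2 D.labs.length ≤ ((8 * D.s - 3 : ℕ) : ℝ) ^ 2 := by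
    rw [Real.logb_le_iff_le_rpow (by norm_num) (by exact_mod_cast h0)]
    have : ((D.labs.length : ℕ) : ℝ) ≤ ((2 ^ ((8 * D.s - 3) ^ 2) : ℕ) : ℝ) := by exact_mod_cast hn
    refine this.trans (le_of_eq ?_)
    rw [← Nat.cast_pow, Real.rpow_natCast]
    push_cast
    rfl
  have h2 : Real.sqrt (Real.logb 2 D.labs.length) ≤ ((8 * D.s - 3 : ℕ) : ℝ) :=
    Real.sqrt_le_iff.2 ⟨by positivity, h1⟩
  have h3 : (2 : ℝ) ^ Real.sqrt (Real.logb 2 D.labs.length) ≤ 2 ^ (8 * D.s - 3) := by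
    rw [← Real.rpow_natCast]
    exact Real.rpow_le_rpow_of_exponent_le (by norm_num) h2
  calc _ ≤ 4 * (2 : ℝ) ^ (8 * D.s - 3) := by linarith
    _ ≤ 2 ^ (8 * D.s) := by
      rw [show (4 : ℝ) = 2 ^ 2 by norm_num, ← pow_add]
      exact pow_le_pow_right₀ (by norm_num) (by omega)
    _ = _ := by rw [hM]; push_cast; rfl

end TreeData

/-! ### Alternating quantification over sets as a game -/

namespace ParamComplexity

/-- The owners of the moves in which the value of a formula with `t` levels is determined;
`conj` tells whether the topmost level is a conjunction. -/
def levelOwners : (t : ℕ) → (conj : Bool) → List Bool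
  | 0, _ => []
  | t + 1, conj => (!conj) :: levelOwners t (!conj)

/-- The owners of the moves in which the sets are chosen, element by element; `i` is the index of
the first of the given blocks. -/
def blockOwners : (i : ℕ) → List (ℕ × ℕ) → List Bool
  | _, [] => []
  | i, (_, k) :: bs => List.replicate k (decide (Even i)) ++ blockOwners (i + 1) bs

/-- The layers of positions in which the sets are chosen, given by the number of their positions
and the index of the block. -/
def blockLayers : (i : ℕ) → List (ℕ × ℕ) → List (ℕ × ℕ)
  | _, [] => []
  | i, (m, k) :: bs => List.replicate k (m, i) ++ blockLayers (i + 1) bs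

/-- The immediate subformulas with their places, if the first one stands in place `c`. -/
def childPos (t : ℕ) : ℕ → List (Levels t) → List (ℕ × Levels t)
  | _, [] => []
  | c, H :: F => (c, H) :: childPos t (c + (Levels.words t H).length) F

section Edges

variable (Z : ℕ) (Ly : List (ℕ × ℕ))

/-- The number of positions in a layer. -/
def width (p : ℕ) : ℕ := (Ly.getD p (0, 0)).1

/-- The block to which a layer belongs. -/
def block (p : ℕ) : ℕ := (Ly.getD p (0, 0)).2

/-- The edges between the layers, and from the last layer to the formula in place `root`.  The
position `v` of the layer number `p` is the vertex `(p + 1) * Z + v`.  Within a block, the elements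
of a set have to be chosen in increasing order. -/
def layerEdges (root : ℕ) : List (ℕ × ℕ) :=
  ((List.range (Ly.length - 1)).flatMap fun p => (List.range (width Ly p)).flatMap fun v =>
    (List.range (width Ly (p + 1))).flatMap fun v' =>
      if block Ly p = block Ly (p + 1) ∧ v' ≤ v then []
        else [((p + 1) * Z + v, (p + 2) * Z + v')]) ++
    (List.range (width Ly (Ly.length - 1))).map fun v => ((Ly.length - 1 + 1) * Z + v, root)

/-- The edges that start in a literal at the place `c`: they lead to all vertices that make the
variable of the literal true, and to `c` itself if the literal is negative. -/
def literalEdges (c i j : ℕ) (b : Bool) : List (ℕ × ℕ) :=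
  ((List.range Ly.length).flatMap fun p =>
    if block Ly p = i then [(c, (p + 1) * Z + j)] else []) ++ if b then [] else [(c, c)]

/-- The edges that start in a formula at the place `c` and its subformulas. -/
def formEdges : (t : ℕ) → ℕ → Levels t → List (ℕ × ℕ)
  | 0, c, (((i, j), b) : BVar × Bool) => literalEdges Z Ly c i j b
  | t + 1, c, (F : List (Levels t)) =>
      (childPos t (c + 1) F).flatMap fun x => (c, x.1) :: formEdges t x.1 x.2

end Edges

theorem length_words_pos : ∀ (t : ℕ) (F : Levels t), 0 < (Levels.words t F).length
  | 0, ((_, _), _) => by simp [Levels.words]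
  | t + 1, F => by simp [Levels.words]

section ChildPos

variable {t : ℕ}

theorem childPos_bounds {F : List (Levels t)} {c : ℕ} {x : ℕ × Levels t}
    (hx : x ∈ childPos t c F) : x.2 ∈ F ∧ c ≤ x.1 ∧
      x.1 + (Levels.words t x.2).length ≤ c + (F.flatMap (Levels.words t)).length := by
  induction F generalizing c with
  | nil => simp [childPos] at hx
  | cons H F ih =>
    simp only [childPos, List.mem_cons] at hx
    simp only [List.flatMap_cons, List.length_append]
    rcases hx with rfl | hx
    · simp
    · obtain ⟨h1, h2, h3⟩ := ih hx
      exact ⟨List.mem_cons_of_mem _ h1, by omega, by omega⟩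

theorem exists_childPos {F : List (Levels t)} {H : Levels t} (hH : H ∈ F) (c : ℕ) :
    ∃ d, (d, H) ∈ childPos t c F := by
  induction F generalizing c with
  | nil => simp at hH
  | cons G F ih =>
    rcases List.mem_cons.1 hH with rfl | hH
    · exact ⟨c, by simp [childPos]⟩
    · obtain ⟨d, hd⟩ := ih hH (c + (Levels.words t G).length)
      exact ⟨d, by simp [childPos, hd]⟩

/-- Different subformulas occupy disjoint places. -/
theorem childPos_disjoint {F : List (Levels t)} {c u : ℕ} {x y : ℕ × Levels t}
    (hx : x ∈ childPos t c F) (hy : y ∈ childPos t c F)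
    (hux : x.1 ≤ u ∧ u < x.1 + (Levels.words t x.2).length)
    (huy : y.1 ≤ u ∧ u < y.1 + (Levels.words t y.2).length) : x = y := by
  induction F generalizing c with
  | nil => simp [childPos] at hx
  | cons H F ih =>
    simp only [childPos, List.mem_cons] at hx hy
    rcases hx with rfl | hx <;> rcases hy with rfl | hy
    · rfl
    · have := (childPos_bounds hy).2.1
      simp only at *
      omega
    · have := (childPos_bounds hx).2.1
      simp only at *
      omega
    · exact ih hx hy

end ChildPos

variable {Z : ℕ} {Ly : List (ℕ × ℕ)}

theorem formEdges_source : ∀ {t : ℕ} {c : ℕ} {F : Levels t} {u x : ℕ},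
    (u, x) ∈ formEdges Z Ly t c F → c ≤ u ∧ u < c + (Levels.words t F).length
  | 0, c, ((i, j), b), u, x, h => by
    have : u = c := by
      simp only [formEdges, literalEdges, List.mem_append, List.mem_flatMap] at h
      rcases h with ⟨p, -, h⟩ | h <;> split_ifs at h <;> simp at h <;> exact h.1
    simp [Levels.words, this]
  | t + 1, c, F, u, x, h => by
    simp only [formEdges, List.mem_flatMap, List.mem_cons, Prod.mk.injEq] at h
    simp only [Levels.words, List.length_cons]
    obtain ⟨y, hy, ⟨rfl, -⟩ | h⟩ := h
    · omega
    · have h1 := formEdges_source h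
      have h2 := childPos_bounds hy
      omega

section Levels

variable {E : ℕ → ℕ → Prop} {S : Set BVar}

/-- The game in a formula.  The vertices from `c` on that belong to the formula are still unvisited,
and the visited vertices of the layers tell which variables are true. -/
theorem play_levels : ∀ (t : ℕ) (conj : Bool) (F : Levels t) (c : ℕ) (h : List ℕ),
    c + (Levels.words t F).length ≤ Z →
    (∀ u x, c ≤ u → u < c + (Levels.words t F).length →
      (E u x ↔ (u, x) ∈ formEdges Z Ly t c F)) →
    (∀ u ∈ h, u < c ∨ c + (Levels.words t F).length ≤ u) →
    (∀ x ∈ Levels.vars t F, x ∈ S ↔ ∃ p < Ly.length, block Ly p = x.1 ∧ (p + 1) * Z + x.2 ∈ h) →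
    (Play E (levelOwners t conj) h c ↔ Levels.Holds S t conj F)
  | 0, conj, ((i, j), b), c, h, hZ, hE, hh, hS => by
    simp only [Levels.words, List.length_cons, List.length_nil] at hZ hE hh
    have hS := hS (i, j) (by simp [Levels.vars])
    simp only at hS
    have hc : c ∉ h := fun hc => by have := hh c hc; omega
    have hne : ∀ p j, c ≠ (p + 1) * Z + j := fun p j => by rw [Nat.succ_mul]; omega
    have e1 : (∃ w, E c w ∧ w ∈ h) ↔ (i, j) ∈ S := by
      rw [hS]
      constructor
      · rintro ⟨w, hw, hwh⟩
        rw [hE c w le_rfl (by omega)] at hw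
        simp only [formEdges, literalEdges, List.mem_append, List.mem_flatMap, List.mem_range] at hw
        rcases hw with ⟨p, hp, hw⟩ | hw
        · split_ifs at hw with hi
          · simp only [List.mem_singleton, Prod.mk.injEq, true_and] at hw
            exact ⟨p, hp, hi, hw ▸ hwh⟩
          · simp at hw
        · split_ifs at hw
          · simp at hw
          · simp only [List.mem_singleton, Prod.mk.injEq, true_and] at hw
            exact absurd (hw ▸ hwh) hc
      · rintro ⟨p, hp, hi, hm⟩
        refine ⟨_, (hE c _ le_rfl (by omega)).2 ?_, hm⟩
        simp only [formEdges, literalEdges, List.mem_append, List.mem_flatMap, List.mem_range]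
        exact .inl ⟨p, hp, by simp [hi]⟩
    have e2 : E c c ↔ b = false := by
      rw [hE c c le_rfl (by omega)]
      simp only [formEdges, literalEdges, List.mem_append, List.mem_flatMap, List.mem_range]
      constructor
      · rintro (⟨p, -, hw⟩ | hw)
        · split_ifs at hw
          · simp only [List.mem_singleton, Prod.mk.injEq, true_and] at hw
            exact absurd hw (hne _ _)
          · simp at hw
        · split_ifs at hw with hb
          · simp at hw
          · simpa using hb
      · rintro rfl
        simp
    simp only [levelOwners, Play, Levels.Holds]
    rw [e1, e2]
    cases b <;> simp [Xor]
  | t + 1, conj, F, c, h, hZ, hE, hh, hS => by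
    have hlen : (Levels.words (t + 1) F).length =
        (List.flatMap (Levels.words t) F).length + 1 := by simp [Levels.words]
    rw [hlen] at hZ hE hh
    have e1 : ∀ x, E c x ↔ ∃ H, (x, H) ∈ childPos t (c + 1) F := by
      intro x
      rw [hE c x le_rfl (by omega)]
      simp only [formEdges, List.mem_flatMap, List.mem_cons, Prod.mk.injEq, true_and]
      constructor
      · rintro ⟨y, hy, rfl | h'⟩
        · exact ⟨y.2, hy⟩
        · have h1 := formEdges_source h'
          have h2 := childPos_bounds hy
          omega
      · rintro ⟨H, hH⟩
        exact ⟨_, hH, .inl rfl⟩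
    have e2 : ∀ x H, (x, H) ∈ childPos t (c + 1) F →
        (Play E (levelOwners t (!conj)) (c :: h) x ↔ Levels.Holds S t (!conj) H) := by
      intro x H hx
      obtain ⟨hb1, hb2, hb3⟩ := childPos_bounds hx
      simp only at hb1 hb2 hb3
      refine play_levels t _ H x (c :: h) (by omega) (fun u y hu1 hu2 => ?_) (fun u hu => ?_)
        (fun y hy => ?_)
      · rw [hE u y (by omega) (by omega)]
        simp only [formEdges, List.mem_flatMap, List.mem_cons, Prod.mk.injEq]
        constructor
        · rintro ⟨z, hz, ⟨rfl, -⟩ | h'⟩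
          · omega
          · have := childPos_disjoint hx hz ⟨hu1, hu2⟩ (formEdges_source h')
            rw [← this] at h'
            exact h'
        · intro h'
          exact ⟨_, hx, .inr h'⟩
      · rcases List.mem_cons.1 hu with rfl | hu
        · omega
        · have := hh u hu; omega
      · rw [hS y ⟨H, hb1, hy⟩]
        simp only [List.mem_cons]
        refine exists_congr fun p => and_congr_right fun _ => and_congr_right fun _ => ?_
        refine ⟨.inr, fun h' => h'.resolve_left fun h'' => ?_⟩
        have := length_words_pos t H
        rw [Nat.succ_mul] at h''
        omega
    cases conj
    · simp only [levelOwners, Bool.not_false, Play, Levels.Holds] at e2 ⊢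
      constructor
      · rintro ⟨x, hx, hp⟩
        obtain ⟨H, hH⟩ := (e1 x).1 hx
        exact ⟨H, (childPos_bounds hH).1, (e2 x H hH).1 hp⟩
      · rintro ⟨H, hH, hp⟩
        obtain ⟨x, hx⟩ := exists_childPos hH (c + 1)
        exact ⟨x, (e1 x).2 ⟨H, hx⟩, (e2 x H hx).2 hp⟩
    · simp only [levelOwners, Bool.not_true, Play, Levels.Holds] at e2 ⊢
      constructor
      · intro hp H hH
        obtain ⟨x, hx⟩ := exists_childPos hH (c + 1)
        exact (e2 x H hx).1 (hp x ((e1 x).2 ⟨H, hx⟩))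
      · intro hp x hx
        obtain ⟨H, hH⟩ := (e1 x).1 hx
        exact (e2 x H hH).2 (hp H (childPos_bounds hH).1)

end Levels

/-! ### Sets as increasing sequences -/

/-- The list is strictly increasing and consists of numbers in the interval `[lo, m)`. -/
def Incr (lo m : ℕ) (l : List ℕ) : Prop := l.Pairwise (· < ·) ∧ ∀ v ∈ l, lo ≤ v ∧ v < m

theorem incr_cons {lo m v : ℕ} {l : List ℕ} :
    Incr lo m (v :: l) ↔ (lo ≤ v ∧ v < m) ∧ Incr (v + 1) m l := by
  simp only [Incr, List.pairwise_cons, List.mem_cons, forall_eq_or_imp]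
  constructor
  · rintro ⟨⟨h1, h2⟩, h3, h4⟩
    exact ⟨h3, h2, fun w hw => ⟨h1 w hw, (h4 w hw).2⟩⟩
  · rintro ⟨h1, h2, h3⟩
    exact ⟨⟨fun w hw => (h3 w hw).1, h2⟩, h1, fun w hw => ⟨by have := h3 w hw; omega, (h3 w hw).2⟩⟩

/-- The quantifier of a player over the increasing sequences of length `k`. -/
def Pick (own : Bool) (lo m k : ℕ) (Q : List ℕ → Prop) : Prop :=
  if own then ∃ l, Incr lo m l ∧ l.length = k ∧ Q l else ∀ l, Incr lo m l → l.length = k → Q l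

theorem pick_zero {own : Bool} {lo m : ℕ} {Q : List ℕ → Prop} : Pick own lo m 0 Q ↔ Q [] := by
  have h0 : Incr lo m [] := by simp [Incr]
  cases own <;> simp only [Pick, Bool.false_eq_true, if_false, if_true, List.length_eq_zero_iff]
  · exact ⟨fun h => h [] h0 rfl, fun h l _ hl => hl ▸ h⟩
  · exact ⟨fun ⟨l, _, hl, h⟩ => hl ▸ h, fun h => ⟨[], h0, rfl, h⟩⟩

theorem pick_iff_finset {own : Bool} {m k : ℕ} {Q : Finset ℕ → Prop} :
    Pick own 0 m k (fun l => Q l.toFinset) ↔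
      if own then ∃ u ⊆ Finset.range m, u.card = k ∧ Q u
        else ∀ u ⊆ Finset.range m, u.card = k → Q u := by
  have hto : ∀ l : List ℕ, Incr 0 m l → l.toFinset ⊆ Finset.range m ∧ l.toFinset.card = l.length := by
    intro l hl
    refine ⟨fun v hv => Finset.mem_range.2 (hl.2 v (List.mem_toFinset.1 hv)).2, ?_⟩
    exact List.toFinset_card_of_nodup (hl.1.imp fun h => ne_of_lt h)
  have hfro : ∀ u ⊆ Finset.range m, ∃ l, Incr 0 m l ∧ l.length = u.card ∧ l.toFinset = u := by
    intro u hu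
    refine ⟨u.sort, ⟨(u.sortedLT_sort).pairwise, fun v hv => ⟨v.zero_le, ?_⟩⟩, by simp, by simp⟩
    exact Finset.mem_range.1 (hu ((Finset.mem_sort _).1 hv))
  cases own <;> simp only [Pick, Bool.false_eq_true, if_false, if_true]
  · constructor
    · intro h u hu hk
      obtain ⟨l, h1, h2, rfl⟩ := hfro u hu
      exact h l h1 (h2.trans hk)
    · intro h l hl hk
      exact h _ (hto l hl).1 ((hto l hl).2.trans hk)
  · constructor
    · rintro ⟨l, hl, hk, h⟩
      exact ⟨_, (hto l hl).1, (hto l hl).2.trans hk, h⟩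
    · rintro ⟨u, hu, hk, h⟩
      obtain ⟨l, h1, h2, rfl⟩ := hfro u hu
      exact ⟨l, h1, h2.trans hk, h⟩

/-- The vertices visited when the elements of the list `l` are chosen in the layers from number
`q` on, on top of the stack `h`. -/
def visit (Z : ℕ) : ℕ → List ℕ → List ℕ → List ℕ
  | _, [], h => h
  | q, v :: l, h => visit Z (q + 1) l (((q + 1) * Z + v) :: h)

theorem mem_visit {q n : ℕ} {l h : List ℕ} :
    n ∈ visit Z q l h ↔ n ∈ h ∨ ∃ y, ∃ hy : y < l.length, n = (q + y + 1) * Z + l[y] := by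
  induction l generalizing q h with
  | nil => simp [visit]
  | cons v l ih =>
    rw [visit, ih, List.mem_cons]
    constructor
    · rintro ((rfl | h) | ⟨y, hy, rfl⟩)
      · exact .inr ⟨0, by simp, by simp⟩
      · exact .inl h
      · exact .inr ⟨y + 1, by simpa using hy, by simp [show q + 1 + y = q + (y + 1) by ring]⟩
    · rintro (h | ⟨_ | y, hy, rfl⟩)
      · exact .inl (.inr h)
      · exact .inl (.inl (by simp))
      · exact .inr ⟨y, by simpa using hy, by simp [show q + 1 + y = q + (y + 1) by ring]⟩

/-- The game from a nonempty stack of visited vertices. -/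
def PlayFrom (E : ℕ → ℕ → Prop) (os : List Bool) : List ℕ → Prop
  | [] => False
  | u :: h => Play E os h u


section Game

variable (Z Ly)

/-- The edges of the digraph on which the game is played.  The loop at the vertex `0`, which is
never reached, makes sure that there are edges. -/
def gameEdges (root : ℕ) {t : ℕ} (F : Levels t) : List (ℕ × ℕ) :=
  (0, 0) :: (layerEdges Z Ly root ++ formEdges Z Ly t root F)

variable {Z Ly} {root t : ℕ} {F : Levels t} (hroot : 0 < root)
  (hF : root + (Levels.words t F).length ≤ Z) (hw : ∀ p, width Ly p < Z)

theorem node_inj {p q v v' : ℕ} (hv : v < Z) (hv' : v' < Z) (h : p * Z + v = q * Z + v') :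
    p = q ∧ v = v' := by
  have hZ : 0 < Z := by omega
  have h1 := congrArg (· / Z) h
  have h2 := congrArg (· % Z) h
  simp only [mul_comm _ Z, Nat.mul_add_div hZ, Nat.div_eq_of_lt hv,
    Nat.div_eq_of_lt hv', Nat.mul_add_mod, Nat.mod_eq_of_lt hv, Nat.mod_eq_of_lt hv'] at h1 h2
  omega

include hF hw in
theorem mem_gameEdges_layer {p v x : ℕ} (hp : p < Ly.length) (hv : v < width Ly p) :
    ((p + 1) * Z + v, x) ∈ gameEdges Z Ly root F ↔
      if p + 1 < Ly.length then ∃ v' < width Ly (p + 1),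
        ¬ (block Ly p = block Ly (p + 1) ∧ v' ≤ v) ∧ x = (p + 1 + 1) * Z + v'
      else x = root := by
  have hvZ : v < Z := hv.trans (hw p)
  have h0 : (p + 1) * Z + v ≠ 0 := by rw [Nat.succ_mul]; omega
  have hform : ((p + 1) * Z + v, x) ∉ formEdges Z Ly t root F := fun h => by
    have := formEdges_source h
    rw [Nat.succ_mul] at this
    omega
  simp only [gameEdges, layerEdges, List.mem_cons, List.mem_append, List.mem_flatMap, List.mem_map,
    List.mem_range, Prod.mk.injEq, h0, hform, false_and, false_or, or_false]
  constructor
  · rintro (⟨q, hq, w, hw1, w', hw2, h⟩ | ⟨w, hw1, h, rfl⟩)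
    · split_ifs at h with hb
      · simp at h
      · simp only [List.mem_singleton, Prod.mk.injEq] at h
        obtain ⟨h1, h2⟩ := node_inj hvZ (hw1.trans (hw q)) h.1
        obtain rfl : p = q := by omega
        subst h2
        rw [if_pos (by omega)]
        exact ⟨w', hw2, hb, h.2⟩
    · obtain ⟨h1, h2⟩ := node_inj (hw1.trans (hw _)) hvZ h
      rw [if_neg (by omega)]
  · intro h
    split_ifs at h with hp1
    · obtain ⟨v', hv', hb, rfl⟩ := h
      exact .inl ⟨p, by omega, v, hv, v', hv', by rw [if_neg hb]; simp⟩
    · subst h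
      obtain rfl : p = Ly.length - 1 := by omega
      exact .inr ⟨v, hv, rfl, rfl⟩

include hroot hF in
theorem mem_gameEdges_form {u x : ℕ} (hu : root ≤ u) (huF : u < root + (Levels.words t F).length) :
    (u, x) ∈ gameEdges Z Ly root F ↔ (u, x) ∈ formEdges Z Ly t root F := by
  have h1 : ∀ p v, (p + 1) * Z + v ≠ u := fun p v => by rw [Nat.succ_mul]; omega
  simp only [gameEdges, layerEdges, List.mem_cons, List.mem_append, List.mem_flatMap, List.mem_map,
    List.mem_range, Prod.mk.injEq, h1, false_and, and_false, exists_false, or_false]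
  constructor
  · rintro (h | ⟨q, hq, w, hw1, w', hw2, h⟩ | h)
    · omega
    · split_ifs at h
      · simp at h
      · simp only [List.mem_singleton, Prod.mk.injEq] at h
        exact absurd h.1.symm (h1 _ _)
    · exact h
  · exact fun h => .inr (.inr h)

theorem width_append {pre post : List (ℕ × ℕ)} {m i : ℕ} :
    width (pre ++ (m, i) :: post) pre.length = m := by simp [width, List.getD]

theorem block_append {pre post : List (ℕ × ℕ)} {m i : ℕ} :
    block (pre ++ (m, i) :: post) pre.length = i := by simp [block, List.getD]

include hF hw in
/-- In the layers of a block, the owner of the block chooses an increasing sequence. -/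
theorem play_block {own : Bool} {os : List Bool} {m i : ℕ} (k : ℕ) :
    ∀ {pre post : List (ℕ × ℕ)} {p v lo : ℕ} {h : List ℕ},
    Ly = pre ++ List.replicate k (m, i) ++ post → pre.length = p + 1 → v < width Ly p →
    (∀ v', ¬ (block Ly p = i ∧ v' ≤ v) ↔ lo ≤ v') →
    (Play (fun u x => (u, x) ∈ gameEdges Z Ly root F) (List.replicate k own ++ os) h
      ((p + 1) * Z + v) ↔
      Pick own lo m k fun l => PlayFrom (fun u x => (u, x) ∈ gameEdges Z Ly root F) os
        (visit Z (p + 1) l (((p + 1) * Z + v) :: h))) := by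
  induction k with
  | zero =>
    intro pre post p v lo h _ _ _ _
    rw [pick_zero]
    rfl
  | succ k ih =>
    intro pre post p v lo h hLy hpre hv hlo
    have hLy' : Ly = pre ++ (m, i) :: (List.replicate k (m, i) ++ post) := by
      rw [hLy, List.replicate_succ]; simp
    have hwp : width Ly (p + 1) = m := by rw [hLy', ← hpre, width_append]
    have hbp : block Ly (p + 1) = i := by rw [hLy', ← hpre, block_append]
    have hlt : p + 1 < Ly.length := by rw [hLy', ← hpre]; simp
    have hE : ∀ x, ((p + 1) * Z + v, x) ∈ gameEdges Z Ly root F ↔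
        ∃ v', (lo ≤ v' ∧ v' < m) ∧ x = (p + 1 + 1) * Z + v' := by
      intro x
      rw [mem_gameEdges_layer hF hw (by omega) hv, if_pos hlt, hwp, hbp]
      exact exists_congr fun v' => by rw [hlo]; tauto
    have hnext := fun (v' : ℕ) (hv' : v' < m) => ih (pre := pre ++ [(m, i)]) (post := post)
      (p := p + 1) (v := v') (lo := v' + 1) (h := ((p + 1) * Z + v) :: h)
      (by rw [hLy']; simp) (by simp [hpre]) (by rw [hwp]; exact hv')
      (fun w => by rw [hbp]; omega)
    cases own
    · simp only [List.replicate_succ, List.cons_append, Play, hE]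
      simp only [Pick, Bool.false_eq_true, if_false] at hnext ⊢
      constructor
      · intro H l hl hk
        rcases l with _ | ⟨v', l⟩
        · simp at hk
        · rw [incr_cons] at hl
          exact (hnext v' hl.1.2).1 (H _ ⟨v', hl.1, rfl⟩) l hl.2 (by simpa using hk)
      · rintro H x ⟨v', hv', rfl⟩
        exact (hnext v' hv'.2).2 fun l hl hk => H (v' :: l) (incr_cons.2 ⟨hv', hl⟩) (by simp [hk])
    · simp only [List.replicate_succ, List.cons_append, Play, hE]
      simp only [Pick, if_true] at hnext ⊢
      constructor
      · rintro ⟨x, ⟨v', hv', rfl⟩, H⟩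
        obtain ⟨l, hl, hk, H⟩ := (hnext v' hv'.2).1 H
        exact ⟨v' :: l, incr_cons.2 ⟨hv', hl⟩, by simp [hk], H⟩
      · rintro ⟨l, hl, hk, H⟩
        rcases l with _ | ⟨v', l⟩
        · simp at hk
        · rw [incr_cons] at hl
          exact ⟨_, ⟨v', hl.1, rfl⟩, (hnext v' hl.1.2).2 ⟨l, hl.2, by simpa using hk, H⟩⟩

/-- The last visited vertex lies in the layer where the last element was chosen. -/
theorem visit_eq_cons {q v : ℕ} {l h : List ℕ} (hv : v < width Ly (q - 1)) (hq : 0 < q)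
    (hl : ∀ y, ∀ hy : y < l.length, l[y] < width Ly (q + y)) :
    ∃ v' h', visit Z q l ((q * Z + v) :: h) = ((q + l.length) * Z + v') :: h' ∧
      v' < width Ly (q + l.length - 1) := by
  induction l generalizing q v h with
  | nil => exact ⟨v, h, rfl, hv⟩
  | cons w l ih =>
    obtain ⟨v', h', h1, h2⟩ := ih (q := q + 1) (v := w) (h := (q * Z + v) :: h)
      (hl 0 (by simp)) (by omega)
      (fun y hy => by
        have := hl (y + 1) (by simpa using hy)
        simpa [show q + 1 + y = q + (y + 1) by ring] using this)
    refine ⟨v', h', ?_, ?_⟩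
    · rw [visit, h1, List.length_cons, show q + 1 + l.length = q + (l.length + 1) by ring]
    · rwa [List.length_cons, show q + (l.length + 1) = q + 1 + l.length by ring]

theorem getD_middle {α : Type} {pre post : List α} {k : ℕ} {a d : α} {y : ℕ} (hy : y < k) :
    (pre ++ List.replicate k a ++ post).getD (pre.length + y) d = a := by
  rw [List.append_assoc, List.getD_append_right _ _ _ _ (by omega), Nat.add_sub_cancel_left,
    List.getD_append _ _ _ _ (by simpa using hy), List.getD_eq_getElem _ _ (by simpa using hy)]
  simp

include hroot hF hw in
/-- The game from the vertex `v` of the layer `p`, the last layer before the given blocks.  The set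
`S` is read off from the visited vertices.  The first layer is assigned to the block number `r`,
which does not exist, so that its vertex stands for no variable. -/
theorem play_blocks {r : ℕ} (hvars : ∀ x ∈ Levels.vars t F, x.1 < r ∧ x.2 < Z) :
    ∀ (bs : List (ℕ × ℕ)) (i : ℕ) (S : Set BVar) (pre : List (ℕ × ℕ)) (p v : ℕ) (h : List ℕ),
    i + bs.length = r → Ly = pre ++ blockLayers i bs → pre.length = p + 1 → v < width Ly p →
    (∀ q < pre.length, block Ly q < i ∨ block Ly q = r) →
    (∀ n ∈ ((p + 1) * Z + v) :: h, Z ≤ n ∧ n < (p + 2) * Z) →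
    (∀ x : BVar, x.1 < r → x.2 < Z → (x ∈ S ↔ ∃ q < Ly.length, block Ly q = x.1 ∧
      (q + 1) * Z + x.2 ∈ ((p + 1) * Z + v) :: h)) →
    (Play (fun u x => (u, x) ∈ gameEdges Z Ly root F)
      (blockOwners i bs ++ true :: levelOwners t true) h ((p + 1) * Z + v) ↔
      Alternate (fun S => Levels.Holds S t true F) i bs S)
  | [], i, S, pre, p, v, h, hr, hLy, hpre, hv, hb, hh, hS => by
    have hlen : Ly.length = p + 1 := by rw [hLy]; simp [blockLayers, hpre]
    simp only [blockOwners, List.nil_append, Play, Alternate]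
    have hE : ∀ x, ((p + 1) * Z + v, x) ∈ gameEdges Z Ly root F ↔ x = root := fun x => by
      rw [mem_gameEdges_layer hF hw (by omega) hv, if_neg (by omega)]
    simp only [hE, exists_eq_left]
    refine play_levels (Z := Z) (Ly := Ly) t true F root _ hF
      (fun u x h1 h2 => mem_gameEdges_form hroot hF h1 h2)
      (fun u hu => .inr (by have := hh u hu; omega)) fun x hx => hS x (hvars x hx).1 (hvars x hx).2
  | (m, k) :: bs, i, S, pre, p, v, h, hr, hLy, hpre, hv, hb, hh, hS => by
    have hLy' : Ly = pre ++ List.replicate k (m, i) ++ blockLayers (i + 1) bs := by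
      rw [hLy, blockLayers, List.append_assoc]
    simp only [List.length_cons] at hr
    have hbp : block Ly p ≠ i := by have := hb p (by omega); omega
    have hmid : ∀ y < k, Ly.getD (p + 1 + y) (0, 0) = (m, i) := fun y hy => by
      rw [hLy', ← hpre]; exact getD_middle hy
    rw [blockOwners, List.append_assoc, play_block hF hw k hLy' hpre hv (lo := 0)
      (fun v' => by simp [hbp])]
    -- The rest of the game depends only on the set of the chosen elements.
    have rest : ∀ l, Incr 0 m l → l.length = k →
        (PlayFrom (fun u x => (u, x) ∈ gameEdges Z Ly root F)
          (blockOwners (i + 1) bs ++ true :: levelOwners t true)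
          (visit Z (p + 1) l (((p + 1) * Z + v) :: h)) ↔
        Alternate (fun S => Levels.Holds S t true F) (i + 1) bs
          (S ∪ {x | x.1 = i ∧ x.2 ∈ l.toFinset})) := by
      intro l hl hk
      have hlw : ∀ y, ∀ hy : y < l.length, l[y] < width Ly (p + 1 + y) := fun y hy => by
        rw [width, hmid y (by omega)]; exact (hl.2 _ (List.getElem_mem _)).2
      obtain ⟨v', h', e1, e2⟩ := visit_eq_cons (Z := Z) (q := p + 1) (h := h) (by simpa using hv)
        (by omega) hlw
      have hmem : ∀ n, n ∈ ((p + k + 1) * Z + v') :: h' ↔ n ∈ ((p + 1) * Z + v) :: h ∨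
          ∃ y, ∃ hy : y < l.length, n = (p + 1 + y + 1) * Z + l[y] := fun n => by
        rw [← mem_visit, e1, hk, show p + 1 + k = p + k + 1 by ring]
      rw [e1, hk, show p + 1 + k = p + k + 1 by ring]
      rw [hk, show p + 1 + k - 1 = p + k by omega] at e2
      refine play_blocks hvars bs (i + 1) _ (pre ++ List.replicate k (m, i)) (p + k) v' h'
        (by omega) hLy' (by simp [hpre]; omega) e2 ?_ ?_ ?_
      · intro q hq
        simp only [List.length_append, List.length_replicate] at hq
        by_cases hq' : q < pre.length
        · have := hb q hq'; omega
        · left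
          have := hmid (q - (p + 1)) (by omega)
          rw [show p + 1 + (q - (p + 1)) = q by omega] at this
          rw [block, this]
          exact Nat.lt_succ_self i
      · intro n hn
        rcases (hmem n).1 hn with hn | ⟨y, hy, rfl⟩
        · have := hh n hn
          refine ⟨this.1, this.2.trans_le (Nat.mul_le_mul_right _ (by omega))⟩
        · have h1 := hlw y hy
          have h2 := hw (p + 1 + y)
          have h3 : (p + 1 + y + 1 + 1) * Z ≤ (p + k + 2) * Z := Nat.mul_le_mul_right _ (by omega)
          rw [Nat.succ_mul] at h3
          refine ⟨?_, by omega⟩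
          rw [Nat.succ_mul]; omega
      · intro x hx1 hx2
        rw [Set.mem_union, hS x hx1 hx2]
        simp only [hmem, Set.mem_ofPred_eq, List.mem_toFinset]
        constructor
        · rintro (⟨q, hq, h1, h2⟩ | ⟨h1, h2⟩)
          · exact ⟨q, hq, h1, .inl h2⟩
          · obtain ⟨y, hy, h3⟩ := List.mem_iff_getElem.1 h2
            have h4 := hmid y (by omega)
            refine ⟨p + 1 + y, ?_, by rw [block, h4, h1], .inr ⟨y, hy, by rw [h3]⟩⟩
            rw [hLy']; simp [hpre]; omega
        · rintro ⟨q, hq, h1, h2 | ⟨y, hy, h2⟩⟩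
          · exact .inl ⟨q, hq, h1, h2⟩
          · obtain ⟨h3, h4⟩ := node_inj hx2 ((hlw y hy).trans (hw _)) h2
            obtain rfl : q = p + 1 + y := by omega
            rw [block, hmid y (by omega)] at h1
            exact .inr ⟨h1.symm, h4 ▸ List.getElem_mem _⟩
    have := pick_iff_finset (own := decide (Even i)) (m := m) (k := k) (Q := fun u =>
      Alternate (fun S => Levels.Holds S t true F) (i + 1) bs (S ∪ {x | x.1 = i ∧ x.2 ∈ u}))
    rw [Alternate]
    by_cases hi : Even i
    · simp only [hi, decide_true, if_true, Pick] at this ⊢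
      rw [← this]
      exact exists_congr fun l => and_congr_right fun hl => and_congr_right fun hk => rest l hl hk
    · simp only [hi, decide_false, if_false, Pick, Bool.false_eq_true] at this ⊢
      rw [← this]
      exact forall_congr' fun l => imp_congr_right fun hl => imp_congr_right fun hk => rest l hl hk

end Game

end ParamComplexity

/-! ### The tree of an instance of `QBFSAT` -/

namespace ParamComplexity

theorem length_unary (w : List ℕ) : (unary w).length = w.sum + w.length := by
  induction w with
  | nil => rfl
  | cons n w ih =>
    rw [unary, List.flatMap_cons, ← unary, List.length_append, ih]
    simp; omega

theorem length_blockLayers (bs : List (ℕ × ℕ)) (i : ℕ) :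
    (blockLayers i bs).length = (bs.map Prod.snd).sum := by
  induction bs generalizing i with
  | nil => rfl
  | cons b bs ih => obtain ⟨m, k⟩ := b; simp [blockLayers, ih]

theorem length_blockOwners (bs : List (ℕ × ℕ)) (i : ℕ) :
    (blockOwners i bs).length = (bs.map Prod.snd).sum := by
  induction bs generalizing i with
  | nil => rfl
  | cons b bs ih => obtain ⟨m, k⟩ := b; simp [blockOwners, ih]

theorem length_levelOwners (t : ℕ) (conj : Bool) : (levelOwners t conj).length = t := by
  induction t generalizing conj with
  | zero => rfl
  | succ t ih => simp [levelOwners, ih]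

theorem mem_blockLayers {bs : List (ℕ × ℕ)} {i : ℕ} {x : ℕ × ℕ} (hx : x ∈ blockLayers i bs) :
    x.1 ∈ bs.map Prod.fst ∧ i ≤ x.2 ∧ x.2 < i + bs.length := by
  induction bs generalizing i with
  | nil => simp [blockLayers] at hx
  | cons b bs ih =>
    obtain ⟨m, k⟩ := b
    simp only [blockLayers, List.mem_append, List.mem_replicate] at hx
    simp only [List.map_cons, List.mem_cons, List.length_cons]
    rcases hx with ⟨-, rfl⟩ | hx
    · simp
    · obtain ⟨h1, h2, h3⟩ := ih hx
      exact ⟨.inr h1, by omega, by omega⟩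

theorem flatMap_prod_sum (bs : List (ℕ × ℕ)) :
    (bs.flatMap fun b => [b.1, b.2]).sum = (bs.map Prod.fst).sum + (bs.map Prod.snd).sum := by
  induction bs with
  | nil => rfl
  | cons b bs ih => simp [ih]; omega

theorem flatMap_prod_length (bs : List (ℕ × ℕ)) :
    (bs.flatMap fun b => [b.1, b.2]).length = 2 * bs.length := by
  induction bs with
  | nil => rfl
  | cons b bs ih => simp [ih]; omega

theorem formEdges_target {Z : ℕ} {Ly : List (ℕ × ℕ)} :
    ∀ {t : ℕ} {c : ℕ} {F : Levels t} {u x : ℕ}, c + (Levels.words t F).length ≤ Z →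
    0 < Ly.length → (∀ x ∈ Levels.vars t F, x.2 < Z) →
    (u, x) ∈ formEdges Z Ly t c F → x < (Ly.length + 1) * Z
  | 0, c, ((i, j), b), u, x, hZ, h0, hv, h => by
    have hj : j < Z := hv (i, j) (by simp [Levels.vars])
    have h2 : 2 * Z ≤ (Ly.length + 1) * Z := Nat.mul_le_mul_right _ (by omega)
    simp only [Levels.words, List.length_cons, List.length_nil] at hZ
    simp only [formEdges, literalEdges, List.mem_append, List.mem_flatMap, List.mem_range] at h
    rcases h with ⟨p, hp, h⟩ | h <;> split_ifs at h <;> simp at h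
    · have h3 : (p + 2) * Z ≤ (Ly.length + 1) * Z := Nat.mul_le_mul_right _ (by omega)
      rw [show (p + 2) * Z = (p + 1) * Z + Z by ring] at h3
      omega
    · omega
  | t + 1, c, F, u, x, hZ, h0, hv, h => by
    simp only [formEdges, List.mem_flatMap, List.mem_cons, Prod.mk.injEq] at h
    simp only [Levels.words, List.length_cons] at hZ
    have h2 : 1 * Z ≤ (Ly.length + 1) * Z := Nat.mul_le_mul_right _ (by omega)
    obtain ⟨y, hy, ⟨-, rfl⟩ | h⟩ := h
    · obtain ⟨h3, h4, h5⟩ := childPos_bounds hy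
      have := length_words_pos t y.2
      omega
    · obtain ⟨h3, h4, h5⟩ := childPos_bounds hy
      exact formEdges_target (by omega) h0 (fun x hx => hv x ⟨_, h3, hx⟩) h

theorem length_formEdges (Z : ℕ) (Ly : List (ℕ × ℕ)) : ∀ (t : ℕ) (c : ℕ) (F : Levels t),
    (formEdges Z Ly t c F).length + 1 ≤ (Levels.words t F).length * (Ly.length + 2)
  | 0, c, ((i, j), b) => by
    have h1 : ((List.range Ly.length).flatMap fun p =>
        if block Ly p = i then [(c, (p + 1) * Z + j)] else []).length ≤ Ly.length * 1 :=
      TreeData.length_flatMap_range_le _ _ _ fun p _ => by split_ifs <;> simp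
    simp only [formEdges, literalEdges, List.length_append, Levels.words, List.length_cons,
      List.length_nil]
    have h2 : (if b = true then ([] : List (ℕ × ℕ)) else [(c, c)]).length ≤ 1 := by
      split_ifs <;> simp
    omega
  | t + 1, c, F => by
    simp only [formEdges, Levels.words, List.length_cons]
    have key : ∀ (F : List (Levels t)) c', ((childPos t c' F).flatMap fun x =>
        (c, x.1) :: formEdges Z Ly t x.1 x.2).length ≤
        (F.flatMap (Levels.words t)).length * (Ly.length + 2) := by
      intro F
      induction F with
      | nil => simp [childPos]
      | cons H F ih =>
        intro c'
        have h1 := ih (c' + (Levels.words t H).length)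
        have h2 := length_formEdges Z Ly t c' H
        simp only [childPos, List.flatMap_cons, List.length_append, List.length_cons, Nat.add_mul]
        omega
    have := key F (c + 1)
    rw [Nat.add_mul]
    omega

namespace QBF

variable {t : ℕ} (I : QBF t)

/-- The instance as a list of numbers. -/
def words : List ℕ :=
  I.blocks.length :: (I.blocks.flatMap (fun b => [b.1, b.2]) ++ Levels.words t I.formula)

/-- The size of the instance. -/
def size : ℕ := (unary I.words).length

/-- The layers of the game.  The first one consists of the start vertex only, and the index of its
block is the number of blocks, so that it is none of them. -/
def layers : List (ℕ × ℕ) := (1, I.blocks.length) :: blockLayers 0 I.blocks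

/-- The place of the formula in the list of numbers; a subformula is represented in the game by its
place in this list. -/
def root : ℕ := 1 + 2 * I.blocks.length

/-- The owners of the moves of the game. -/
def owners : List Bool := blockOwners 0 I.blocks ++ true :: levelOwners t true

/-- The edges of the digraph of the game. -/
def edges : List (ℕ × ℕ) := gameEdges (I.size + 1) I.layers I.root I.formula

/-- The tree that encodes the game. -/
def tree (s : ℕ) : TreeData := ⟨s, 2 ^ (8 * s), I.size + 1, I.edges⟩

theorem size_eq : I.size = I.blocks.length + (I.blocks.map Prod.fst).sum +
    (I.blocks.map Prod.snd).sum + (Levels.words t I.formula).sum + 1 + 2 * I.blocks.length +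
    (Levels.words t I.formula).length := by
  simp only [size, length_unary, words, List.sum_cons, List.sum_append, flatMap_prod_sum,
    List.length_cons, List.length_append, flatMap_prod_length]
  omega

theorem length_layers : I.layers.length = (I.blocks.map Prod.snd).sum + 1 := by
  simp [layers, length_blockLayers]

theorem length_layers_le : I.layers.length ≤ I.size := by
  have := I.size_eq
  rw [length_layers]
  omega

theorem length_owners : I.owners.length = (I.blocks.map Prod.snd).sum + 1 + t := by
  simp [owners, length_blockOwners, length_levelOwners]
  omega

theorem width_lt (p : ℕ) : width I.layers p < I.size + 1 := by
  have h := I.size_eq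
  rcases lt_or_ge p I.layers.length with hp | hp
  · have hmem : I.layers[p] ∈ I.layers := List.getElem_mem hp
    rw [width, List.getD_eq_getElem _ _ hp]
    generalize I.layers[p] = x at hmem ⊢
    rw [layers, List.mem_cons] at hmem
    rcases hmem with rfl | hmem
    · simp only; omega
    · have := List.le_sum_of_mem (mem_blockLayers hmem).1
      omega
  · rw [width, List.getD_eq_default _ _ hp]
    simp only; omega

theorem root_add_le : I.root + (Levels.words t I.formula).length ≤ I.size + 1 := by
  have h := I.size_eq
  rw [root]
  omega

theorem vars_lt (x : BVar) (hx : x ∈ Levels.vars t I.formula) :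
    x.1 < I.blocks.length ∧ x.2 < I.size + 1 := by
  obtain ⟨h, h2⟩ := I.vars_mem x hx
  have h3 := List.le_sum_of_mem (List.mem_map_of_mem (f := Prod.fst) (List.getElem_mem h))
  have := I.size_eq
  exact ⟨h, by omega⟩

/-- The existential player wins the game exactly on the yes-instances. -/
theorem play_iff : Play (fun u x => (u, x) ∈ I.edges) I.owners [] (I.size + 1) ↔
    I ∈ (QBFSAT t).yes := by
  have h := play_blocks (Z := I.size + 1) (Ly := I.layers) (root := I.root) (F := I.formula)
    (by rw [root]; omega) I.root_add_le I.width_lt (r := I.blocks.length) I.vars_lt I.blocks 0 ∅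
    [(1, I.blocks.length)] 0 0 [] (by simp) rfl rfl (by simp [width, layers])
    (fun q hq => .inr (by obtain rfl : q = 0 := by simpa using hq
                          rfl))
    (fun n hn => by simp at hn; omega)
    (fun x hx1 hx2 => by
      simp only [Set.mem_empty_iff_false, false_iff, not_exists, not_and, List.mem_singleton]
      rintro q hq h1 h2
      obtain ⟨h3, -⟩ := node_inj hx2 (by omega) h2
      obtain rfl : q = 0 := by omega
      simp [block, layers] at h1
      omega)
  rwa [Nat.zero_add, Nat.one_mul, Nat.add_zero] at h

theorem edges_lt (p : ℕ × ℕ) (hp : p ∈ I.edges) :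
    p.1 < (I.size + 3) ^ 2 ∧ p.2 < (I.size + 3) ^ 2 := by
  have hZ : (I.layers.length + 1) * (I.size + 1) ≤ (I.size + 3) ^ 2 := by
    have := I.length_layers_le
    rw [pow_two]
    exact Nat.mul_le_mul (by omega) (by omega)
  have hnode : ∀ q v, q < I.layers.length → v < I.size + 1 →
      (q + 1) * (I.size + 1) + v < (I.size + 3) ^ 2 := by
    intro q v hq hv
    have : (q + 2) * (I.size + 1) ≤ (I.layers.length + 1) * (I.size + 1) :=
      Nat.mul_le_mul_right _ (by omega)
    rw [show (q + 2) * (I.size + 1) = (q + 1) * (I.size + 1) + (I.size + 1) by ring] at this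
    omega
  have h1 : 0 < I.layers.length := by simp [layers]
  have h2 : I.size + 1 < (I.size + 3) ^ 2 := by nlinarith
  have h3 := I.root_add_le
  have h4 := length_words_pos t I.formula
  obtain ⟨u, x⟩ := p
  simp only [edges, gameEdges, layerEdges, List.mem_cons, List.mem_append, List.mem_flatMap,
    List.mem_map, List.mem_range, Prod.mk.injEq] at hp
  rcases hp with ⟨rfl, rfl⟩ | ((⟨q, hq, v, hv, v', hv', h⟩ | ⟨v, hv, rfl, rfl⟩) | h)
  · simp
  · split_ifs at h
    · simp at h
    · simp only [List.mem_singleton, Prod.mk.injEq] at h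
      obtain ⟨rfl, rfl⟩ := h
      exact ⟨hnode _ _ (by omega) (hv.trans (I.width_lt _)),
        hnode (q + 1) _ (by omega) (hv'.trans (I.width_lt _))⟩
  · exact ⟨hnode _ _ (by omega) (hv.trans (I.width_lt _)), by simp only; omega⟩
  · exact ⟨by have := formEdges_source h; simp only; omega,
      (formEdges_target h3 h1 (fun x hx => (I.vars_lt x hx).2) h).trans_le hZ⟩

theorem length_edges : I.edges.length ≤ (I.size + 3) ^ 4 := by
  have h1 := length_formEdges (I.size + 1) I.layers t I.root I.formula
  have h2 := I.length_layers_le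
  have h3 := I.root_add_le
  have hw := fun p => (I.width_lt p).le
  have h4 : ((List.range (I.layers.length - 1)).flatMap fun p =>
      (List.range (width I.layers p)).flatMap fun v =>
      (List.range (width I.layers (p + 1))).flatMap fun v' =>
      if block I.layers p = block I.layers (p + 1) ∧ v' ≤ v then []
        else [((p + 1) * (I.size + 1) + v, (p + 2) * (I.size + 1) + v')]).length ≤
      (I.layers.length - 1) * ((I.size + 1) * ((I.size + 1) * 1)) := by
    refine TreeData.length_flatMap_range_le _ _ _ fun p _ => ?_
    refine (TreeData.length_flatMap_range_le _ ((I.size + 1) * 1) _ fun v _ => ?_).trans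
      (Nat.mul_le_mul_right _ (hw _))
    refine (TreeData.length_flatMap_range_le _ 1 _ fun v' _ => ?_).trans
      (Nat.mul_le_mul_right _ (hw _))
    split_ifs <;> simp
  have h5 : (Levels.words t I.formula).length * (I.layers.length + 2) ≤
      (I.size + 1) * (I.size + 2) := Nat.mul_le_mul (by omega) (by omega)
  have h6 : (I.layers.length - 1) * ((I.size + 1) * ((I.size + 1) * 1)) ≤
      I.size * ((I.size + 1) * ((I.size + 1) * 1)) := Nat.mul_le_mul_right _ (by omega)
  have h7 := hw (I.layers.length - 1)
  simp only [edges, gameEdges, layerEdges, List.length_cons, List.length_append, List.length_map,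
    List.length_range]
  calc _ ≤ 1 + I.size * ((I.size + 1) * ((I.size + 1) * 1)) + (I.size + 1) +
        (I.size + 1) * (I.size + 2) := by omega
    _ ≤ (I.size + 3) ^ 4 := by nlinarith [sq_nonneg I.size, Nat.zero_le (I.size ^ 3)]

variable {s : ℕ}

theorem good_tree (hs : 3 ≤ s) (h : (I.size + 3) ^ 2 ≤ 2 ^ (s * s)) : (I.tree s).Good where
  two_le_s := by simp only [tree]; omega
  sq_lt_M := by
    have h1 : s + 1 ≤ 2 ^ s := Nat.lt_two_pow_self
    simp only [tree]
    calc s * s + 1 ≤ (s + 1) * (s + 1) := by nlinarith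
      _ ≤ 2 ^ s * 2 ^ s := Nat.mul_le_mul h1 h1
      _ = 2 ^ (s + s) := by rw [pow_add]
      _ ≤ _ := Nat.pow_le_pow_right (by norm_num) (by omega)
  edges_ne := by simp [tree, edges, gameEdges]
  lt_start := by simp only [tree]; nlinarith
  lt_edges p hp := by
    obtain ⟨h1, h2⟩ := I.edges_lt p hp
    exact ⟨h1.trans_le h, h2.trans_le h⟩

open FOC

/-- The tree has depth nine, and on it the sentence is stable and tells whether the given instance
is a yes-instance. -/
theorem tree_spec (ρ : Rule) (hs : 3 ≤ s) (h : (I.size + 3) ^ 2 ≤ 2 ^ (s * s)) :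
    IsTreeOfDepth (I.tree s).labelling.graph 9 ∧
      (Models (I.tree s).labelling.graph
        (gameF ρ (((I.tree s).M ^ (4 * s + 2) : ℕ) : ℤ) I.owners) ↔ I ∈ (QBFSAT t).yes) ∧
      Stable (2 ^ Real.sqrt (Real.logb 2 (I.tree s).labs.length)) (I.tree s).labelling.graph
        (gameF ρ (((I.tree s).M ^ (4 * s + 2) : ℕ) : ℤ) I.owners) := by
  have hD := I.good_tree hs h
  have hR : (I.tree s).edges.length ≤ 2 ^ (2 * (I.tree s).s * (I.tree s).s) := by
    refine I.length_edges.trans ?_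
    calc _ = ((I.size + 3) ^ 2) ^ 2 := by ring
      _ ≤ (2 ^ (s * s)) ^ 2 := by gcongr
      _ = 2 ^ (2 * s * s) := by rw [← pow_mul]; congr 1; ring
  obtain ⟨h1, h2⟩ := TreeData.tolerance_le hD hs rfl hR
  have hsep := (I.tree s).labelling.separated hD ρ h1 h2
  have henc := (I.tree s).labelling.encodes hD ρ
  have : Nonempty (Fin (I.tree s).labs.length) :=
    ⟨((I.tree s).labelling.surj (.ch 0) (by simp [TreeData.Valid])).choose⟩
  refine ⟨(I.tree s).labelling.isTreeOfDepth hD, ?_, stable_gameF hsep henc _⟩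
  rw [← I.play_iff]
  exact models_gameF_iff hsep henc I.owners

end QBF

end ParamComplexity

/-! ### Reasoning about bounded loops -/

namespace LoopLang

namespace Store

variable (v : Store)

@[simp] theorem set_reg (i x j : ℕ) : (v.set i x).reg j = if j = i then x else v.reg j := by
  simp [set, Function.update_apply]

@[simp] theorem set_arr (i x : ℕ) : (v.set i x).arr = v.arr := rfl

@[simp] theorem app_reg (b : Fin 8) (l : List ℕ) : (v.app b l).reg = v.reg := rfl

@[simp] theorem app_arr (b b' : Fin 8) (l : List ℕ) :
    (v.app b l).arr b' = if b' = b then v.arr b ++ l else v.arr b' := by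
  simp [app, Function.update_apply]

@[simp] theorem app_nil (b : Fin 8) : v.app b [] = v := by
  cases v; simp [app]

@[simp] theorem app_app (b : Fin 8) (l l' : List ℕ) : (v.app b l).app b l' = v.app b (l ++ l') := by
  simp [app]

@[simp] theorem set_app (i x : ℕ) (b : Fin 8) (l : List ℕ) :
    (v.set i x).app b l = (v.app b l).set i x := rfl

@[simp] theorem set_set (i x y : ℕ) : (v.set i x).set i y = v.set i y := by
  simp [set]

theorem set_of_eq {i x : ℕ} (h : x = v.reg i) : v.set i x = v := by
  subst h; cases v; simp [set]

@[simp] theorem set_reg_self (i : ℕ) : v.set i (v.reg i) = v := v.set_of_eq rfl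

end Store

namespace Does

variable {N : ℕ} {P Q : Cmd} {v u w : Store}

theorem congr (h : Does N P v u) (hr : ∀ a, u.reg a = w.reg a) (ha : ∀ b, u.arr b = w.arr b) :
    Does N P v w := by
  obtain rfl : u = w := Store.ext (funext hr) (funext ha)
  exact h

theorem skip : Does N .skip v v := ⟨rfl, trivial⟩

theorem set {i : ℕ} {e : Ex} {x : ℕ} (h : e.ev v = x) : Does N (.set i e) v (v.set i x) :=
  ⟨by rw [← h]; rfl, trivial⟩

theorem push {b : Fin 8} {e : Ex} {x : ℕ} (h : e.ev v = x) : Does N (.push b e) v (v.app b [x]) :=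
  ⟨by rw [← h]; rfl, trivial⟩

theorem seq (h : Does N P v u) (h' : Does N Q u w) : Does N (.seq P Q) v w :=
  ⟨by rw [Cmd.run, h.1, h'.1], h.2, by rw [h.1]; exact h'.2⟩

theorem ite {e : Ex} (h : e.ev v ≠ 0 → Does N P v w) (h' : e.ev v = 0 → Does N Q v w) :
    Does N (.ite e P Q) v w := by
  by_cases he : e.ev v = 0
  · exact ⟨by simp [Cmd.run, he, (h' he).1], by simp [Cmd.Ok, he, (h' he).2]⟩
  · exact ⟨by simp [Cmd.run, he, (h he).1], by simp [Cmd.Ok, he, (h he).2]⟩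

theorem loc {i : ℕ} {e : Ex} {x : ℕ} (he : e.ev v = x) (h : Does N P (v.set i x) w) :
    Does N (.loc i e P) v (w.set i (v.reg i)) := by
  subst he
  exact ⟨by rw [Cmd.run, h.1], h.2⟩

theorem loop {i : ℕ} {e : Ex} {n : ℕ} (g : ℕ → Store) (he : e.ev v = n) (hn : n ≤ N) (h0 : g 0 = v)
    (h : ∀ k < n, ∃ w, Does N P ((g k).set i k) w ∧ w.set i ((g k).reg i) = g (k + 1)) :
    Does N (.loop i e P) v (g n) := by
  have key : ∀ k ≤ n,
      iter (fun k u => (P.run (u.set i k)).set i (u.reg i)) v k = g k := by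
    intro k
    induction k with
    | zero => intro _; exact h0.symm
    | succ k ih =>
      intro hk
      obtain ⟨w, hw, hg⟩ := h k hk
      rw [iter, ih (by omega), hw.1, hg]
  subst he
  refine ⟨key _ le_rfl, hn, fun k hk => ?_⟩
  rw [key k hk.le]
  obtain ⟨w, hw, -⟩ := h k hk
  exact hw.2

/-- A command that only appends to an array, using a local register. -/
theorem loc_app {i : ℕ} {e : Ex} {x : ℕ} {b : Fin 8} {l : List ℕ} (he : e.ev v = x)
    (h : Does N P (v.set i x) ((v.set i x).app b l)) : Does N (.loc i e P) v (v.app b l) := by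
  have := loc he h
  rwa [Store.set_app, Store.set_set, Store.set_of_eq _ (by simp)] at this

/-- A local register that is given its value by a command. -/
theorem loc_seq_app {i : ℕ} {e : Ex} {x y : ℕ} {b : Fin 8} {l : List ℕ} (he : e.ev v = x)
    (h : Does N P (v.set i x) (v.set i y)) (h' : Does N Q (v.set i y) ((v.set i y).app b l)) :
    Does N (.loc i e (.seq P Q)) v (v.app b l) := by
  have := loc he (h.seq h')
  rwa [Store.set_app, Store.set_set, Store.set_of_eq _ (by simp)] at this

/-- A loop whose body only appends to an array. -/
theorem loop_app {i : ℕ} {e : Ex} {n : ℕ} {b : Fin 8} (l : ℕ → List ℕ) (he : e.ev v = n)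
    (hn : n ≤ N)
    (h : ∀ k < n, ∀ u, u = (v.app b ((List.range k).flatMap l)).set i k →
      Does N P u (u.app b (l k))) :
    Does N (.loop i e P) v (v.app b ((List.range n).flatMap l)) := by
  refine loop (fun k => v.app b ((List.range k).flatMap l)) he hn (by simp) fun k hk =>
    ⟨_, h k hk _ rfl, ?_⟩
  rw [Store.set_app, Store.set_set, Store.set_of_eq _ (by simp)]
  simp [List.range_succ]

theorem seq_app {b : Fin 8} {l l' : List ℕ} (h : Does N P v (v.app b l))
    (h' : Does N Q (v.app b l) ((v.app b l).app b l')) :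
    Does N (.seq P Q) v (v.app b (l ++ l')) := by
  rw [Store.app_app] at h'
  exact seq h h'

end Does

/-- Appends the values of several expressions. -/
def pushAll (b : Fin 8) : List Ex → Cmd
  | [] => .skip
  | e :: es => .seq (.push b e) (pushAll b es)

/-- The expression does not read the length or the entries of the array. -/
def Ex.Avoids (b : Fin 8) : Ex → Prop
  | c _ => True
  | r _ => True
  | add e e' => e.Avoids b ∧ e'.Avoids b
  | sub e e' => e.Avoids b ∧ e'.Avoids b
  | half e => e.Avoids b
  | get b' e => b' ≠ b ∧ e.Avoids b
  | len b' => b' ≠ b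

theorem Ex.ev_app {b : Fin 8} {e : Ex} (h : e.Avoids b) (v : Store) (l : List ℕ) :
    e.ev (v.app b l) = e.ev v := by
  induction e with
  | c k => rfl
  | r i => rfl
  | add e e' ih ih' => simp only [ev, ih h.1, ih' h.2]
  | sub e e' ih ih' => simp only [ev, ih h.1, ih' h.2]
  | half e ih => simp only [ev, ih h]
  | get b' e ih => simp only [ev, ih h.2, Store.app_arr, if_neg h.1]
  | len b' =>
    have h : b' ≠ b := h
    simp only [ev, Store.app_arr, if_neg h]

theorem Does.pushAll {N : ℕ} {b : Fin 8} : ∀ {es : List Ex} {v : Store} {l : List ℕ},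
    (∀ e ∈ es, e.Avoids b) → es.map (fun e => e.ev v) = l →
    Does N (pushAll b es) v (v.app b l)
  | [], v, l, _, h => by subst h; simpa [LoopLang.pushAll] using Does.skip
  | e :: es, v, l, ha, h => by
    subst h
    refine Does.seq_app (l := [e.ev v]) (Does.push rfl) (Does.pushAll
      (fun e' he' => ha e' (List.mem_cons_of_mem _ he')) ?_)
    exact List.map_congr_left fun e' he' => Ex.ev_app (ha e' (List.mem_cons_of_mem _ he')) _ _

/-- `R_i := R_i + R_j` for as many times as `e` says. -/
def addMul (i j : ℕ) (e : Ex) : Cmd := .loop 0 e (.set i (.add (.r i) (.r j)))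

theorem Does.addMul {N i j n : ℕ} {e : Ex} {v : Store} (hi : i ≠ 0) (hj : j ≠ 0) (hij : j ≠ i)
    (he : e.ev v = n) (hn : n ≤ N) :
    Does N (addMul i j e) v (v.set i (v.reg i + n * v.reg j)) := by
  refine Does.loop (fun k => v.set i (v.reg i + k * v.reg j)) he hn (by simp) fun k hk =>
    ⟨_, Does.set rfl, ?_⟩
  refine Store.ext (funext fun a => ?_) rfl
  simp only [Store.set_reg, Ex.ev]
  split_ifs <;> first | omega | (subst_vars; first | omega | ring)

/-- A product is computed in a register that has been cleared. -/
theorem Does.addMul_zero {N i j n x : ℕ} {e : Ex} {v : Store} (hi : i ≠ 0) (hj : j ≠ 0)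
    (hij : j ≠ i) (he : e.ev (v.set i 0) = n) (hn : n ≤ N) (hx : n * v.reg j = x) :
    Does N (LoopLang.addMul i j e) (v.set i 0) (v.set i x) := by
  refine (Does.addMul hi hj hij he hn).congr (fun a => ?_) fun b => rfl
  simp [hij, hx]

end LoopLang

/-! ### The numbers that the reduction needs -/

namespace LoopLang

open ParamComplexity (unary)

/-- Reading a list of numbers written in unary: the current number and the finished ones. -/
def decodeStep (x : ℕ × List ℕ) (a : ℕ) : ℕ × List ℕ :=
  if a ≠ 0 then (x.1 + 1, x.2) else (0, x.2 ++ [x.1])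

theorem foldl_decodeStep (w l : List ℕ) :
    ((unary w).map Bool.toNat).foldl decodeStep (0, l) = (0, l ++ w) := by
  have h1 : ∀ n m l, ((List.replicate n true).map Bool.toNat).foldl decodeStep (m, l) =
      (m + n, l) := by
    intro n
    induction n with
    | zero => intro m l; rfl
    | succ n ih =>
      intro m l
      rw [List.replicate_succ, List.map_cons, List.foldl_cons, decodeStep, if_pos (by simp), ih]
      simp only [Prod.mk.injEq, and_true]; omega
  induction w generalizing l with
  | nil => simp [unary]
  | cons n w ih =>
    have : unary (n :: w) = List.replicate n true ++ [false] ++ unary w := by simp [unary]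
    rw [this, List.map_append, List.map_append, List.foldl_append, List.foldl_append, h1]
    have e : (List.map Bool.toNat [false]).foldl decodeStep (0 + n, l) = (0, l ++ [n]) := by
      simp [decodeStep]
    rw [e, ih]
    simp

/-- Appends to the array `2` the numbers whose unary encoding stands in the array `0`. -/
def decodeCmd : Cmd :=
  .loop 10 (.len 0) (.ite (.get 0 (.r 10)) (.set 1 (.add (.r 1) (.c 1)))
    (.seq (.push 2 (.r 1)) (.set 1 (.c 0))))

theorem does_decodeCmd {N : ℕ} {v : Store} {w : List ℕ} (h0 : v.arr 0 = (unary w).map Bool.toNat)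
    (h1 : v.reg 1 = 0) (hN : (unary w).length ≤ N) : Does N decodeCmd v (v.app 2 w) := by
  set x : ℕ → ℕ × List ℕ := fun k => ((v.arr 0).take k).foldl decodeStep (0, []) with hx
  have hlen : (v.arr 0).length = (unary w).length := by simp [h0]
  have hend : x (v.arr 0).length = (0, w) := by
    simp only [hx]
    rw [List.take_length, h0, foldl_decodeStep]; simp
  have key := Does.loop (N := N) (P := .ite (.get 0 (.r 10)) (.set 1 (.add (.r 1) (.c 1)))
    (.seq (.push 2 (.r 1)) (.set 1 (.c 0)))) (v := v) (i := 10) (e := .len 0)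
    (fun k => (v.set 1 (x k).1).app 2 (x k).2) rfl (by change (v.arr 0).length ≤ N; omega)
    (by simp [hx, Store.set_of_eq, h1]) fun k hk => ?_
  · simp only [Ex.ev, hend] at key
    rwa [Store.set_of_eq _ h1.symm] at key
  · have hk : k < (v.arr 0).length := hk
    have hstep : x (k + 1) = decodeStep (x k) ((v.arr 0).getD k 0) := by
      simp only [hx]
      rw [List.take_add_one, List.getElem?_eq_getElem hk, Option.toList_some, List.foldl_append,
        List.foldl_cons, List.foldl_nil, List.getD_eq_getElem _ _ hk]
    have hev : Ex.ev ((((v.set 1 (x k).1).app 2 (x k).2)).set 10 k) (.get 0 (.r 10)) =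
        (v.arr 0).getD k 0 := by simp [Ex.ev]
    refine ⟨(((v.set 1 (x (k + 1)).1).app 2 (x (k + 1)).2)).set 10 k, Does.ite (fun h => ?_)
      (fun h => ?_), ?_⟩
    · rw [hev] at h
      rw [hstep, decodeStep, if_pos h]
      refine (Does.set rfl).congr (fun a => ?_) fun b => by simp
      simp [Ex.ev]; grind
    · rw [hev] at h
      rw [hstep, decodeStep, if_neg (by simpa using h)]
      refine ((Does.push rfl).seq (Does.set rfl)).congr (fun a => ?_) fun b => ?_
      · simp [Ex.ev]; grind
      · simp [Ex.ev]
    · refine Store.ext (funext fun a => ?_) rfl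
      simp; grind

/-- Numbers `s` that increase by one as long as `2 ^ (s * s)` is less than `T`. -/
def growth (T : ℕ) : ℕ → ℕ
  | 0 => 3
  | k + 1 => if 2 ^ (growth T k * growth T k) < T then growth T k + 1 else growth T k

/-- A number `s` such that `2 ^ (s * s)` lies between the square of `l + 3` and a power of it. -/
def sideLength (l : ℕ) : ℕ := growth ((l + 3) ^ 2) (l + 3)

theorem three_le_growth (T k : ℕ) : 3 ≤ growth T k := by
  induction k with
  | zero => exact le_rfl
  | succ k ih => rw [growth]; split_ifs <;> omega

theorem growth_le (T k : ℕ) : growth T k ≤ k + 3 := by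
  induction k with
  | zero => exact le_rfl
  | succ k ih => rw [growth]; split_ifs <;> omega

theorem sq_le_two_pow_sideLength (l : ℕ) :
    (l + 3) ^ 2 ≤ 2 ^ (sideLength l * sideLength l) := by
  have key : ∀ k, (l + 3) ^ 2 ≤ 2 ^ (growth ((l + 3) ^ 2) k * growth ((l + 3) ^ 2) k) ∨
      growth ((l + 3) ^ 2) k = k + 3 := by
    intro k
    induction k with
    | zero => exact .inr rfl
    | succ k ih =>
      rw [growth]
      split_ifs with h
      · exact .inr (by omega)
      · exact .inl (by omega)
  rcases key (l + 3) with h | h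
  · exact h
  · rw [sideLength, h]
    have h1 : l + 3 ≤ 2 ^ (l + 3) := Nat.lt_two_pow_self.le
    calc (l + 3) ^ 2 ≤ (2 ^ (l + 3)) ^ 2 := Nat.pow_le_pow_left h1 2
      _ = 2 ^ ((l + 3) * 2) := by rw [← pow_mul]
      _ ≤ _ := Nat.pow_le_pow_right (by norm_num) (Nat.mul_le_mul (by omega) (by omega))

theorem two_pow_sideLength_le (l : ℕ) :
    2 ^ (sideLength l * sideLength l) ≤ 2 ^ 9 * (l + 3) ^ 8 := by
  have key : ∀ k, 2 ^ (growth ((l + 3) ^ 2) k * growth ((l + 3) ^ 2) k) ≤ 2 ^ 9 * (l + 3) ^ 8 := by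
    intro k
    induction k with
    | zero => exact Nat.le_mul_of_pos_right _ (by positivity)
    | succ k ih =>
      rw [growth]
      split_ifs with h
      · have h3 := three_le_growth ((l + 3) ^ 2) k
        generalize growth ((l + 3) ^ 2) k = s at *
        calc 2 ^ ((s + 1) * (s + 1)) ≤ 2 ^ (s * s * 4) :=
              Nat.pow_le_pow_right (by norm_num) (by nlinarith)
          _ = (2 ^ (s * s)) ^ 4 := by rw [pow_mul]
          _ ≤ ((l + 3) ^ 2) ^ 4 := Nat.pow_le_pow_left h.le 4
          _ = (l + 3) ^ 8 := by ring
          _ ≤ _ := Nat.le_mul_of_pos_left _ (by norm_num)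
      · exact ih
  exact key _

/-- Computes the side length in register `5`.  Register `4` holds the number `T` of `growth`, and
register `7` holds `2 ^ (s * s)` for the current side length `s`. -/
def sideCmd : Cmd :=
  .seq (.seq (.set 4 (.c 0)) <| .seq (.set 21 (.add (.len 0) (.c 3))) <|
    .seq (addMul 4 21 (.r 21)) <| .seq (.set 5 (.c 3)) (.set 7 (.c 512))) <|
  .loop 10 (.r 21) (.ite (.sub (.r 4) (.r 7))
    (.seq (.loop 0 (.add (.add (.r 5) (.r 5)) (.c 1)) (.set 7 (.add (.r 7) (.r 7))))
      (.set 5 (.add (.r 5) (.c 1)))) .skip)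

/-- Doubles the content of a register several times. -/
theorem Does.double {N i n : ℕ} {e : Ex} {v : Store} (hi : i ≠ 0) (he : e.ev v = n) (hn : n ≤ N) :
    Does N (.loop 0 e (.set i (.add (.r i) (.r i)))) v (v.set i (v.reg i * 2 ^ n)) := by
  refine Does.loop (fun k => v.set i (v.reg i * 2 ^ k)) he hn (by simp) fun k hk =>
    ⟨_, Does.set rfl, ?_⟩
  refine Store.ext (funext fun a => ?_) rfl
  simp only [Store.set_reg, Ex.ev]
  split_ifs <;> first | omega | (subst_vars; first | omega | ring)

theorem does_sideCmd {N l : ℕ} {v : Store} (hl : (v.arr 0).length = l) (hN : 2 * l + 13 ≤ N) :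
    ∃ x y z, Does N sideCmd v
      ((((v.set 4 x).set 21 y).set 5 (sideLength l)).set 7 z) := by
  have h1 : Does N (.seq (.set 4 (.c 0)) <| .seq (.set 21 (.add (.len 0) (.c 3))) <|
      .seq (addMul 4 21 (.r 21)) <| .seq (.set 5 (.c 3)) (.set 7 (.c 512))) v
      ((((v.set 4 ((l + 3) ^ 2)).set 21 (l + 3)).set 5 3).set 7 512) := by
    refine Does.congr ((Does.set rfl).seq <| (Does.set rfl).seq <|
      (Does.addMul (by norm_num) (by norm_num) (by norm_num) rfl ?_).seq <|
      (Does.set rfl).seq (Does.set rfl)) (fun a => ?_) fun b => rfl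
    · simp [Ex.ev, hl]; omega
    · simp [Ex.ev, hl, pow_two]
      grind
  have h2 : Does N (.loop 10 (.r 21) (.ite (.sub (.r 4) (.r 7))
      (.seq (.loop 0 (.add (.add (.r 5) (.r 5)) (.c 1)) (.set 7 (.add (.r 7) (.r 7))))
        (.set 5 (.add (.r 5) (.c 1)))) .skip))
      ((((v.set 4 ((l + 3) ^ 2)).set 21 (l + 3)).set 5 3).set 7 512)
      ((((v.set 4 ((l + 3) ^ 2)).set 21 (l + 3)).set 5 (sideLength l)).set 7
        (2 ^ (sideLength l * sideLength l))) := by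
    refine Does.loop (n := l + 3) (fun k => ((((v.set 4 ((l + 3) ^ 2)).set 21 (l + 3)).set 5
      (growth ((l + 3) ^ 2) k)).set 7
        (2 ^ (growth ((l + 3) ^ 2) k * growth ((l + 3) ^ 2) k)))) (by simp [Ex.ev]) (by omega) ?_
        fun k hk => ?_
    · simp [growth]
    · refine ⟨((((v.set 4 ((l + 3) ^ 2)).set 21 (l + 3)).set 5
        (growth ((l + 3) ^ 2) (k + 1))).set 7
        (2 ^ (growth ((l + 3) ^ 2) (k + 1) * growth ((l + 3) ^ 2) (k + 1)))).set 10 k,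
        Does.ite (fun h => ?_) fun h => ?_, ?_⟩
      · simp [Ex.ev] at h
        have h3 : 2 ^ (growth ((l + 3) ^ 2) k * growth ((l + 3) ^ 2) k) < (l + 3) ^ 2 := by omega
        refine Does.congr ((Does.double (by norm_num) rfl ?_).seq (Does.set rfl)) (fun a => ?_)
          fun b => rfl
        · have := growth_le ((l + 3) ^ 2) k
          simp [Ex.ev]; omega
        · rw [growth, if_pos h3]
          simp [Ex.ev]
          have : 2 ^ (growth ((l + 3) ^ 2) k * growth ((l + 3) ^ 2) k) *
              2 ^ (growth ((l + 3) ^ 2) k + growth ((l + 3) ^ 2) k + 1) =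
              2 ^ ((growth ((l + 3) ^ 2) k + 1) * (growth ((l + 3) ^ 2) k + 1)) := by
            rw [← pow_add]; congr 1; ring
          rw [this]
          grind
      · simp [Ex.ev] at h
        have h3 : ¬ 2 ^ (growth ((l + 3) ^ 2) k * growth ((l + 3) ^ 2) k) < (l + 3) ^ 2 := by omega
        rw [growth, if_neg h3]
        exact Does.skip
      · refine Store.ext (funext fun a => ?_) rfl
        simp; grind
  exact ⟨_, _, _, h1.seq h2⟩

/-- Computes the number `M` in register `6`, its powers in the array `6`, and the bound of the
counting terms in register `8`. -/
def powersCmd : Cmd :=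
  .seq (.seq (.set 6 (.c 1)) <|
    .seq (.loop 0 (.add (.add (.add (.r 5) (.r 5)) (.add (.r 5) (.r 5)))
    (.add (.add (.r 5) (.r 5)) (.add (.r 5) (.r 5)))) (.set 6 (.add (.r 6) (.r 6))))
    (.push 6 (.c 1))) <|
  .seq (.loop 10 (.add (.add (.add (.r 5) (.r 5)) (.add (.r 5) (.r 5))) (.c 2))
    (.loc 14 (.c 0) (.seq (.loop 11 (.r 6) (.set 14 (.add (.r 14) (.get 6 (.r 10)))))
      (.push 6 (.r 14))))) <|
  .set 8 (.get 6 (.add (.add (.add (.r 5) (.r 5)) (.add (.r 5) (.r 5))) (.c 2)))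

theorem does_powersCmd {N s : ℕ} {v : Store} (hs : v.reg 5 = s) (h6 : v.arr 6 = [])
    (hN : 2 ^ (8 * s) ≤ N) (hN' : 8 * s + 2 ≤ N) :
    Does N powersCmd v (((v.set 6 (2 ^ (8 * s))).app 6
      ((List.range (4 * s + 3)).map fun k => (2 ^ (8 * s)) ^ k)).set 8
        ((2 ^ (8 * s)) ^ (4 * s + 2))) := by
  set M := 2 ^ (8 * s) with hM
  have hr : ∀ k, [1] ++ (List.range k).flatMap (fun k => [M ^ (k + 1)]) =
      (List.range (k + 1)).map (M ^ ·) := by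
    intro k
    induction k with
    | zero => rfl
    | succ k ih => rw [List.range_succ, List.flatMap_append, ← List.append_assoc, ih,
        List.range_succ (n := k + 1)]; simp
  have h1 : Does N (.loop 10 (.add (.add (.add (.r 5) (.r 5)) (.add (.r 5) (.r 5))) (.c 2))
    (.loc 14 (.c 0) (.seq (.loop 11 (.r 6) (.set 14 (.add (.r 14) (.get 6 (.r 10)))))
      (.push 6 (.r 14))))) ((v.set 6 M).app 6 [1]) (((v.set 6 M).app 6 [1]).app 6
        ((List.range (4 * s + 2)).flatMap fun k => [M ^ (k + 1)])) := by
    refine Does.loop_app _ (by simp [Ex.ev, hs]; omega) (by omega) fun k hk u hu => ?_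
    have ha : u.arr 6 = (List.range (k + 1)).map (M ^ ·) := by
      rw [← hr, hu]; simp [h6]
    have hg : (u.arr 6).getD k 0 = M ^ k := by rw [ha]; simp [List.getD]
    have h3 : u.reg 6 = M := by rw [hu]; simp
    have h4 : u.reg 10 = k := by rw [hu]; simp
    have h5 : Does N (.loop 11 (.r 6) (.set 14 (.add (.r 14) (.get 6 (.r 10))))) (u.set 14 0)
        ((u.set 14 (M * M ^ k))) := by
      refine Does.loop (n := M) (fun j => u.set 14 (j * M ^ k)) (by simp [Ex.ev, h3]) hN
        (by simp) fun j hj => ⟨_, Does.set rfl, ?_⟩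
      refine Store.ext (funext fun a => ?_) rfl
      simp only [Store.set_reg, Ex.ev, Store.set_arr, if_true]
      simp only [Nat.reduceEqDiff, if_false, h4, hg]
      split_ifs <;> first | omega | (subst_vars; first | omega | ring)
    refine Does.loc_seq_app rfl h5 (Does.push ?_)
    simp [Ex.ev, pow_succ, mul_comm]
  have h0 : Does N (.seq (.set 6 (.c 1)) <|
    .seq (.loop 0 (.add (.add (.add (.r 5) (.r 5)) (.add (.r 5) (.r 5)))
    (.add (.add (.r 5) (.r 5)) (.add (.r 5) (.r 5)))) (.set 6 (.add (.r 6) (.r 6))))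
    (.push 6 (.c 1))) v ((v.set 6 M).app 6 [1]) := by
    refine Does.congr ((Does.set rfl).seq <| (Does.double (n := 8 * s) (by norm_num) ?_
      (by omega)).seq (Does.push rfl)) (fun a => ?_) fun b => ?_
    · simp [Ex.ev, hs]; omega
    · simp [Ex.ev, hM]
    · simp [Ex.ev]
  refine Does.congr (h0.seq <| h1.seq (Does.set rfl)) (fun a => ?_) fun b => ?_
  · have hg : ([1] ++ (List.range (4 * s + 2)).flatMap fun k => [M ^ (k + 1)]).getD (4 * s + 2) 0 =
        M ^ (4 * s + 2) := by rw [hr]; simp [List.getD]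
    have h4 : s + s + (s + s) + 2 = 4 * s + 2 := by omega
    simp only [Ex.ev, Store.set_reg, Store.app_reg, Store.app_arr, Store.set_arr, if_true, h6,
      List.nil_append, Nat.reduceEqDiff, if_false, hs, h4, hg]
  · have hg := hr (4 * s + 2)
    simp only [Store.app_app, Store.set_arr, Store.app_arr, h6, List.nil_append, hg]

end LoopLang

/-! ### Computing the edges of the game -/

namespace LoopLang

open ParamComplexity

/-- A list of pairs, written into an array. -/
def flat (l : List (ℕ × ℕ)) : List ℕ := l.flatMap fun x => [x.1, x.2]

@[simp] theorem flat_nil : flat [] = [] := rfl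

@[simp] theorem flat_cons (x : ℕ × ℕ) (l : List (ℕ × ℕ)) : flat (x :: l) = x.1 :: x.2 :: flat l := rfl

@[simp] theorem flat_append (l l' : List (ℕ × ℕ)) : flat (l ++ l') = flat l ++ flat l' :=
  List.flatMap_append

@[simp] theorem length_flat (l : List (ℕ × ℕ)) : (flat l).length = 2 * l.length :=
  flatMap_prod_length l

theorem flat_flatMap {α : Type} (l : List α) (f : α → List (ℕ × ℕ)) :
    flat (l.flatMap f) = l.flatMap fun a => flat (f a) := List.flatMap_assoc

theorem flat_map {α : Type} (l : List α) (f : α → ℕ × ℕ) :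
    flat (l.map f) = l.flatMap fun a => [(f a).1, (f a).2] := by
  rw [flat, List.flatMap_map]

theorem getD_flat (l : List (ℕ × ℕ)) (p : ℕ) :
    (flat l).getD (p + p) 0 = (l.getD p (0, 0)).1 ∧
      (flat l).getD (p + p + 1) 0 = (l.getD p (0, 0)).2 := by
  induction l generalizing p with
  | nil => simp
  | cons x l ih =>
    rcases p with _ | p
    · simp
    · rw [show p + 1 + (p + 1) = p + p + 1 + 1 by ring]
      simpa using ih p

theorem getD_flat_append {l : List (ℕ × ℕ)} {p : ℕ} (hp : p < l.length) (l' : List ℕ) :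
    (flat l ++ l').getD (p + p) 0 = (l.getD p (0, 0)).1 ∧
      (flat l ++ l').getD (p + p + 1) 0 = (l.getD p (0, 0)).2 := by
  rw [List.getD_append _ _ _ _ (by rw [length_flat]; omega),
    List.getD_append _ _ _ _ (by rw [length_flat]; omega)]
  exact getD_flat l p

theorem blockLayers_eq (bs : List (ℕ × ℕ)) (i : ℕ) : blockLayers i bs =
    (List.range bs.length).flatMap fun k =>
      List.replicate (bs.getD k (0, 0)).2 ((bs.getD k (0, 0)).1, i + k) := by
  induction bs generalizing i with
  | nil => rfl
  | cons b bs ih =>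
    obtain ⟨m, k⟩ := b
    rw [blockLayers, ih, List.length_cons, List.range_succ_eq_map, List.flatMap_cons,
      List.flatMap_map]
    simp [Nat.add_comm, Nat.add_left_comm]

theorem blockOwners_eq (bs : List (ℕ × ℕ)) (i : ℕ) : blockOwners i bs =
    (List.range bs.length).flatMap fun k =>
      List.replicate (bs.getD k (0, 0)).2 (decide (Even (i + k))) := by
  induction bs generalizing i with
  | nil => rfl
  | cons b bs ih =>
    obtain ⟨m, k⟩ := b
    rw [blockOwners, ih, List.length_cons, List.range_succ_eq_map, List.flatMap_cons,
      List.flatMap_map]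
    simp [Nat.add_comm, Nat.add_left_comm]

/-- A loop that appends the same list in every pass. -/
theorem flatMap_range_const {α β : Type} (n : ℕ) (a : α) (f : α → List β) :
    (List.range n).flatMap (fun _ => f a) = (List.replicate n a).flatMap f := by
  induction n with
  | zero => rfl
  | succ n ih => rw [List.range_succ, List.replicate_succ', List.flatMap_append,
      List.flatMap_append, ih]; rfl

section Instance

variable {t : ℕ} (I : QBF t)

theorem words_block {i : ℕ} (hi : i < I.blocks.length) :
    I.words.getD (i + i + 1) 0 = (I.blocks.getD i (0, 0)).1 ∧
      I.words.getD (i + i + 2) 0 = (I.blocks.getD i (0, 0)).2 := by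
  have h := getD_flat_append hi (Levels.words t I.formula)
  exact h

theorem block_le_size (i : ℕ) :
    (I.blocks.getD i (0, 0)).1 ≤ I.size ∧ (I.blocks.getD i (0, 0)).2 ≤ I.size := by
  rcases lt_or_ge i I.blocks.length with hi | hi
  · rw [List.getD_eq_getElem _ _ hi]
    have h1 := List.le_sum_of_mem (List.mem_map_of_mem (f := Prod.fst) (List.getElem_mem hi))
    have h2 := List.le_sum_of_mem (List.mem_map_of_mem (f := Prod.snd) (List.getElem_mem hi))
    have := I.size_eq
    omega
  · rw [List.getD_eq_default _ _ hi]; simp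

/-- Computes the layers in the array `4`. -/
def layersCmd : Cmd :=
  .seq (pushAll 4 [.c 1, .r 22])
    (.loop 12 (.r 22) (.loop 0 (.get 2 (.add (.add (.r 12) (.r 12)) (.c 2)))
      (pushAll 4 [.get 2 (.add (.add (.r 12) (.r 12)) (.c 1)), .r 12])))

theorem does_layersCmd {N : ℕ} {v : Store} (h2 : v.arr 2 = I.words)
    (h22 : v.reg 22 = I.blocks.length) (hN : I.size ≤ N) :
    Does N layersCmd v (v.app 4 (flat I.layers)) := by
  have e : flat I.layers = [1, I.blocks.length] ++ (List.range I.blocks.length).flatMap fun k =>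
      (List.range (I.blocks.getD k (0, 0)).2).flatMap fun _ => [(I.blocks.getD k (0, 0)).1, k] := by
    rw [QBF.layers, flat_cons, blockLayers_eq, flat_flatMap]
    simp only [List.cons_append, List.nil_append, Nat.zero_add]
    congr 2
    refine List.flatMap_congr fun k _ => ?_
    exact (flatMap_range_const _ _ fun x : ℕ × ℕ => [x.1, x.2]).symm
  have hr : I.blocks.length ≤ I.size := by have := I.size_eq; omega
  rw [e]
  refine Does.seq_app (Does.pushAll (by simp [Ex.Avoids]) (by simp [Ex.ev, h22])) ?_
  refine Does.loop_app _ (by simp [Ex.ev, h22]) (hr.trans hN) fun k hk u hu => ?_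
  obtain ⟨w1, w2⟩ := words_block I hk
  have u2 : u.arr 2 = I.words := by rw [hu]; simp [h2]
  have u12 : u.reg 12 = k := by rw [hu]; simp
  refine Does.loop_app _ (by simp only [Ex.ev, u2, u12, w2]) ((block_le_size I k).2.trans hN)
    fun j _ w hw => ?_
  have x2 : w.arr 2 = I.words := by rw [hw]; simp [u2]
  have x12 : w.reg 12 = k := by rw [hw]; simp [u12]
  exact Does.pushAll (by simp [Ex.Avoids]) (by simp only [List.map, Ex.ev, x2, x12, w1])

end Instance

/-- A number that is zero exactly if the two expressions have the same value. -/
def Ex.neq (e e' : Ex) : Ex := .add (.sub e e') (.sub e' e)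

theorem Ex.ev_neq (e e' : Ex) (v : Store) : (e.neq e').ev v ≠ 0 ↔ e.ev v ≠ e'.ev v := by
  simp only [neq, ev]; omega

/-- Computes the edges between the layers. -/
def linksCmd : Cmd :=
  .loop 10 (.sub (.half (.len 4)) (.c 1)) <| .loc 14 (.c 0) <|
    .seq (addMul 14 2 (.add (.r 10) (.c 1))) <|
    .loop 11 (.get 4 (.add (.r 10) (.r 10))) <|
    .loop 12 (.get 4 (.add (.add (.r 10) (.r 10)) (.c 2))) <|
    .ite (.add (.neq (.get 4 (.add (.add (.r 10) (.r 10)) (.c 1)))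
        (.get 4 (.add (.add (.r 10) (.r 10)) (.c 3)))) (.sub (.r 12) (.r 11)))
      (pushAll 3 [.add (.r 14) (.r 11), .add (.add (.r 14) (.r 2)) (.r 12)]) .skip

theorem does_linksCmd {N Z : ℕ} {Ly : List (ℕ × ℕ)} {v : Store} (h2 : v.reg 2 = Z)
    (h4 : v.arr 4 = flat Ly) (hN : Ly.length ≤ N) (hw : ∀ p, width Ly p ≤ N) :
    Does N linksCmd v (v.app 3 (flat ((List.range (Ly.length - 1)).flatMap fun p =>
      (List.range (width Ly p)).flatMap fun x => (List.range (width Ly (p + 1))).flatMap fun y =>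
      if block Ly p = block Ly (p + 1) ∧ y ≤ x then []
        else [((p + 1) * Z + x, (p + 2) * Z + y)]))) := by
  rw [flat_flatMap]
  refine Does.loop_app _ (by simp [Ex.ev, h4]) (by omega) fun p hp u hu => ?_
  have u4 : u.arr 4 = flat Ly := by rw [hu]; simp [h4]
  have u2 : u.reg 2 = Z := by rw [hu]; simp [h2]
  have u10 : u.reg 10 = p := by rw [hu]; simp
  have g := getD_flat Ly p
  have g' := getD_flat Ly (p + 1)
  rw [show p + 1 + (p + 1) = p + p + 2 by ring] at g'
  refine Does.loc_seq_app rfl (Does.addMul_zero (n := p + 1) (x := (p + 1) * Z) (by norm_num)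
    (by norm_num) (by norm_num) (by simp [Ex.ev, u10]) (by omega) (by rw [u2])) ?_
  rw [flat_flatMap]
  refine Does.loop_app _ (by simp only [Ex.ev, Store.set_arr, Store.set_reg, u4, u10]; exact g.1)
    (hw p) fun x hx w hw' => ?_
  rw [flat_flatMap]
  have w4 : w.arr 4 = flat Ly := by rw [hw']; simp [u4]
  have w10 : w.reg 10 = p := by rw [hw']; simp [u10]
  refine Does.loop_app _ (by simp only [Ex.ev, w4, w10]; exact g'.1) (hw (p + 1))
    fun y hy z hz => ?_
  have z4 : z.arr 4 = flat Ly := by rw [hz]; simp [w4]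
  have z10 : z.reg 10 = p := by rw [hz]; simp [w10]
  have z2 : z.reg 2 = Z := by rw [hz, hw']; simp [u2]
  have z11 : z.reg 11 = x := by rw [hz, hw']; simp
  have z12 : z.reg 12 = y := by rw [hz]; simp
  have z14 : z.reg 14 = (p + 1) * Z := by rw [hz, hw']; simp
  have hb : Ex.ev z (.neq (.get 4 (.add (.add (.r 10) (.r 10)) (.c 1)))
      (.get 4 (.add (.add (.r 10) (.r 10)) (.c 3)))) ≠ 0 ↔ block Ly p ≠ block Ly (p + 1) := by
    rw [Ex.ev_neq]
    simp only [Ex.ev, z4, z10, g.2]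
    rw [show p + p + 3 = p + p + 2 + 1 by ring, g'.2]
    rfl
  refine Does.ite (fun h => ?_) fun h => ?_
  · have hc : ¬ (block Ly p = block Ly (p + 1) ∧ y ≤ x) := by
      simp only [Ex.ev, z11, z12] at h hb
      by_cases hne : block Ly p = block Ly (p + 1) <;> simp only [hne, ne_eq, not_true_eq_false, iff_false, not_not] at hb <;> omega
    rw [if_neg hc]
    refine Does.pushAll (by simp [Ex.Avoids]) ?_
    simp [Ex.ev, z14, z11, z2, z12]
    ring
  · have hc : block Ly p = block Ly (p + 1) ∧ y ≤ x := by
      simp only [Ex.ev, z11, z12] at h hb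
      by_cases hne : block Ly p = block Ly (p + 1)
      · exact ⟨hne, by omega⟩
      · exact absurd (hb.2 hne) (by omega)
    rw [if_pos hc]
    simpa using Does.skip

/-- Computes the edges from the last layer to the formula. -/
def lastCmd : Cmd :=
  .loc 14 (.c 0) <| .seq (addMul 14 2 (.half (.len 4))) <|
    .loop 11 (.get 4 (.sub (.len 4) (.c 2)))
      (pushAll 3 [.add (.r 14) (.r 11), .add (.add (.r 22) (.r 22)) (.c 1)])

theorem does_lastCmd {N Z r : ℕ} {Ly : List (ℕ × ℕ)} {v : Store} (h2 : v.reg 2 = Z)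
    (h22 : v.reg 22 = r) (h4 : v.arr 4 = flat Ly) (hLy : 0 < Ly.length) (hN : Ly.length ≤ N)
    (hw : ∀ p, width Ly p ≤ N) :
    Does N lastCmd v (v.app 3 (flat ((List.range (width Ly (Ly.length - 1))).map fun x =>
      ((Ly.length - 1 + 1) * Z + x, 1 + 2 * r)))) := by
  refine Does.loc_seq_app rfl (Does.addMul_zero (n := Ly.length) (x := Ly.length * Z) (by norm_num)
    (by norm_num) (by norm_num) (by simp [Ex.ev, h4]) hN (by rw [h2])) ?_
  rw [flat_map]
  have g := (getD_flat Ly (Ly.length - 1)).1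
  rw [show Ly.length - 1 + (Ly.length - 1) = 2 * Ly.length - 2 by omega] at g
  refine Does.loop_app _ (by simp only [Ex.ev, Store.set_arr, h4, length_flat]; exact g)
    (hw _) fun x hx u hu => ?_
  refine Does.pushAll (by simp [Ex.Avoids]) ?_
  simp [Ex.ev, hu, h22]
  rw [Nat.sub_add_cancel hLy]
  omega

/-- Computes the edges that start in the formula that is read from the array `2` at the place
given by register `3`, and moves on to the end of the formula.  Register `100 + t` keeps the place
of the formula with `t + 1` levels that is being read. -/
def formCmd : ℕ → Cmd
  | 0 => .seq (.loop 10 (.half (.len 4)) (.ite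
        (.neq (.get 4 (.add (.add (.r 10) (.r 10)) (.c 1))) (.get 2 (.r 3))) .skip
        (.loc 14 (.c 0) (.seq (addMul 14 2 (.add (.r 10) (.c 1)))
          (pushAll 3 [.r 3, .add (.r 14) (.get 2 (.add (.r 3) (.c 1)))]))))) <|
      .seq (.ite (.get 2 (.add (.r 3) (.c 2))) .skip (pushAll 3 [.r 3, .r 3]))
        (.set 3 (.add (.r 3) (.c 3)))
  | t + 1 => .loc (100 + t) (.r 3) (.seq (.set 3 (.add (.r 3) (.c 1)))
      (.loop 0 (.get 2 (.r (100 + t))) (.seq (pushAll 3 [.r (100 + t), .r 3]) (formCmd t))))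

theorem childPos_append (t : ℕ) (F F' : List (Levels t)) (c : ℕ) : childPos t c (F ++ F') =
    childPos t c F ++ childPos t (c + (F.flatMap (Levels.words t)).length) F' := by
  induction F generalizing c with
  | nil => simp [childPos]
  | cons H F ih => simp [childPos, ih, Nat.add_assoc]

theorem does_formCmd {N Z : ℕ} {Ly : List (ℕ × ℕ)} (hN : Ly.length ≤ N) :
    ∀ (t : ℕ) (F : Levels t) (v : Store) (pre post : List ℕ),
    v.reg 2 = Z → v.arr 4 = flat Ly → v.arr 2 = pre ++ Levels.words t F ++ post →
    v.reg 3 = pre.length → (Levels.words t F).length ≤ N →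
    Does N (formCmd t) v ((v.app 3 (flat (formEdges Z Ly t pre.length F))).set 3
      (pre.length + (Levels.words t F).length))
  | 0, ((i, j), b), v, pre, post, h2, h4, hW, h3, hF => by
    have g0 : (v.arr 2).getD pre.length 0 = i := by
      rw [hW]; simp [Levels.words, List.getD]
    have g1 : (v.arr 2).getD (pre.length + 1) 0 = j := by
      rw [hW]; simp [Levels.words, List.getD]
    have g2 : (v.arr 2).getD (pre.length + 2) 0 = b.toNat := by
      rw [hW]; simp [Levels.words, List.getD]
    have e : flat (formEdges Z Ly 0 pre.length ((i, j), b)) =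
        ((List.range Ly.length).flatMap fun p =>
          flat (if block Ly p = i then [(pre.length, (p + 1) * Z + j)] else [])) ++
        flat (if b then [] else [(pre.length, pre.length)]) := by
      rw [← flat_flatMap, ← flat_append]; rfl
    rw [e, ← Store.app_app]
    refine Does.seq (u := v.app 3 ((List.range Ly.length).flatMap fun p =>
      flat (if block Ly p = i then [(pre.length, (p + 1) * Z + j)] else [])))
      (Does.loop_app _ (by simp [Ex.ev, h4]) hN fun p hp u hu => ?_) ?_
    · have u4 : u.arr 4 = flat Ly := by rw [hu]; simp [h4]
      have u2 : u.arr 2 = v.arr 2 := by rw [hu]; simp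
      have u3 : u.reg 3 = pre.length := by rw [hu]; simp [h3]
      have r2 : u.reg 2 = Z := by rw [hu]; simp [h2]
      have u10 : u.reg 10 = p := by rw [hu]; simp
      have hev : Ex.ev u (.neq (.get 4 (.add (.add (.r 10) (.r 10)) (.c 1))) (.get 2 (.r 3))) ≠ 0 ↔
          block Ly p ≠ i := by
        rw [Ex.ev_neq]
        simp only [Ex.ev, u4, u2, u3, u10, g0, (getD_flat Ly p).2]
        rfl
      refine Does.ite (fun h => ?_) fun h => ?_
      · rw [if_neg (hev.1 h)]; simpa using Does.skip
      · rw [if_pos (by by_contra h'; exact hev.2 h' h)]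
        refine Does.loc_seq_app rfl (Does.addMul_zero (n := p + 1) (x := (p + 1) * Z) (by norm_num)
          (by norm_num) (by norm_num) (by simp [Ex.ev, u10]) (by omega) (by rw [r2]))
          (Does.pushAll (by simp [Ex.Avoids]) ?_)
        simp [Ex.ev, u3, u2]
        simpa using g1
    · refine Does.seq (u := (v.app 3 ((List.range Ly.length).flatMap fun p =>
          flat (if block Ly p = i then [(pre.length, (p + 1) * Z + j)] else []))).app 3
          (flat (if b then [] else [(pre.length, pre.length)]))) ?_ (Does.set ?_)
      · have hev : ∀ l, Ex.ev (v.app 3 l) (.get 2 (.add (.r 3) (.c 2))) = b.toNat := fun l => by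
          simp only [Ex.ev, Store.app_reg, Store.app_arr, h3]
          simpa using g2
        refine Does.ite (fun h => ?_) fun h => ?_ <;> rw [hev] at h
        · cases b <;> simp at h
          simpa using Does.skip
        · cases b <;> simp at h
          exact Does.pushAll (by simp [Ex.Avoids]) (by simp [Ex.ev, h3])
      · simp [Ex.ev, h3, Levels.words]
  | t + 1, (F : List (Levels t)), v, pre, post, h2, h4, hW, h3, hF => by
    have hlen : (Levels.words (t + 1) F).length =
        (List.flatMap (Levels.words t) F).length + 1 := by simp [Levels.words]
    rw [hlen] at hF
    have g0 : (v.arr 2).getD pre.length 0 = List.length F := by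
      rw [hW]; simp [Levels.words, List.getD]
    -- The store after the treatment of `k` subformulas.
    let g : ℕ → Store := fun k => ((v.set (100 + t) pre.length).app 3
      (flat ((childPos t (pre.length + 1) (List.take k F)).flatMap fun x =>
        (pre.length, x.1) :: formEdges Z Ly t x.1 x.2))).set 3
        (pre.length + 1 + (List.flatMap (Levels.words t) (List.take k F)).length)
    have hFN : List.length F ≤ N := by
      have : List.length F ≤ (List.flatMap (Levels.words t) F).length := by
        rw [List.length_flatMap]
        calc List.length F = (List.map (fun _ => 1) F).sum := by simp
          _ ≤ _ := List.sum_le_sum fun H _ => length_words_pos t H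
      omega
    have h100 : (3 : ℕ) ≠ 100 + t := by omega
    have main : Does N (.loop 0 (.get 2 (.r (100 + t))) (.seq (pushAll 3 [.r (100 + t), .r 3])
        (formCmd t))) ((v.set (100 + t) pre.length).set 3 (pre.length + 1)) (g (List.length F)) := by
      refine Does.loop g ?_ hFN ?_ fun k hk => ?_
      · simp only [Ex.ev, Store.set_arr, Store.set_reg, if_neg h100.symm, if_true, g0]
      · simp [g, childPos]
      · set cur := pre.length + 1 + (List.flatMap (Levels.words t) (List.take k F)).length with hcur
        have hsplit : List.flatMap (Levels.words t) F =
            List.flatMap (Levels.words t) (List.take k F) ++ Levels.words t F[k] ++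
              List.flatMap (Levels.words t) (List.drop (k + 1) F) := by
          conv_lhs => rw [← List.take_append_drop k F, List.drop_eq_getElem_cons hk]
          rw [List.flatMap_append, List.flatMap_cons, List.append_assoc]
        have htake : List.take (k + 1) F = List.take k F ++ [F[k]] := by simp
        have hle : (Levels.words t F[k]).length ≤ N := by
          have := congrArg List.length hsplit
          simp only [List.length_append] at this
          omega
        have hform := does_formCmd (Z := Z) hN t F[k]
          (((g k).set 0 k).app 3 [pre.length, cur])
          (pre ++ List.length F :: List.flatMap (Levels.words t) (List.take k F))
          (List.flatMap (Levels.words t) (List.drop (k + 1) F) ++ post) (by simp [g, h2]; omega)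
          (by simp [g, h4])
          (by simp only [g, Store.app_arr, Store.set_arr, hW, Levels.words, hsplit]; simp)
          (by simp [g, hcur]; omega) hle
        refine ⟨_, Does.seq (Does.pushAll (by simp [Ex.Avoids]) ?_) hform, ?_⟩
        · simp [g, Ex.ev, h100.symm, hcur]
        · have hc2 : (pre ++ List.length F ::
              List.flatMap (Levels.words t) (List.take k F)).length = cur := by
            simp [hcur]; omega
          rw [hc2]
          simp only [g, htake, childPos_append, childPos, List.flatMap_append, List.flatMap_cons,
            List.flatMap_nil, List.append_nil, ← hcur, flat_append, flat_cons, List.length_append]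
          refine Store.ext (funext fun a => ?_) (funext fun b => ?_)
          · simp only [Store.set_reg, Store.app_reg]
            split_ifs <;> first | omega | rfl | contradiction | (subst_vars; first | contradiction | rfl)
          · simp
    refine Does.congr (Does.loc (x := pre.length) h3 (Does.seq (Does.set ?_) main)) (fun a => ?_)
      fun b => ?_
    · simp [Ex.ev, h100, h3]
    · simp only [g, List.take_length, hlen]
      simp
      grind
    · simp only [g, List.take_length, formEdges]
      simp

end LoopLang

/-! ### Computing the tree -/

namespace LoopLang

open ParamComplexity

/-- Computes the edges of the game for a formula with `t` levels. -/
def edgesCmd (t : ℕ) : Cmd :=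
  .seq (pushAll 3 [.c 0, .c 0]) <| .seq linksCmd <| .seq lastCmd <|
    .seq (.set 3 (.add (.add (.r 22) (.r 22)) (.c 1))) (formCmd t)

theorem does_edgesCmd {N t : ℕ} (I : QBF t) {v : Store} (hW : v.arr 2 = I.words)
    (h4 : v.arr 4 = flat I.layers) (h2 : v.reg 2 = I.size + 1)
    (h22 : v.reg 22 = I.blocks.length) (hN : I.size + 1 ≤ N) :
    ∃ x, Does N (edgesCmd t) v ((v.app 3 (flat I.edges)).set 3 x) := by
  have hl := I.length_layers_le
  have hwd : ∀ p, width I.layers p ≤ N := fun p => (I.width_lt p).le.trans hN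
  have hF := I.root_add_le
  set l1 := flat ((List.range (I.layers.length - 1)).flatMap fun p =>
      (List.range (width I.layers p)).flatMap fun x =>
      (List.range (width I.layers (p + 1))).flatMap fun y =>
      if block I.layers p = block I.layers (p + 1) ∧ y ≤ x then []
        else [((p + 1) * (I.size + 1) + x, (p + 2) * (I.size + 1) + y)]) with hl1
  set l2 := flat ((List.range (width I.layers (I.layers.length - 1))).map fun x =>
      ((I.layers.length - 1 + 1) * (I.size + 1) + x, 1 + 2 * I.blocks.length)) with hl2
  have e : flat I.edges = [0, 0] ++ (l1 ++ (l2 ++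
      flat (formEdges (I.size + 1) I.layers t I.root I.formula))) := by
    simp only [QBF.edges, gameEdges, layerEdges, flat_cons, flat_append, hl1, hl2]
    simp [QBF.root]
  have d1 : Does N (pushAll 3 [.c 0, .c 0]) v (v.app 3 [0, 0]) :=
    Does.pushAll (by simp [Ex.Avoids]) rfl
  have d2 : Does N linksCmd (v.app 3 [0, 0]) ((v.app 3 [0, 0]).app 3 l1) :=
    does_linksCmd (by simpa using h2) (by simpa using h4) (by omega) hwd
  have d3 : Does N lastCmd ((v.app 3 [0, 0]).app 3 l1) (((v.app 3 [0, 0]).app 3 l1).app 3 l2) :=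
    does_lastCmd (by simpa using h2) (by simpa using h22) (by simpa using h4)
      (by rw [I.length_layers]; omega) (by omega) hwd
  have hroot : (I.blocks.length :: flat I.blocks).length = I.root := by simp [QBF.root]; omega
  have d4 := does_formCmd (N := N) (Z := I.size + 1) (Ly := I.layers) (by omega) t I.formula
    ((((v.app 3 [0, 0]).app 3 l1).app 3 l2).set 3 I.root) (I.blocks.length :: flat I.blocks) []
    (by simp [h2]) (by simp [h4]) (by simp [hW, QBF.words, flat]) (by rw [hroot]; simp) (by omega)
  rw [hroot] at d4
  refine ⟨I.root + (Levels.words t I.formula).length, Does.congr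
    (d1.seq <| d2.seq <| d3.seq <| (Does.set ?_).seq d4) (fun a => ?_) fun b => ?_⟩
  · simp [Ex.ev, h22, QBF.root]; omega
  · simp
  · simp only [Store.set_app, Store.app_app, Store.set_arr, e, List.append_assoc]

section Tree

open TreeData Lab

variable (D : TreeData) {N : ℕ}

/-- The store holds what is needed for the construction of the tree. -/
structure Ready (N : ℕ) (v : Store) : Prop where
  s : v.reg 5 = D.s
  start : v.reg 2 = D.start
  pow : v.arr 6 = (List.range (4 * D.s + 3)).map (D.M ^ ·)
  edges : v.arr 3 = flat D.edges
  s_le : 2 * D.s ≤ N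
  M_pos : 0 < D.M
  M_le : D.M ^ (4 * D.s) ≤ N
  edges_le : D.edges.length ≤ N

variable {D} {v : Store} {pre post : List Lab}

theorem Ready.of_agree {u : Store} (h : Ready D N v) (h2 : u.reg 2 = v.reg 2)
    (h5 : u.reg 5 = v.reg 5) (h3 : u.arr 3 = v.arr 3) (h6 : u.arr 6 = v.arr 6) : Ready D N u :=
  ⟨h5.trans h.s, h2.trans h.start, h6.trans h.pow, h3.trans h.edges, h.s_le, h.M_pos, h.M_le,
    h.edges_le⟩

theorem Ready.get_pow (h : Ready D N v) {k : ℕ} (hk : k ≤ 4 * D.s) :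
    (v.arr 6).getD k 0 = D.M ^ k ∧ D.M ^ k ≤ N := by
  constructor
  · rw [h.pow, List.getD_eq_getElem _ _ (by simp; omega)]; simp
  · exact (Nat.pow_le_pow_right h.M_pos hk).trans h.M_le

/-- The command appends the numbers of the parents of the vertices in `seg`. -/
def Grows (D : TreeData) (N : ℕ) (P : Cmd) (v : Store) (seg : List Lab) : Prop :=
  Does N P v (v.app 5 (seg.map D.up))

/-- The next vertices to be created are those in `seg`. -/
def Next (D : TreeData) (v : Store) (seg : List Lab) : Prop :=
  ∃ pre post, D.labs = pre ++ seg ++ post ∧ (v.arr 5).length = pre.length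

theorem Next.place {x : Lab} {seg : List Lab} (h : Next D v (x :: seg)) :
    D.place x = (v.arr 5).length := by
  obtain ⟨pre, post, h1, h2⟩ := h
  rw [h2]
  exact place_eq (post := seg ++ post) (by rw [h1]; simp)

theorem Next.left {seg seg' : List Lab} (h : Next D v (seg ++ seg')) : Next D v seg := by
  obtain ⟨pre, post, h1, h2⟩ := h
  exact ⟨pre, seg' ++ post, by rw [h1]; simp, h2⟩

theorem Next.right {seg seg' : List Lab} (h : Next D v (seg ++ seg')) {u : Store}
    (hu : (u.arr 5).length = (v.arr 5).length + seg.length) : Next D u seg' := by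
  obtain ⟨pre, post, h1, h2⟩ := h
  exact ⟨pre ++ seg, post, by rw [h1]; simp, by rw [hu, h2]; simp⟩

theorem Next.congr {seg : List Lab} (h : Next D v seg) {u : Store} (hu : u.arr 5 = v.arr 5) :
    Next D u seg := by
  obtain ⟨pre, post, h1, h2⟩ := h
  exact ⟨pre, post, h1, by rw [hu, h2]⟩

theorem Grows.seq {P Q : Cmd} {seg seg' : List Lab} (h : Grows D N P v seg)
    (h' : Grows D N Q (v.app 5 (seg.map D.up)) seg') : Grows D N (.seq P Q) v (seg ++ seg') := by
  rw [Grows, List.map_append]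
  exact Does.seq_app h h'

theorem Grows.push {e : Ex} {x : Lab} (h : e.ev v = D.up x) : Grows D N (.push 5 e) v [x] :=
  Does.push h

theorem Grows.loc {P : Cmd} {i x : ℕ} {e : Ex} {seg : List Lab} (he : e.ev v = x)
    (h : Grows D N P (v.set i x) seg) : Grows D N (.loc i e P) v seg :=
  Does.loc_app he h

theorem Grows.loop {P : Cmd} {i n : ℕ} {e : Ex} {seg : ℕ → List Lab} (he : e.ev v = n) (hn : n ≤ N)
    (hv : Next D v ((List.range n).flatMap seg))
    (h : ∀ k < n, ∀ u : Store, (∀ a, u.reg a = if a = i then k else v.reg a) →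
      (∀ b, b ≠ 5 → u.arr b = v.arr b) → Next D u (seg k) → Grows D N P u (seg k)) :
    Grows D N (.loop i e P) v ((List.range n).flatMap seg) := by
  rw [Grows, List.map_flatMap]
  refine Does.loop_app _ he hn fun k hk u hu => h k hk u ?_ ?_ ?_
  · intro a; rw [hu]; simp
  · intro b hb; rw [hu]; simp [hb]
  · have hsplit : (List.range n).flatMap seg = (List.range k).flatMap seg ++
        (seg k ++ ((List.range n).drop (k + 1)).flatMap seg) := by
      conv_lhs => rw [← List.take_append_drop k (List.range n), List.take_range,
        List.drop_eq_getElem_cons (by simpa using hk), List.flatMap_append, List.flatMap_cons]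
      simp [Nat.min_eq_left hk.le]
    rw [hsplit] at hv
    refine (hv.right (u := u) ?_).left
    rw [hu]
    simp [List.length_flatMap]

/-- A loop that creates the leaves below a vertex. -/
theorem Grows.leaves {n : ℕ} {e e' : Ex} {f : ℕ → Lab} {x : ℕ} (he : e.ev v = n) (hn : n ≤ N)
    (hx : ∀ k, D.up (f k) = x) (he' : ∀ l k, e'.ev ((v.app 5 l).set 0 k) = x) :
    Grows D N (.loop 0 e (.push 5 e')) v ((List.range n).map f) := by
  rw [Grows, List.map_map, show D.up ∘ f = fun _ => x from funext hx]
  have := Does.loop_app (N := N) (b := 5) (P := .push 5 e') (i := 0) (v := v) (fun _ => [x]) he hn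
    fun k _ u hu => Does.push (by rw [hu]; exact he' _ _)
  rwa [← List.map_eq_flatMap] at this

/-- Creates the vertices for one binary digit. -/
def bitCmd : Cmd :=
  .loc 21 (.r 19) <| .seq (.seq (.loop 0 (.r 12) (.loop 0 (.r 5) (.set 21 (.half (.r 21)))))
    (.loop 0 (.r 13) (.set 21 (.half (.r 21))))) <|
  .loc 18 (.len 5) <| .seq (.push 5 (.r 17)) <| .seq (.push 5 (.r 18)) <|
  .seq (.loop 0 (.get 6 (.add (.add (.add (.r 13) (.r 13)) (.add (.r 13) (.r 13)))
      (.add (.add (.sub (.r 21) (.add (.half (.r 21)) (.half (.r 21))))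
        (.sub (.r 21) (.add (.half (.r 21)) (.half (.r 21))))) (.c 2))))
    (.push 5 (.add (.r 18) (.c 1))))
  (.loop 0 (.get 6 (.add (.add (.r 12) (.r 12)) (.c 2))) (.push 5 (.r 18)))

theorem Does.halve {n : ℕ} {e : Ex} (he : e.ev v = n) (hn : n ≤ N) :
    Does N (.loop 0 e (.set 21 (.half (.r 21)))) v (v.set 21 (v.reg 21 / 2 ^ n)) := by
  refine Does.loop (fun k => v.set 21 (v.reg 21 / 2 ^ k)) he hn (by simp) fun k hk =>
    ⟨_, Does.set rfl, ?_⟩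
  refine Store.ext (funext fun a => ?_) rfl
  simp only [Store.set_reg, Ex.ev]
  split_ifs <;> first
    | omega | contradiction | (rw [pow_succ, ← Nat.div_div_eq_div_mul])
    | (subst_vars; first | contradiction | rfl)

theorem Does.halve_mul {i j x : ℕ} (hi : v.reg 12 = i) (hj : v.reg 13 = j) (hs : v.reg 5 = D.s)
    (hx : v.reg 21 = x) (hiN : i ≤ N) (hjN : j ≤ N) (hsN : D.s ≤ N) :
    Does N (.seq (.loop 0 (.r 12) (.loop 0 (.r 5) (.set 21 (.half (.r 21)))))
      (.loop 0 (.r 13) (.set 21 (.half (.r 21))))) v (v.set 21 (x / 2 ^ (i * D.s + j))) := by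
  have h1 : Does N (.loop 0 (.r 12) (.loop 0 (.r 5) (.set 21 (.half (.r 21))))) v
      (v.set 21 (x / 2 ^ (i * D.s))) := by
    refine Does.loop (fun k => v.set 21 (x / 2 ^ (k * D.s))) hi hiN
      (by simp [Store.set_of_eq, hx]) fun k hk => ⟨_, Does.halve (n := D.s) ?_ hsN, ?_⟩
    · simp [Ex.ev, hs]
    · refine Store.ext (funext fun a => ?_) rfl
      simp only [Store.set_reg, if_true, Nat.reduceEqDiff, if_false]
      rw [Nat.div_div_eq_div_mul, ← pow_add, ← Nat.succ_mul]
      split_ifs <;> first | rfl | (subst_vars; first | contradiction | rfl)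
  refine (h1.seq (Does.halve (n := j) (by simp [Ex.ev, hj]) hjN)).congr (fun a => ?_) fun b => rfl
  simp only [Store.set_set, Store.set_reg, if_true]
  rw [Nat.div_div_eq_div_mul, ← pow_add]

theorem grows_bitCmd (hv : Ready D N v) {h : Host} {i j : ℕ} (hi : i < D.s) (hj : j < D.s)
    (h12 : v.reg 12 = i) (h13 : v.reg 13 = j) (h19 : v.reg 19 = D.num h)
    (h17 : v.reg 17 = D.up (a1 h i j)) (hnext : Next D v (D.bitLabs h i j)) :
    Grows D N bitCmd v (D.bitLabs h i j) := by
  have hs := hv.s_le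
  have hp1 : D.place (a1 h i j) = (v.arr 5).length := Next.place hnext
  have hp2 : D.place (a2 h i j) = (v.arr 5).length + 1 := by
    have := Next.place (Next.right (seg := [a1 h i j]) (u := v.app 5 [0]) hnext (by simp))
    simpa using this
  set y := D.num h / 2 ^ (i * D.s + j) with hy
  have hd := Does.halve_mul (N := N) (D := D) (v := v.set 21 (D.num h)) (x := D.num h)
    (by simpa using h12) (by simpa using h13) (by simpa using hv.s) (by simp) (by omega) (by omega)
    (by omega)
  rw [Store.set_set, ← hy] at hd
  refine Does.loc_seq_app h19 hd ?_
  have hc : j + j + (j + j) + (y - (y / 2 + y / 2) + (y - (y / 2 + y / 2)) + 2) =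
      2 * D.code h i j := by rw [TreeData.code, ← hy]; omega
  have hc4 : 2 * D.code h i j ≤ 4 * D.s := by rw [TreeData.code]; omega
  refine Grows.loc (D := D) rfl ?_
  obtain ⟨g1, g2⟩ := hv.get_pow hc4
  obtain ⟨g3, g4⟩ := hv.get_pow (k := 2 * (i + 1)) (by omega)
  rw [bitLabs, List.append_assoc, show ([a1 h i j, a2 h i j] : List Lab) = [a1 h i j] ++ [a2 h i j]
    from rfl, List.append_assoc]
  refine Grows.seq (Grows.push ?_) (Grows.seq (Grows.push ?_) (Grows.seq
    (Grows.leaves (x := D.place (a2 h i j)) ?_ g2 (fun k => rfl) fun l k => ?_)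
    (Grows.leaves (x := D.place (a1 h i j)) ?_ g4 (fun k => rfl) fun l k => ?_)))
  · simp [Ex.ev, h17]
  · simp [Ex.ev, TreeData.up, par, hp1]
  · simp only [Ex.ev, Store.app_reg, Store.set_reg, Store.app_arr, Store.set_arr, if_true,
      Nat.reduceEqDiff, if_false, h13, hc]
    simpa using g1
  · simp [Ex.ev, hp2]
  · simp only [Ex.ev, Store.app_reg, Store.set_reg, Store.app_arr, Store.set_arr, if_true,
      Nat.reduceEqDiff, if_false, h12, show i + i + 2 = 2 * (i + 1) by ring]
    simpa using g3
  · simp [Ex.ev, hp1]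

/-- Creates the vertices that encode the number at the source of an edge. -/
def srcCmd : Cmd := .loop 12 (.r 5) (.loop 13 (.r 5) (.loc 17 (.r 16) bitCmd))

/-- Creates the vertices that encode the number at another host. -/
def dstCmd : Cmd :=
  .loop 12 (.r 5) (.loop 13 (.r 5) (.loc 17 (.len 5) (.seq (.push 5 (.r 16)) bitCmd)))

theorem grows_srcCmd (hv : Ready D N v) {e : ℕ} (h19 : v.reg 19 = D.num (.src e))
    (h16 : v.reg 16 = D.place (rc e)) (hnext : Next D v (D.srcLabs (.src e))) :
    Grows D N srcCmd v (D.srcLabs (.src e)) := by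
  have hs := hv.s_le
  refine Grows.loop hv.s (by omega) hnext fun i hi u hu1 hu2 hu3 => ?_
  refine Grows.loop (by simp [Ex.ev, hu1, hv.s]) (by omega) hu3 fun j hj w hw1 hw2 hw3 => ?_
  refine Grows.loc rfl (grows_bitCmd ?_ hi hj ?_ ?_ ?_ ?_ ?_)
  · refine hv.of_agree ?_ ?_ ?_ ?_ <;> simp [hw1, hw2, hu1, hu2]
  · simp [hw1, hu1]
  · simp [hw1]
  · simp [hw1, hu1, h19]
  · simp [Ex.ev, hw1, hu1, h16, TreeData.up, par]
  · exact hw3.congr rfl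

theorem grows_dstCmd (hv : Ready D N v) {h : Host} (hh : ∀ e, h ≠ .src e) {x : Lab}
    (hx : ∀ i j, par (sp h i j) = x) (h19 : v.reg 19 = D.num h)
    (h16 : v.reg 16 = D.place x) (hnext : Next D v (D.dstLabs h)) :
    Grows D N dstCmd v (D.dstLabs h) := by
  have hs := hv.s_le
  refine Grows.loop hv.s (by omega) hnext fun i hi u hu1 hu2 hu3 => ?_
  refine Grows.loop (by simp [Ex.ev, hu1, hv.s]) (by omega) hu3 fun j hj w hw1 hw2 hw3 => ?_
  refine Grows.loc rfl (Grows.seq (seg := [sp h i j]) (Grows.push ?_)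
    (grows_bitCmd ?_ hi hj ?_ ?_ ?_ ?_ ?_))
  · simp [Ex.ev, hw1, hu1, h16, TreeData.up, hx]
  · refine hv.of_agree ?_ ?_ ?_ ?_ <;> simp [hw1, hw2, hu1, hu2]
  · simp [hw1, hu1]
  · simp [hw1]
  · simp [hw1, hu1, h19]
  · have hp : par (a1 h i j) = sp h i j := by
      rcases h with e | e | p
      · exact absurd rfl (hh e)
      · rfl
      · rfl
    simp [Ex.ev, TreeData.up, hp, hw3.place]
  · exact Next.right (seg := [sp h i j]) hw3 (by simp)

/-- Creates the tree. -/
def treeCmd : Cmd :=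
  .seq (pushAll 5 [.c 0, .c 0, .c 1, .c 2]) <|
  .seq (.loop 10 (.sub (.add (.r 5) (.r 5)) (.c 1)) <| .loc 16 (.len 5) <| .seq (.push 5 (.c 0)) <|
    .seq (.loc 19 (.r 2) dstCmd)
      (.loop 0 (.get 6 (.add (.add (.r 10) (.r 10)) (.c 3))) (.push 5 (.r 16))))
  (.loop 10 (.half (.len 3)) <| .loc 16 (.len 5) <| .seq (.push 5 (.c 3)) <|
    .seq (.loc 19 (.get 3 (.add (.r 10) (.r 10))) srcCmd)
      (.loc 19 (.get 3 (.add (.add (.r 10) (.r 10)) (.c 1))) dstCmd))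

theorem place_ch {k : ℕ} (hk : k < 4) : D.place (ch k) = k := by
  interval_cases k
  · exact place_eq (pre := []) rfl
  · exact place_eq (pre := [ch 0]) rfl
  · exact place_eq (pre := [ch 0, ch 1]) rfl
  · exact place_eq (pre := [ch 0, ch 1, ch 2]) rfl

theorem does_treeCmd (hv : Ready D N v) (h5 : v.arr 5 = []) :
    Does N treeCmd v (v.app 5 (D.labs.map D.up)) := by
  have hs := hv.s_le
  have h0 : Next D v D.labs := ⟨[], [], by simp, by simp [h5]⟩
  have hch : ([ch 0, ch 1, ch 2, ch 3] : List Lab).map D.up = [0, 0, 1, 2] := by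
    simp [TreeData.up, par, place_ch]
  refine Grows.seq (seg := [ch 0, ch 1, ch 2, ch 3]) (D := D) ?_ (Grows.seq
    (Grows.loop ?_ (by omega : 2 * D.s - 1 ≤ N) (h0.right (by simp)).left
      fun p hp u hu1 hu2 hu3 => ?_)
    (Grows.loop ?_ hv.edges_le ((h0.right (u := v.app 5
      ([ch 0, ch 1, ch 2, ch 3].map D.up)) (by simp)).right (by simp; omega)) fun e he u hu1 hu2 hu3 => ?_))
  · rw [Grows, hch]
    exact Does.pushAll (by simp [Ex.Avoids]) rfl
  · simp [Ex.ev, hv.s]; omega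
  · have hr : Ready D N u := by
      refine hv.of_agree ?_ ?_ ?_ ?_ <;> simp [hu1, hu2]
    obtain ⟨g1, g2⟩ := hr.get_pow (k := 2 * p + 3) (by omega)
    have hpl := hu3.place
    refine Grows.loc rfl (Grows.seq (seg := [rul p]) (Grows.push ?_) (Grows.seq (Grows.loc rfl
      (grows_dstCmd (x := rul p) ?_ (by simp) (fun _ _ => rfl) ?_ ?_ ?_))
      (Grows.leaves (x := D.place (rul p)) ?_ g2 (fun _ => rfl) fun l k => ?_)))
    · simp [Ex.ev, TreeData.up, par, place_ch]
    · refine hr.of_agree ?_ ?_ ?_ ?_ <;> simp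
    · simp [Ex.ev, hr.start, num]
    · simp [Ex.ev, hpl]
    · exact (Next.right (seg := [rul p]) hu3 (by simp)).left
    · simp only [Ex.ev, Store.app_reg, Store.set_reg, Store.app_arr, Store.set_arr, if_true,
        Nat.reduceEqDiff, if_false, hu1, show p + p + 3 = 2 * p + 3 by ring]
      simpa using g1
    · simp [Ex.ev, hpl]
  · simp [Ex.ev, hv.edges]
  · have hr : Ready D N u := by
      refine hv.of_agree ?_ ?_ ?_ ?_ <;> simp [hu1, hu2]
    have hpl := hu3.place
    have g := getD_flat D.edges e
    refine Grows.loc rfl (Grows.seq (seg := [rc e]) (Grows.push ?_) (Grows.seq (Grows.loc rfl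
      (grows_srcCmd ?_ ?_ ?_ ?_)) (Grows.loc rfl
      (grows_dstCmd (x := rc e) ?_ (by simp) (fun _ _ => rfl) ?_ ?_ ?_))))
    · simp [Ex.ev, TreeData.up, par, place_ch]
    · refine hr.of_agree ?_ ?_ ?_ ?_ <;> simp
    · simp only [Ex.ev, Store.app_reg, Store.set_reg, Store.app_arr, Store.set_arr, if_true,
        Nat.reduceEqDiff, if_false, hu1, num]
      simpa [hr.edges] using g.1
    · simp [Ex.ev, hpl]
    · exact (Next.right (seg := [rc e]) hu3 (by simp)).left
    · refine hr.of_agree ?_ ?_ ?_ ?_ <;> simp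
    · simp only [Ex.ev, Store.app_reg, Store.set_reg, Store.app_arr, Store.set_arr, if_true,
        Nat.reduceEqDiff, if_false, hu1, num]
      simpa [hr.edges] using g.2
    · simp [Ex.ev, hpl]
    · exact (Next.right (seg := [rc e]) hu3 (u := u.app 5 ([rc e].map D.up)) (by simp)).right
        (by simp; omega)

end Tree

end LoopLang

/-! ### Computing the adjacency matrix and the formula -/

namespace LoopLang

open ParamComplexity FOC

/-- Appends the description of the tree to the output. -/
def adjCmd : Cmd :=
  .seq (.push 1 (.len 5)) <| .loop 10 (.len 5) <| .loop 11 (.len 5) <|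
    .ite (.neq (.r 10) (.r 11))
      (.ite (.neq (.get 5 (.r 10)) (.r 11))
        (.ite (.neq (.get 5 (.r 11)) (.r 10)) (.push 1 (.c 0)) (.push 1 (.c 1)))
        (.push 1 (.c 1)))
      (.push 1 (.c 0))

theorem does_adjCmd {N : ℕ} {v : Store} (D : TreeData) (h5 : v.arr 5 = D.labs.map D.up)
    (hN : D.labs.length ≤ N) : Does N adjCmd v (v.app 1 (graphWords D.labelling.graph)) := by
  classical
  have hfin : ∀ (n : ℕ) (f : ℕ → List ℕ),
      (List.finRange n).flatMap (fun u : Fin n => f u) = (List.range n).flatMap f := by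
    intro n f
    rw [show List.range n = (List.finRange n).map Fin.val by simp, List.flatMap_map]
  set n := D.labs.length with hn
  have hup : ∀ k, k < n → (D.labs.map D.up).getD k 0 = D.up (D.labs.getD k (.ch 0)) := by
    intro k hk
    rw [List.getD_eq_getElem _ _ (by simpa using hk), List.getElem_map,
      List.getD_eq_getElem _ _ hk]
  set A : ℕ → ℕ → ℕ := fun u w => if u ≠ w ∧ ((D.labs.map D.up).getD u 0 = w ∨
    (D.labs.map D.up).getD w 0 = u) then 1 else 0 with hA
  have hAdj : ∀ u w : Fin n, (if D.labelling.graph.Adj u w then 1 else 0) = A u w := by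
    intro u w
    have e : D.labelling.graph.Adj u w ↔ ((u : ℕ) ≠ w ∧ ((D.labs.map D.up).getD u 0 = w ∨
        (D.labs.map D.up).getD w 0 = u)) := by
      rw [hup _ u.2, hup _ w.2, List.getD_eq_getElem _ _ u.2, List.getD_eq_getElem _ _ w.2]
      simp only [TreeData.Labelling.graph, parentGraph, TreeData.labelling, Fin.ext_iff, ne_eq]
      rfl
    simp only [hA, e]
  have e : graphWords D.labelling.graph =
      [n] ++ (List.range n).flatMap fun u => (List.range n).flatMap fun w => [A u w] := by
    rw [graphWords, List.singleton_append, ← hfin]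
    congr 1
    refine List.flatMap_congr fun u _ => ?_
    rw [← hfin, List.map_eq_flatMap]
    refine List.flatMap_congr fun w _ => ?_
    rw [← hAdj]
  have hlen : (v.arr 5).length = n := by simp [h5, hn]
  rw [e]
  refine Does.seq_app (Does.push (by simp [Ex.ev, hlen])) ?_
  refine Does.loop_app _ (by simp [Ex.ev, hlen]) hN fun a _ u hu => ?_
  refine Does.loop_app _ (by rw [hu]; simp [Ex.ev, hlen]) hN fun b _ w hw => ?_
  have w10 : w.reg 10 = a := by rw [hw, hu]; simp
  have w11 : w.reg 11 = b := by rw [hw]; simp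
  have w5 : w.arr 5 = D.labs.map D.up := by rw [hw, hu]; simp [h5]
  refine Does.ite (fun h1 => Does.ite (fun h2 => Does.ite (fun h3 => ?_) fun h3 => ?_)
    fun h2 => ?_) fun h1 => ?_
  all_goals
    refine Does.push ?_
    simp only [Ex.ev, hA]
  · rw [Ex.ev_neq] at h1 h2 h3
    simp only [Ex.ev, w10, w11, w5] at h1 h2 h3
    rw [if_neg (by tauto)]
  · rw [Ex.ev_neq] at h1 h2
    rw [← not_ne_iff, Ex.ev_neq, not_ne_iff] at h3
    simp only [Ex.ev, w10, w11, w5] at h1 h2 h3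
    rw [if_pos (by tauto)]
  · rw [Ex.ev_neq] at h1
    rw [← not_ne_iff, Ex.ev_neq, not_ne_iff] at h2
    simp only [Ex.ev, w10, w11, w5] at h1 h2
    rw [if_pos (by tauto)]
  · rw [← not_ne_iff, Ex.ev_neq, not_ne_iff] at h1
    simp only [Ex.ev, w10, w11] at h1
    rw [if_neg (by tauto)]

/-- The word `x` of a formula, where `1000` stands for the content of register `8`, and `1001` and
`1002` stand for the values of the given expressions. -/
def holeEx (e e' : Ex) (x : ℕ) : Ex :=
  if x = 1000 then .r 8 else if x = 1001 then e else if x = 1002 then e' else .c x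

/-- Appends the formula `matchF`, whose variables are given by expressions. -/
def matchCmd (ρ : Rule) (e e' : Ex) : Cmd :=
  pushAll 1 ((matchF ρ 1000 1001 1002).words.map (holeEx e e'))

set_option maxRecDepth 4000 in
theorem does_matchCmd {N n x y : ℕ} {ρ : Rule} {e e' : Ex} {v : Store} (he : e.Avoids 1)
    (he' : e'.Avoids 1) (h8 : v.reg 8 = n) (hx : e.ev v = x) (hy : e'.ev v = y) :
    Does N (matchCmd ρ e e') v (v.app 1 (matchF ρ n x y).words) := by
  refine Does.pushAll ?_ ?_
  · intro a ha
    obtain ⟨k, -, rfl⟩ := List.mem_map.1 ha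
    simp only [holeEx]
    split_ifs <;> first | assumption | trivial
  · rw [List.map_map]
    have h0 : ∀ k, k < 1000 → (holeEx e e' k).ev v = k := by
      intro k hk
      simp only [holeEx]
      rw [if_neg (by omega), if_neg (by omega), if_neg (by omega)]
      rfl
    have h1 : (holeEx e e' 1000).ev v = n := h8
    have h2 : (holeEx e e' 1001).ev v = x := hx
    have h3 : (holeEx e e' 1002).ev v = y := hy
    have h4 : ¬ ((n : ℤ) < 0) := by omega
    cases ρ <;>
    simp [matchF, sameF, dstF, srcF, rulerF, hasLeafF, leafF, conj, FOC.xor, FOC.cmp, Formula.words,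
      Term.words, h0, h1, h2, h3, h4]

/-- The words of `playF` that belong to one move. -/
def moveWords (ρ : Rule) (N : ℤ) (b : Bool) (l : ℕ) : List ℕ :=
  (if b then [4, 20 + (l + 1), 2, 3, 2] else [2, 4, 20 + (l + 1), 2, 3, 2]) ++
    (matchF ρ N (20 + l) (20 + (l + 1))).words ++ if b then [2] else []

/-- The words of `playF` that belong to several moves. -/
def movesWords (ρ : Rule) (N : ℤ) : List Bool → ℕ → List ℕ
  | [], _ => []
  | b :: os, l => moveWords ρ N b l ++ movesWords ρ N os (l + 1)

theorem words_playF (ρ : Rule) (N : ℤ) : ∀ (os : List Bool) (l : ℕ), (playF ρ N os l).words =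
    movesWords ρ N os l ++ (finalF ρ N (l + os.length)).words
  | [], l => by simp [playF, movesWords]
  | b :: os, l => by
    have ih := words_playF ρ N os (l + 1)
    rw [show l + 1 + os.length = l + (b :: os).length by simp; omega] at ih
    cases b <;> simp [playF, movesWords, moveWords, Formula.words, ih]

theorem movesWords_append (ρ : Rule) (N : ℤ) : ∀ (os os' : List Bool) (l : ℕ),
    movesWords ρ N (os ++ os') l = movesWords ρ N os l ++ movesWords ρ N os' (l + os.length)
  | [], os', l => by simp [movesWords]
  | b :: os, os', l => by
    have ih := movesWords_append ρ N os os' (l + 1)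
    rw [show l + 1 + os.length = l + (b :: os).length by simp; omega] at ih
    simp [movesWords, ih]

/-- Register `20` holds the number of moves made so far. -/
def moveCmd (ρ : Rule) (b : Bool) : Cmd :=
  .seq (.seq (pushAll 1 (if b then [.c 4, .add (.c 20) (.add (.r 20) (.c 1)), .c 2, .c 3, .c 2]
      else [.c 2, .c 4, .add (.c 20) (.add (.r 20) (.c 1)), .c 2, .c 3, .c 2])) <|
    .seq (matchCmd ρ (.add (.c 20) (.r 20)) (.add (.c 20) (.add (.r 20) (.c 1))))
      (pushAll 1 (if b then [.c 2] else []))) <|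
  .set 20 (.add (.r 20) (.c 1))

/-- The command describes the given moves. -/
def Moves (ρ : Rule) (n N : ℕ) (P : Cmd) (v : Store) (os : List Bool) : Prop :=
  Does N P v ((v.app 1 (movesWords ρ n os (v.reg 20))).set 20 (v.reg 20 + os.length))

section Moves

variable {ρ : Rule} {n N : ℕ} {v : Store}

theorem Moves.nil : Moves ρ n N .skip v [] := by
  rw [Moves, movesWords, Store.app_nil, List.length_nil, Nat.add_zero, Store.set_reg_self]
  exact Does.skip

theorem Moves.move (b : Bool) (h8 : v.reg 8 = n) : Moves ρ n N (moveCmd ρ b) v [b] := by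
  refine (Does.seq (u := v.app 1 (moveWords ρ n b (v.reg 20))) ?_ (Does.set rfl)).congr
    (fun a => ?_) fun c => ?_
  · rw [moveWords, List.append_assoc]
    refine Does.seq_app ?_ (Does.seq_app (does_matchCmd ⟨trivial, trivial⟩
      ⟨trivial, trivial, trivial⟩ h8 rfl rfl) ?_)
    · cases b <;> exact Does.pushAll (by simp [Ex.Avoids]) rfl
    · cases b <;> exact Does.pushAll (by simp [Ex.Avoids]) rfl
  · simp [Ex.ev]
  · simp [movesWords]

theorem Moves.seq {P Q : Cmd} {os os' : List Bool} (h : Moves ρ n N P v os)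
    (h' : ∀ u : Store, (∀ a, a ≠ 20 → u.reg a = v.reg a) → (∀ b, b ≠ 1 → u.arr b = v.arr b) →
      Moves ρ n N Q u os') : Moves ρ n N (.seq P Q) v (os ++ os') := by
  refine (Does.seq h (h' _ (fun a ha => ?_) fun b hb => ?_)).congr (fun a => ?_) fun b => ?_
  · simp [ha]
  · simp [hb]
  · simp [Nat.add_assoc]
  · simp only [Store.set_reg, if_true, Store.set_app, Store.set_set, Store.app_app,
      movesWords_append, Store.set_arr]

theorem Moves.loop {P : Cmd} {i k : ℕ} {e : Ex} {os : ℕ → List Bool} (hi : i ≠ 20)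
    (he : e.ev v = k) (hk : k ≤ N)
    (h : ∀ j < k, ∀ u : Store, (∀ a, a ≠ 20 → u.reg a = if a = i then j else v.reg a) →
      (∀ b, b ≠ 1 → u.arr b = v.arr b) → Moves ρ n N P u (os j)) :
    Moves ρ n N (.loop i e P) v ((List.range k).flatMap os) := by
  refine Does.loop (fun j => (v.app 1 (movesWords ρ n ((List.range j).flatMap os) (v.reg 20))).set
    20 (v.reg 20 + ((List.range j).flatMap os).length)) he hk ?_ fun j hj => ⟨_, h j hj _ ?_ ?_, ?_⟩
  · simp [movesWords]
  · intro a ha; simp [ha]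
  · intro b hb; simp [hb]
  · rw [List.range_succ, List.flatMap_append, movesWords_append]
    refine Store.ext (funext fun a => ?_) (funext fun b => ?_)
    · simp only [Store.set_reg, Store.app_reg, Store.set_app]
      by_cases h1 : a = i
      · subst h1; simp [hi]
      · by_cases h2 : a = 20
        · subst h2; simp [hi.symm, Nat.add_assoc]
        · simp [h1, h2]
    · simp [hi.symm]

/-- Describes the moves of the blocks. -/
def blocksCmd (ρ : Rule) : Cmd :=
  .loop 12 (.r 22) (.loop 0 (.get 2 (.add (.add (.r 12) (.r 12)) (.c 2)))
    (.ite (.sub (.r 12) (.add (.half (.r 12)) (.half (.r 12)))) (moveCmd ρ false)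
      (moveCmd ρ true)))

theorem moves_blocksCmd {t : ℕ} (I : QBF t) (h8 : v.reg 8 = n) (hW : v.arr 2 = I.words)
    (h22 : v.reg 22 = I.blocks.length) (hN : I.size ≤ N) :
    Moves ρ n N (blocksCmd ρ) v (blockOwners 0 I.blocks) := by
  have hr : I.blocks.length ≤ I.size := by have := I.size_eq; omega
  rw [blockOwners_eq]
  refine Moves.loop (by norm_num) (by simp [Ex.ev, h22]) (hr.trans hN) fun i hi u hu1 hu2 => ?_
  have u12 : u.reg 12 = i := by rw [hu1 _ (by norm_num)]; simp
  have w2 := (words_block I hi).2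
  have hrep : ∀ (k : ℕ) (b : Bool), List.replicate k b = (List.range k).flatMap fun _ => [b] := by
    intro k b
    rw [flatMap_range_const k b (fun b => [b]), ← List.map_eq_flatMap, List.map_id']
  rw [hrep]
  refine Moves.loop (by norm_num) (by simp only [Ex.ev, u12, hu2 2 (by decide), hW, w2])
    ((block_le_size I i).2.trans hN) fun j _ w hw1 hw2 => ?_
  have w12 : w.reg 12 = i := by rw [hw1 _ (by norm_num)]; simp [u12]
  have x8 : w.reg 8 = n := by
    rw [hw1 _ (by norm_num), if_neg (by norm_num), hu1 _ (by norm_num), if_neg (by norm_num), h8]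
  refine Does.ite (fun h => ?_) fun h => ?_
  · simp only [Ex.ev, w12] at h
    have : ¬ Even (0 + i) := by rw [Nat.even_iff]; omega
    rw [decide_eq_false this]
    exact Moves.move false x8
  · simp only [Ex.ev, w12] at h
    have : Even (0 + i) := by rw [Nat.even_iff]; omega
    rw [decide_eq_true this]
    exact Moves.move true x8

/-- Describes given moves. -/
def movesCmd (ρ : Rule) : List Bool → Cmd
  | [] => .skip
  | b :: os => .seq (moveCmd ρ b) (movesCmd ρ os)

theorem moves_movesCmd : ∀ (os : List Bool) {v : Store}, v.reg 8 = n →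
    Moves ρ n N (movesCmd ρ os) v os
  | [], _, _ => Moves.nil
  | b :: os, _, h8 => (Moves.move b h8).seq (os := [b]) fun u hu _ =>
      moves_movesCmd os (by rw [hu _ (by norm_num), h8])

end Moves

/-- Describes that the edge `19` leads to a source of an edge chosen before. -/
def hitCmd (ρ : Rule) : Cmd :=
  .seq (.loop 10 (.r 20) (.seq (.push 1 (.c 3))
    (matchCmd ρ (.c 19) (.add (.c 20) (.sub (.r 20) (.r 10)))))) (pushAll 1 [.c 2, .c 0, .c 19, .c 19])

theorem words_hitF (ρ : Rule) (N : ℤ) : ∀ l, (hitF ρ N l).words =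
    (List.range l).flatMap (fun k => 3 :: (matchF ρ N 19 (20 + (l - k))).words) ++ [2, 0, 19, 19]
  | 0 => by simp [hitF, Formula.words]
  | l + 1 => by
    rw [List.range_succ_eq_map, List.flatMap_cons, List.flatMap_map]
    simp [hitF, Formula.words, words_hitF ρ N l]

theorem does_hitCmd {ρ : Rule} {N n l : ℕ} {v : Store} (h8 : v.reg 8 = n) (h20 : v.reg 20 = l)
    (hl : l ≤ N) : Does N (hitCmd ρ) v (v.app 1 (hitF ρ n l).words) := by
  rw [words_hitF]
  refine Does.seq_app (Does.loop_app _ (by simp [Ex.ev, h20]) hl fun k _ u hu => ?_)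
    (Does.pushAll (by simp [Ex.Avoids]) rfl)
  refine Does.seq_app (l := [3]) (Does.push rfl) (does_matchCmd trivial ⟨trivial, trivial, trivial⟩
    ?_ rfl ?_)
  · rw [hu]; simp [h8]
  · rw [hu]; simp [Ex.ev, h20]

/-- Appends the winning condition. -/
def finalCmd (ρ : Rule) : Cmd :=
  .seq (pushAll 1 [.c 3, .c 2, .c 3, .c 2, .c 4, .c 19, .c 2, .c 3, .c 2]) <|
  .seq (matchCmd ρ (.add (.c 20) (.r 20)) (.c 19)) <| .seq (.push 1 (.c 2)) <| .seq (hitCmd ρ) <|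
  .seq (pushAll 1 [.c 2, .c 2, .c 4, .c 19, .c 2, .c 3, .c 2]) <|
  .seq (matchCmd ρ (.add (.c 20) (.r 20)) (.c 19)) <| .seq (.push 1 (.c 2)) <|
  .seq (matchCmd ρ (.c 19) (.c 19)) <|
  .seq (pushAll 1 [.c 2, .c 3, .c 2, .c 2, .c 4, .c 19, .c 2, .c 3, .c 2]) <|
  .seq (matchCmd ρ (.add (.c 20) (.r 20)) (.c 19)) <| .seq (.push 1 (.c 2)) <| .seq (hitCmd ρ) <|
  .seq (pushAll 1 [.c 2, .c 4, .c 19, .c 2, .c 3, .c 2]) <|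
  .seq (matchCmd ρ (.add (.c 20) (.r 20)) (.c 19)) <| .seq (.push 1 (.c 2)) <|
  matchCmd ρ (.c 19) (.c 19)

theorem words_finalF (ρ : Rule) (N : ℤ) (l : ℕ) : (finalF ρ N l).words =
    [3, 2, 3, 2, 4, 19, 2, 3, 2] ++ ((matchF ρ N (20 + l) 19).words ++ ([2] ++
    ((hitF ρ N l).words ++ ([2, 2, 4, 19, 2, 3, 2] ++ ((matchF ρ N (20 + l) 19).words ++ ([2] ++
    ((matchF ρ N 19 19).words ++ ([2, 3, 2, 2, 4, 19, 2, 3, 2] ++ ((matchF ρ N (20 + l) 19).words ++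
    ([2] ++ ((hitF ρ N l).words ++ ([2, 4, 19, 2, 3, 2] ++ ((matchF ρ N (20 + l) 19).words ++ ([2] ++
    (matchF ρ N 19 19).words)))))))))))))) := by
  simp only [finalF, FOC.xor, conj, Formula.words, List.cons_append, List.nil_append, List.append_assoc]

theorem does_finalCmd {ρ : Rule} {N n l : ℕ} {u : Store} (u8 : u.reg 8 = n) (u20 : u.reg 20 = l)
    (hN : l ≤ N) : Does N (finalCmd ρ) u (u.app 1 (finalF ρ n l).words) := by
  rw [words_finalF]
  have p : ∀ (es : List Ex) (w : Store) (l : List ℕ), (∀ e ∈ es, e.Avoids 1) →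
      es.map (fun e => e.ev w) = l → Does N (pushAll 1 es) w (w.app 1 l) :=
    fun es w l h h' => Does.pushAll h h'
  have m : ∀ w : Store, w.reg 8 = n → w.reg 20 = l →
      Does N (matchCmd ρ (.add (.c 20) (.r 20)) (.c 19)) w
        (w.app 1 (matchF ρ n (20 + l) 19).words) := fun w h h' =>
    does_matchCmd ⟨trivial, trivial⟩ trivial h (by simp [Ex.ev, h']) rfl
  have m' : ∀ w : Store, w.reg 8 = n →
      Does N (matchCmd ρ (.c 19) (.c 19)) w (w.app 1 (matchF ρ n 19 19).words) := fun w h =>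
    does_matchCmd trivial trivial h rfl rfl
  have hh : ∀ w : Store, w.reg 8 = n → w.reg 20 = l →
      Does N (hitCmd ρ) w (w.app 1 (hitF ρ n l).words) := fun w h h' => does_hitCmd h h' hN
  exact Does.seq_app (p _ _ _ (by simp [Ex.Avoids]) rfl) <| Does.seq_app (m _ u8 u20) <|
    Does.seq_app (Does.push rfl) <| Does.seq_app (hh _ u8 u20) <|
    Does.seq_app (p _ _ _ (by simp [Ex.Avoids]) rfl) <| Does.seq_app (m _ u8 u20) <|
    Does.seq_app (Does.push rfl) <| Does.seq_app (m' _ u8) <|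
    Does.seq_app (p _ _ _ (by simp [Ex.Avoids]) rfl) <| Does.seq_app (m _ u8 u20) <|
    Does.seq_app (Does.push rfl) <| Does.seq_app (hh _ u8 u20) <|
    Does.seq_app (p _ _ _ (by simp [Ex.Avoids]) rfl) <| Does.seq_app (m _ u8 u20) <|
    Does.seq_app (Does.push rfl) (m' _ u8)

/-- Appends the sentence; `os` are the moves behind those of the blocks. -/
def gameCmd (ρ : Rule) (os : List Bool) : Cmd :=
  .seq (pushAll 1 (([4, 20, 2, 3, 2] ++ (rulerF 20).words ++ [2]).map .c)) <|
  .seq (.seq (.set 20 (.c 0)) (.seq (blocksCmd ρ) (movesCmd ρ os))) (finalCmd ρ)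

theorem does_gameCmd {ρ : Rule} {N n t : ℕ} {v : Store} {os : List Bool} (I : QBF t)
    (h8 : v.reg 8 = n) (hW : v.arr 2 = I.words) (h22 : v.reg 22 = I.blocks.length)
    (hN : I.size ≤ N) (hN' : (blockOwners 0 I.blocks ++ os).length ≤ N) :
    Does N (gameCmd ρ os) v ((v.app 1 (gameF ρ n (blockOwners 0 I.blocks ++ os)).words).set 20
      (blockOwners 0 I.blocks ++ os).length) := by
  set l := (blockOwners 0 I.blocks ++ os).length with hl
  set l1 := [4, 20, 2, 3, 2] ++ (rulerF 20).words ++ [2] with hl1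
  set l2 := movesWords ρ n (blockOwners 0 I.blocks ++ os) 0 with hl2
  have d1 : Does N (pushAll 1 (l1.map .c)) v (v.app 1 l1) := by
    refine Does.pushAll (fun e he => ?_) (by simp [Function.comp_def, Ex.ev])
    obtain ⟨k, -, rfl⟩ := List.mem_map.1 he
    trivial
  have d2 : Moves ρ n N (.seq (blocksCmd ρ) (movesCmd ρ os)) ((v.app 1 l1).set 20 0)
      (blockOwners 0 I.blocks ++ os) := by
    refine (moves_blocksCmd I (by simpa using h8) (by simpa using hW) (by simpa using h22)
      hN).seq fun u hu _ => moves_movesCmd os ?_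
    rw [hu _ (by norm_num)]; simpa using h8
  have d3 : Does N (.seq (.set 20 (.c 0)) (.seq (blocksCmd ρ) (movesCmd ρ os))) (v.app 1 l1)
      (((v.app 1 l1).app 1 l2).set 20 l) := by
    refine (Does.seq (u := (v.app 1 l1).set 20 0) (Does.set rfl) d2).congr (fun a => ?_) fun b => ?_
    · simp [hl]
    · simp [hl2]
  have e : (gameF ρ n (blockOwners 0 I.blocks ++ os)).words = l1 ++ (l2 ++ (finalF ρ n l).words) := by
    have := words_playF ρ n (blockOwners 0 I.blocks ++ os) 0
    rw [Nat.zero_add, ← hl, ← hl2] at this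
    simp only [gameF, conj, Formula.words, this, hl1, List.cons_append, List.nil_append,
      List.append_assoc]
  refine (d1.seq (d3.seq (does_finalCmd (by simpa using h8) (by simp) hN'))).congr (fun a => ?_)
    fun b => ?_
  · simp
  · simp only [Store.set_app, Store.app_app, e, List.append_assoc]

end LoopLang

/-! ### The reduction -/

namespace LoopLang

open ParamComplexity FOC

/-- Turns the encoding of an instance in the array `0` into the input of the model checker, which
is written to the array `1`.  The other arrays hold the instance as a list of numbers (`2`), the
edges (`3`) and the layers (`4`) of the game, the parents of the vertices of the tree (`5`), and the
powers of `M` (`6`).  Register `2` holds the start vertex of the game, register `5` the number `s`,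
register `8` the number in the counting terms, and register `22` the number of blocks. -/
def reduceCmd (ρ : Rule) (t : ℕ) : Cmd :=
  .seq decodeCmd <| .seq (.set 2 (.add (.len 0) (.c 1))) <| .seq (.set 22 (.get 2 (.c 0))) <|
  .seq sideCmd <| .seq powersCmd <| .seq layersCmd <| .seq (edgesCmd t) <| .seq treeCmd <|
  .seq adjCmd (gameCmd ρ (true :: levelOwners t true))

/-- A bound for the number of vertices of the tree.  The last factor bounds `M ^ (4 * s + 2)`, which
is at most `(2 ^ (s * s)) ^ 48`. -/
def sizeBound (l : ℕ) : ℕ := 32 * (l + 3) ^ 4 * (2 ^ 9 * (l + 3) ^ 8) ^ 48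

variable {t : ℕ} (I : QBF t)

theorem le_sizeBound (l : ℕ) : 32 * (l + 3) ≤ sizeBound l := by
  have h1 : l + 3 ≤ (l + 3) ^ 4 := Nat.le_self_pow (by norm_num) _
  have h2 : 0 < (2 ^ 9 * (l + 3) ^ 8) ^ 48 := by positivity
  rw [sizeBound]
  generalize (2 ^ 9 * (l + 3) ^ 8) ^ 48 = x at h2
  nlinarith [Nat.mul_le_mul (Nat.mul_le_mul_left 32 h1) (show 1 ≤ x from h2)]

theorem pow_sideLength_le (l : ℕ) : (2 ^ (8 * sideLength l)) ^ (4 * sideLength l + 2) ≤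
    (2 ^ 9 * (l + 3) ^ 8) ^ 48 := by
  have hs : 3 ≤ sideLength l := three_le_growth _ _
  have h := two_pow_sideLength_le l
  generalize sideLength l = s at *
  generalize 2 ^ 9 * (l + 3) ^ 8 = x at *
  calc (2 ^ (8 * s)) ^ (4 * s + 2) = 2 ^ (8 * s * (4 * s + 2)) := by rw [← pow_mul]
    _ ≤ 2 ^ (s * s * 48) := Nat.pow_le_pow_right (by norm_num) (by nlinarith)
    _ = (2 ^ (s * s)) ^ 48 := by rw [← pow_mul]
    _ ≤ _ := Nat.pow_le_pow_left h _

theorem edges_mul_pow_le : 32 * I.edges.length *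
    (2 ^ (8 * sideLength I.size)) ^ (4 * sideLength I.size + 2) ≤ sizeBound I.size := by
  have h1 := I.length_edges
  have h2 := pow_sideLength_le I.size
  rw [sizeBound]
  generalize (2 ^ (8 * sideLength I.size)) ^ (4 * sideLength I.size + 2) = x at h2 ⊢
  generalize (2 ^ 9 * (I.size + 3) ^ 8) ^ 48 = y at h2 ⊢
  gcongr

theorem length_labs_tree_le {s : ℕ} (hD : (I.tree s).Good) :
    (I.tree s).labs.length ≤ 32 * I.edges.length * (2 ^ (8 * s)) ^ (4 * s + 2) :=
  TreeData.length_labs hD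

theorem length_labs_le : (I.tree (sideLength I.size)).labs.length ≤ sizeBound I.size := by
  have h1 := length_labs_tree_le I
    (I.good_tree (three_le_growth _ _) (sq_le_two_pow_sideLength I.size))
  have h2 := edges_mul_pow_le I
  exact h1.trans h2

theorem does_reduceCmd {ρ : Rule} {v : Store} {N s : ℕ} (hs : sideLength I.size = s)
    (h0 : v.arr 0 = ((QBFSAT t).encode I).map Bool.toNat) (hv : ∀ b, b ≠ 0 → v.arr b = [])
    (h1 : v.reg 1 = 0) (hE : I.edges.length ≤ N) (hP : (2 ^ (8 * s)) ^ (4 * s + 2) ≤ N)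
    (hlN : 2 * I.size + 13 ≤ N) (how : I.owners.length ≤ N)
    (hlabs : (I.tree s).labs.length ≤ N) :
    ∃ w, Does N (reduceCmd ρ t) v w ∧ w.arr 1 = FOC.inputWords (I.tree s).labelling.graph
      (gameF ρ (((I.tree s).M ^ (4 * s + 2) : ℕ) : ℤ) I.owners) := by
  have hs3 : 3 ≤ s := hs ▸ three_le_growth _ _
  have hM1 : 8 * s + 1 ≤ 2 ^ (8 * s) := Nat.lt_two_pow_self
  have hM2 : (2 ^ (8 * s)) ^ 2 ≤ N := (Nat.pow_le_pow_right (by omega) (by omega)).trans hP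
  have hM3 : 8 * s + 2 ≤ N ∧ 2 ^ (8 * s) ≤ N := by
    generalize 2 ^ (8 * s) = M at hM1 hM2
    constructor <;> nlinarith
  have hP' : (2 ^ (8 * s)) ^ (4 * s) ≤ N :=
    (Nat.pow_le_pow_right (by omega) (by omega)).trans hP
  have hM0 : (I.tree s).M = 2 ^ (8 * s) := rfl
  have hl0 : (v.arr 0).length = I.size := by rw [h0, List.length_map]; rfl
  set v1 := v.app 2 I.words with hv1
  have d1 : Does N decodeCmd v v1 := does_decodeCmd h0 h1 (by change I.size ≤ N; omega)
  set v2 := v1.set 2 (I.size + 1) with hv2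
  have d2 : Does N (.set 2 (.add (.len 0) (.c 1))) v1 v2 := Does.set (by simp [Ex.ev, hv1, hl0])
  set v3 := v2.set 22 I.blocks.length with hv3
  have d3 : Does N (.set 22 (.get 2 (.c 0))) v2 v3 := by
    refine Does.set ?_
    simp only [Ex.ev, hv2, hv1, Store.set_arr, Store.app_arr, if_true, hv 2 (by decide),
      List.nil_append]
    rfl
  obtain ⟨x, y, z, d4⟩ := does_sideCmd (N := N) (v := v3) (l := I.size) (by simp [hv3, hv2, hv1, hl0])
    (by omega)
  rw [hs] at d4
  set v4 := (((v3.set 4 x).set 21 y).set 5 s).set 7 z with hv4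
  have d5 := does_powersCmd (N := N) (v := v4) (s := s) (by simp [hv4])
    (by simp [hv4, hv3, hv2, hv1, hv]) hM3.2 hM3.1
  set v5 := ((v4.set 6 (2 ^ (8 * s))).app 6
      ((List.range (4 * s + 3)).map fun k => (2 ^ (8 * s)) ^ k)).set 8
        ((2 ^ (8 * s)) ^ (4 * s + 2)) with hv5
  have a5 : v5.arr 2 = I.words := by simp [hv5, hv4, hv3, hv2, hv1, hv]
  have d6 := does_layersCmd (N := N) (v := v5) I a5 (by simp [hv5, hv4, hv3]) (by omega)
  set v6 := v5.app 4 (flat I.layers) with hv6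
  obtain ⟨x', d7⟩ := does_edgesCmd (N := N) (v := v6) I (by simp [hv6, a5])
    (by simp [hv6, hv5, hv4, hv3, hv2, hv1, hv]) (by simp [hv6, hv5, hv4, hv3, hv2])
    (by simp [hv6, hv5, hv4, hv3]) (by omega)
  set v7 := (v6.app 3 (flat I.edges)).set 3 x' with hv7
  have hready : Ready (I.tree s) N v7 := by
    refine ⟨?_, ?_, ?_, ?_, ?_, ?_, hP', hE⟩
    · simp [hv7, hv6, hv5, hv4]; rfl
    · simp [hv7, hv6, hv5, hv4, hv3, hv2]; rfl
    · simp [hv7, hv6, hv5, hv4, hv3, hv2, hv1, hv]; rfl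
    · simp [hv7, hv6, hv5, hv4, hv3, hv2, hv1, hv]; rfl
    · change 2 * s ≤ N; omega
    · rw [hM0]; omega
  have d8 := does_treeCmd hready (by simp [hv7, hv6, hv5, hv4, hv3, hv2, hv1, hv])
  set v8 := v7.app 5 ((I.tree s).labs.map (I.tree s).up) with hv8
  have d9 := does_adjCmd (N := N) (v := v8) (I.tree s)
    (by simp [hv8, hv7, hv6, hv5, hv4, hv3, hv2, hv1, hv]) (by omega)
  set v9 := v8.app 1 (graphWords (I.tree s).labelling.graph) with hv9
  have d10 := does_gameCmd (N := N) (v := v9) (ρ := ρ) (n := (I.tree s).M ^ (4 * s + 2))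
    (os := true :: levelOwners t true) I
    (by simp [hv9, hv8, hv7, hv6, hv5, hM0]) (by simp [hv9, hv8, hv7, hv6, a5])
    (by simp [hv9, hv8, hv7, hv6, hv5, hv4, hv3]) (by omega) how
  refine ⟨_, d1.seq <| d2.seq <| d3.seq <| d4.seq <| d5.seq <| d6.seq <| d7.seq <| d8.seq <|
    d9.seq d10, ?_⟩
  simp [hv9, hv8, hv7, hv6, hv5, hv4, hv3, hv2, hv1, hv, FOC.inputWords, QBF.owners]

theorem exists_does_reduceCmd {ρ : Rule} {v : Store}
    (h0 : v.arr 0 = ((QBFSAT t).encode I).map Bool.toNat) (hv : ∀ b, b ≠ 0 → v.arr b = [])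
    (h1 : v.reg 1 = 0) :
    ∃ w, Does (sizeBound I.size + t) (reduceCmd ρ t) v w ∧
      w.arr 1 = FOC.inputWords (I.tree (sideLength I.size)).labelling.graph
        (gameF ρ (((I.tree (sideLength I.size)).M ^ (4 * sideLength I.size + 2) : ℕ) : ℤ)
          I.owners) := by
  have hl := le_sizeBound I.size
  have hx := edges_mul_pow_le I
  have hlabs := length_labs_le I
  have hE : 1 ≤ I.edges.length := by simp [QBF.edges, gameEdges]
  have hx0 : 0 < (2 ^ (8 * sideLength I.size)) ^ (4 * sideLength I.size + 2) := by positivity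
  refine does_reduceCmd I rfl h0 hv h1 ?_ ?_ (by omega) ?_ (by omega)
  · generalize (2 ^ (8 * sideLength I.size)) ^ (4 * sideLength I.size + 2) = x at hx hx0
    nlinarith
  · generalize (2 ^ (8 * sideLength I.size)) ^ (4 * sideLength I.size + 2) = x at hx hx0 ⊢
    nlinarith
  · have := I.length_owners
    have := I.size_eq
    omega

end LoopLang

/-! ### Running a reduction and a model checker one after the other -/

namespace RAM

open LoopLang

/-- Runs the program `R`, then the command `C` on the output of `R` as array `0`, and then the
program `P` on the array `1`. -/
def compose (R : Prog) (C : Cmd) (P : Prog) : Prog :=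
  .seq (.seq moveInput (R.relocate 6 0)) <| .seq (.seq (.const 10 0) (.add 1 6 10)) <|
  .seq (C.compile 0) <| .seq (.seq (.const 10 0) (.add 7 9 10)) <|
  .seq (P.relocate 7 1) (.seq (.const 10 0) (.add 0 7 10))

/-- The store that holds `u` in the array `0`. -/
def initStore (u : List ℕ) : Store := ⟨fun _ => 0, fun b => if b = 0 then u else []⟩

theorem compose_returns {R P : Prog} {C : Cmd} {w u : List ℕ} {tR tP N a : ℕ} {v : Store}
    (hR : Writes R w tR u) (hC : Does N C (initStore u) v) (hP : Returns P (v.arr 1) tP a) :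
    ∃ t, Returns (compose R C P) w t a ∧
      t ≤ 12 * (w.length + 1) + 6 * tR + (2 + (C.cost N + (2 + (6 * tP + 2)))) := by
  obtain ⟨u1, hR1, hR2, hR3⟩ := hR
  obtain ⟨u2, hP1, hP2⟩ := hP
  suffices h : Runs (compose R C P) (init w)
      (12 * (w.length + 1) + 6 * tR + ((1 + 1) + (C.cost N + ((1 + 1) + (6 * tP + (1 + 1))))))
      fun s => s.reg 0 = a by
    obtain ⟨t, s, h1, h2, h3⟩ := h
    exact ⟨t, ⟨s, h1, h3⟩, by omega⟩
  refine Runs.seq ((Runs.seq ((moveInput_runs w).mono le_rfl fun s0 h0 =>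
    (hR1.relocate (by norm_num) (by norm_num) (by norm_num) s0 h0.1).mono le_rfl
      (Q' := fun s => (s.reg 6 = u.length ∧ ∀ a (h : a < u.length), s.mem (8 * a) = u[a]) ∧
        (∀ i, i % 8 ≠ 6 → i % 8 ≠ 2 → s.reg i = 0) ∧ ∀ a, a % 8 ≠ 0 → s.mem a = 0)
      fun s h => ?_)).mono le_rfl fun s1 h1 => ?_)
  · refine ⟨⟨?_, fun a ha => ?_⟩, fun i hi hi' => ?_, fun a ha => ?_⟩
    · rw [← hR2]; exact h.1.1 0
    · rw [← hR3 a ha]; exact h.1.2 a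
    · rw [h.2.1 i hi hi', h0.2.1 i hi hi']
    · rw [h.2.2 a ha, h0.2.2 a ha]
  obtain ⟨⟨h1, h2⟩, h3, h4⟩ := h1
  refine Runs.seq (Runs.seq <| Runs.const <| Runs.add ?_)
  have hrep : Rep (((s1.setReg 10 0)).setReg 1
      ((s1.setReg 10 0).reg 6 + (s1.setReg 10 0).reg 10)) (initStore u) := by
    refine ⟨fun i => ?_, fun b => ?_, fun i => ?_, fun b a ha => ?_, fun b a hb _ => ?_⟩
    · simp only [State.setReg_reg]
      rw [if_neg (by omega), if_neg (by omega), h3 _ (by omega) (by omega)]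
      rfl
    · by_cases hb : b = 0
      · subst hb
        simp [initStore, h1]
      · have hb' : (b : ℕ) ≠ 0 := fun h => hb (Fin.ext h)
        simp only [State.setReg_reg]
        rw [if_neg (by omega), if_neg (by omega), h3 _ (by omega) (by omega)]
        simp [initStore, hb]
    · simp only [State.setReg_reg]
      rw [if_neg (by omega), if_neg (by omega), h3 _ (by omega) (by omega)]
    · by_cases hb : b = 0
      · subst hb
        have ha : a < u.length := ha
        simp only [State.setReg_mem]
        change s1.mem (8 * a) = u.getD a 0
        rw [h2 a ha, List.getD_eq_getElem _ _ ha]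
      · simp [initStore, hb] at ha
    · have hb' : (b : ℕ) ≠ 0 := fun h => hb (Fin.ext h)
      have := b.2
      simp only [State.setReg_mem]
      exact h4 _ (by omega)
  refine Runs.seq ((Cmd.compile_runs C 0 _ _ hrep hC.2).mono le_rfl fun s2 h5 => ?_)
  rw [hC.1] at h5
  obtain ⟨-, r2, r3, r4, r5⟩ := h5.1
  refine Runs.seq (Runs.seq <| Runs.const <| Runs.add ?_)
  have hsim : Sim 7 1 (((s2.setReg 10 0)).setReg 7
      ((s2.setReg 10 0).reg 9 + (s2.setReg 10 0).reg 10)) (init (v.arr 1)) := by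
    refine ⟨fun i => ?_, fun a => ?_⟩
    · by_cases hi : i = 0
      · subst hi
        simp only [State.setReg_reg, init]
        have := r2 1
        simpa using this
      · simp only [State.setReg_reg, init]
        rw [if_neg (by omega), if_neg (by omega), if_neg hi, r3]
    · simp only [State.setReg_mem, init]
      rcases lt_or_ge a (v.arr 1).length with ha | ha
      · exact r4 1 a ha
      · rw [List.getD_eq_default _ _ ha]
        exact r5 1 a (by decide) ha
  refine Runs.seq ((hP1.relocate (by norm_num) (by norm_num) (by norm_num) _ hsim).mono le_rfl
    fun s3 h6 => ?_)
  refine Runs.seq <| Runs.const <| Runs.add ?_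
  have := h6.1.1 0
  simp only [State.setReg_reg, if_true]
  rw [if_neg (by norm_num), Nat.add_zero, ← hP2, ← this]

end RAM

/-! ### Time bounds -/

namespace ParamComplexity

/-- The function is bounded by `f(k) · |x|^c` for some function `f` and constant `c`. -/
def FPTBounded (T : List Bool × ℕ → ℕ) : Prop :=
  ∃ (f : ℕ → ℕ) (c : ℕ), ∀ p, T p ≤ f p.2 * (p.1.length + 1) ^ c

namespace FPTBounded

variable {T T' : List Bool × ℕ → ℕ}

theorem param (g : ℕ → ℕ) : FPTBounded fun p => g p.2 := ⟨g, 0, fun p => by simp⟩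

theorem const (k : ℕ) : FPTBounded fun _ => k := param fun _ => k

theorem length : FPTBounded fun p => p.1.length :=
  ⟨fun _ => 1, 1, fun p => by simp⟩

theorem add (h : FPTBounded T) (h' : FPTBounded T') : FPTBounded fun p => T p + T' p := by
  obtain ⟨f, c, h⟩ := h
  obtain ⟨f', c', h'⟩ := h'
  refine ⟨fun k => f k + f' k, c + c', fun p => ?_⟩
  rw [Nat.add_mul]
  refine Nat.add_le_add ((h p).trans ?_) ((h' p).trans ?_)
  · exact Nat.mul_le_mul_left _ (Nat.pow_le_pow_right (by omega) (by omega))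
  · exact Nat.mul_le_mul_left _ (Nat.pow_le_pow_right (by omega) (by omega))

theorem mul (h : FPTBounded T) (h' : FPTBounded T') : FPTBounded fun p => T p * T' p := by
  obtain ⟨f, c, h⟩ := h
  obtain ⟨f', c', h'⟩ := h'
  refine ⟨fun k => f k * f' k, c + c', fun p => (Nat.mul_le_mul (h p) (h' p)).trans_eq ?_⟩
  rw [pow_add]; ring

theorem pow (h : FPTBounded T) (k : ℕ) : FPTBounded fun p => T p ^ k := by
  induction k with
  | zero => simpa using const 1
  | succ k ih => simpa only [pow_succ] using ih.mul h

theorem cost (h : FPTBounded T) (C : LoopLang.Cmd) : FPTBounded fun p => C.cost (T p) := by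
  induction C with
  | skip => exact const 1
  | set i e => exact const (e.cost + 2)
  | push b e => exact const (e.cost + 8)
  | seq P Q hP hQ => exact hP.add hQ
  | ite e P Q hP hQ => exact ((const e.cost).add (hP.add hQ)).add (const 1)
  | loop i e P hP =>
    exact (const (e.cost + 4)).add ((h.mul ((hP.add (const 7)).add (const 1))).add (const 1))
  | loc i e P hP => exact ((const e.cost).add hP).add (const 5)

end FPTBounded

theorem fptBounded_sizeBound {T : List Bool × ℕ → ℕ} (h : FPTBounded T) :
    FPTBounded fun p => LoopLang.sizeBound (T p) :=
  ((FPTBounded.const 32).mul ((h.add (.const 3)).pow 4)).mul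
    (((FPTBounded.const (2 ^ 9)).mul ((h.add (.const 3)).pow 8)).pow 48)

/-! ### From model checking to deciding -/

/-- A model checker with the given properties decides every problem in `AW[t]`, since the
reduction produces stable sentences and the model checker then has to give the true answer. -/
theorem mem_FPT_of_modelChecker {ρ : FOC.Rule} {P : RAM.Prog} {f : ℕ → ℕ} {c : ℕ}
    (hP : ∀ φ : FOC.Formula, FOC.Fragment ρ φ → φ.IsSentence →
      ∀ (n : ℕ) (T : SimpleGraph (Fin n)), FOC.IsTreeOfDepth T 9 →
      ∃ (t : ℕ) (a : FOC.Answer),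
        RAM.Returns P (FOC.inputWords T φ) t a.code ∧
        t ≤ f φ.length * n ^ c ∧
        (a = .one → FOC.Models T φ) ∧
        (a = .zero → ¬ FOC.Models T φ) ∧
        (a = .bot → FOC.Unstable (2 ^ Real.sqrt (Real.logb 2 n)) T φ))
    {t : ℕ} {L : Problem} (hL : L ∈ AW t) : L ∈ FPT := by
  obtain ⟨R, Q, fR, g, cR, hR⟩ := hL
  have hsize : FPTBounded fun p => (R p).size := by
    refine ⟨fR, cR, fun p => ?_⟩
    obtain ⟨-, -, tR, -, h⟩ := hR p
    exact (Nat.le_add_left _ _).trans h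
  -- The length of the sentence is bounded in terms of the parameter; since `f` need not be
  -- monotone, its values up to this bound are added up.
  set len : ℕ → ℕ := fun k =>
    (2 * (g k + 1 + t) + 4) * (2 * (FOC.matchF ρ 0 0 0).length + 20) + 100 with hlen
  set F : ℕ → ℕ := fun k => ∑ i ∈ Finset.range (len k + 1), f i with hF
  have hbd : FPTBounded fun p => 12 * (p.1.length + 1 + 1) +
      6 * (fR p.2 * (p.1.length + 1) ^ cR) +
      (2 + ((LoopLang.reduceCmd ρ t).cost (LoopLang.sizeBound (R p).size + t) +
        (2 + (6 * (F p.2 * LoopLang.sizeBound (R p).size ^ c) + 2)))) := by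
    have hN := fptBounded_sizeBound hsize
    have h1 : FPTBounded fun p => fR p.2 * (p.1.length + 1) ^ cR := ⟨fR, cR, fun p => le_rfl⟩
    exact (((FPTBounded.const 12).mul ((FPTBounded.length.add (.const 1)).add (.const 1))).add
      ((FPTBounded.const 6).mul h1)).add ((FPTBounded.const 2).add (((hN.add (.const t)).cost
      (LoopLang.reduceCmd ρ t)).add ((FPTBounded.const 2).add (((FPTBounded.const 6).mul
      ((FPTBounded.param F).mul (hN.pow c))).add (.const 2)))))
  obtain ⟨fT, cT, hT⟩ := hbd
  refine ⟨RAM.compose Q (LoopLang.reduceCmd ρ t) P, fT, cT, fun p => ?_⟩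
  obtain ⟨hp, hparam, tR, hW, htR⟩ := hR p
  obtain ⟨w, hdoes, hw⟩ := LoopLang.exists_does_reduceCmd (R p) (ρ := ρ)
    (v := RAM.initStore (((QBFSAT t).encode (R p)).map Bool.toNat)) rfl
    (fun b hb => if_neg hb) rfl
  have hnum := LoopLang.length_labs_le (R p)
  obtain ⟨h1, h2, h3⟩ := (R p).tree_spec ρ (LoopLang.three_le_growth _ _)
    (LoopLang.sq_le_two_pow_sideLength (R p).size)
  set s := LoopLang.sideLength (R p).size with hs
  set φ := FOC.gameF ρ ((((R p).tree s).M ^ (4 * s + 2) : ℕ) : ℤ) (R p).owners with hφ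
  obtain ⟨tP, a, hret, htP, ha1, ha2, ha3⟩ := hP φ (FOC.Fragment.gameF _)
    (FOC.isSentence_gameF _) _ ((R p).tree s).labelling.graph h1
  rw [← hw] at hret
  obtain ⟨tt, hRet, htt⟩ := RAM.compose_returns hW hdoes hret
  have hφlen : φ.length ≤ len p.2 := by
    refine (FOC.length_gameF _).trans ?_
    have ho : (R p).owners.length ≤ g p.2 + 1 + t := by
      have h4 := (R p).length_owners
      have h5 : (R p).blocks.length + ((R p).blocks.map Prod.snd).sum ≤ g p.2 := hparam
      omega
    simp only [hlen]
    gcongr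
  have hf : f φ.length ≤ F p.2 :=
    Finset.single_le_sum (f := f) (fun _ _ => Nat.zero_le _) (by simp; omega)
  have htP' : tP ≤ F p.2 * LoopLang.sizeBound (R p).size ^ c :=
    htP.trans (Nat.mul_le_mul hf (Nat.pow_le_pow_left hnum c))
  refine ⟨tt, a.code, hRet, htt.trans (le_trans ?_ (hT p)), fun hL => ?_, fun hL => ?_⟩
  · have hlw : (inputWords p).length = p.1.length + 1 := by simp [inputWords]
    rw [hlw]
    have htR' : tR ≤ fR p.2 * (p.1.length + 1) ^ cR := by omega
    beta_reduce
    gcongr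
  · have hm := h2.2 (hp.1 hL)
    cases a with
    | one => rfl
    | zero => exact absurd hm (ha2 rfl)
    | bot => exact absurd h3 (ha3 rfl)
  · have hm := fun h => hL (hp.2 (h2.1 h))
    cases a with
    | one => exact absurd (ha1 rfl) hm
    | zero => rfl
    | bot => exact absurd h3 (ha3 rfl)

end ParamComplexity

theorem mainTheorem7 (ρ : FOC.Rule)
    (hAW : ¬ ParamComplexity.AWStar ⊆ ParamComplexity.FPT) :
    ¬ ∃ (P : RAM.Prog) (f : ℕ → ℕ) (c : ℕ),
      ∀ φ : FOC.Formula, FOC.Fragment ρ φ → φ.IsSentence →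
      ∀ (n : ℕ) (T : SimpleGraph (Fin n)), FOC.IsTreeOfDepth T 9 →
      ∃ (t : ℕ) (a : FOC.Answer),
        RAM.Returns P (FOC.inputWords T φ) t a.code ∧
        t ≤ f φ.length * n ^ c ∧
        (a = .one → FOC.Models T φ) ∧
        (a = .zero → ¬ FOC.Models T φ) ∧
        (a = .bot → FOC.Unstable (2 ^ Real.sqrt (Real.logb 2 n)) T φ) := by
  rintro ⟨P, f, c, hP⟩
  exact hAW fun L ⟨t, _, hL⟩ => ParamComplexity.mem_FPT_of_modelChecker hP hL
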